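/- The parameterized Directed Feedback Vertex Set problem is the following. Given a directed graph $G$ with $n$ vertices (loops and pairs of opposite edges are allowed) and an integer $k\ge 0$, find a set $S$ of at most $k$ vertices such that every directed cycle of $G$ contains a vertex of $S$, or answer NO if there is no such set. This problem is fixed-parameter tractable, that is, it can be solved in time $g(k)\cdot p(n)$ for some function $g$ and some polynomial $p$ that does not depend on $k$. More precisely, it can be solved in time $$O\bigl(8^k\, k!\cdot \mathrm{poly}(n)\bigr),$$ where $\mathrm{poly}(n)$ is a polynomial in $n$ that does not depend on $k$: there are a single algorithm and a polynomial $p$ such that, for all $n\ge 0$, all $k\ge 0$ and all directed graphs $G$ with vertex set $\{0,\dots,n-1\}$, given by $n$, $k$ and the adjacency matrix of $G$, the algorithm halts with a correct answer after at most $8^k\, k!\, p(n)$ steps. Here an algorithm is a program for a random access machine with unit cost that has registers and an indirectly addressed memory, both with entries in $\mathbb{N}$, and whose elementary instructions are: assigning a constant, copying, successor, predecessor, loading from memory, storing to memory, and comparing two registers. -/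

import Mathlib

namespace DFVS

/-! ### Directed feedback vertex sets -/

/-- A directed cycle of `G`: a nonempty cyclic sequence of pairwise distinct vertices in which every
vertex has an edge to its cyclic successor. A loop is a cycle of length one, and a pair of opposite
edges is a cycle of length two. -/
def IsDirectedCycle {V : Type*} (G : Digraph V) (c : Cycle V) : Prop :=
  c ≠ Cycle.nil ∧ c.Nodup ∧ c.Chain G.Adj

/-- A directed feedback vertex set: a set of vertices that meets every directed cycle. -/
def IsFeedbackVertexSet {V : Type*} (G : Digraph V) (S : Finset V) : Prop :=
  ∀ c : Cycle V, IsDirectedCycle G c → ∃ v ∈ c, v ∈ S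

/-- The correct answers to the instance `(G, k)` of the parameterized search problem:
a feedback vertex set of size at most `k`, or `none` (the answer NO) if there is no such set. -/
def IsCorrectAnswer {V : Type*} (G : Digraph V) (k : ℕ) : Option (Finset V) → Prop
  | some S => IsFeedbackVertexSet G S ∧ S.card ≤ k
  | none => ¬ ∃ S : Finset V, IsFeedbackVertexSet G S ∧ S.card ≤ k

/-! ### Random access machines

The machine is a random access machine with unit cost whose only arithmetic operations are successor
and predecessor. In `t` steps the largest number it holds grows by at most `t` beyond the numbers
in the input and the constants in the program, so no information can be packed into huge words. -/

/-- A configuration: registers, of which each program names only finitely many, and an unbounded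
memory that is addressed by the contents of registers. -/
structure State where
  reg : ℕ → ℕ
  mem : ℕ → ℕ

/-- The tests of a program: two registers are compared. -/
inductive Test where
  | eq (x y : ℕ)
  | lt (x y : ℕ)

/-- The truth value of a test. -/
def Test.Holds : Test → State → Prop
  | .eq x y, s => s.reg x = s.reg y
  | .lt x y, s => s.reg x < s.reg y

/-- Programs; the natural numbers `x`, `y` are names of registers. -/
inductive Program where
  /-- do nothing -/
  | skip
  /-- `reg x := c` -/
  | const (x c : ℕ)
  /-- `reg x := reg y` -/
  | copy (x y : ℕ)
  /-- `reg x := reg y + 1` -/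
  | succ (x y : ℕ)
  /-- `reg x := reg y - 1` (and `0` if `reg y = 0`) -/
  | pred (x y : ℕ)
  /-- `reg x := mem (reg y)` -/
  | load (x y : ℕ)
  /-- `mem (reg x) := reg y` -/
  | store (x y : ℕ)
  /-- first `P`, then `Q` -/
  | seq (P Q : Program)
  /-- if `b` then `P` else `Q` -/
  | ite (b : Test) (P Q : Program)
  /-- while `b` do `P` -/
  | loop (b : Test) (P : Program)

/-- Assign the value `a` to the register `x`. -/
def State.setReg (s : State) (x a : ℕ) : State :=
  { s with reg := Function.update s.reg x a }

/-- Write the value `a` to the memory cell with address `i`. -/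
def State.setMem (s : State) (i a : ℕ) : State :=
  { s with mem := Function.update s.mem i a }

/-- `Runs P s t s'`: the program `P`, started in `s`, halts in `s'` after exactly `t` steps.
Every elementary instruction and every evaluation of a test is one step. -/
inductive Runs : Program → State → ℕ → State → Prop where
  | skip (s) : Runs .skip s 1 s
  | const (s x c) : Runs (.const x c) s 1 (s.setReg x c)
  | copy (s x y) : Runs (.copy x y) s 1 (s.setReg x (s.reg y))
  | succ (s x y) : Runs (.succ x y) s 1 (s.setReg x (s.reg y + 1))
  | pred (s x y) : Runs (.pred x y) s 1 (s.setReg x (s.reg y - 1))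
  | load (s x y) : Runs (.load x y) s 1 (s.setReg x (s.mem (s.reg y)))
  | store (s x y) : Runs (.store x y) s 1 (s.setMem (s.reg x) (s.reg y))
  | seq {P Q s s' s'' t t'} : Runs P s t s' → Runs Q s' t' s'' → Runs (.seq P Q) s (t + t') s''
  | ite_true {b P Q s s' t} : b.Holds s → Runs P s t s' → Runs (.ite b P Q) s (1 + t) s'
  | ite_false {b P Q s s' t} : ¬ b.Holds s → Runs Q s t s' → Runs (.ite b P Q) s (1 + t) s'
  | loop_true {b P s s' s'' t t'} : b.Holds s → Runs P s t s' → Runs (.loop b P) s' t' s'' →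
      Runs (.loop b P) s (1 + t + t') s''
  | loop_false {b P s} : ¬ b.Holds s → Runs (.loop b P) s 1 s

/-! ### Solving the parameterized problem -/

open Classical in
/-- The input `(G, k)`: register `0` holds the number `n` of vertices, register `1` holds `k`, and
the first `n * n` memory cells hold the adjacency matrix of `G` row by row. Everything else is
zero. -/
noncomputable def inputState {n : ℕ} (G : Digraph (Fin n)) (k : ℕ) : State where
  reg := fun x => if x = 0 then n else if x = 1 then k else 0
  mem := fun i => if ∃ u v : Fin n, i = u.val * n + v.val ∧ G.Adj u v then 1 else 0

/-- The answer in a final configuration: NO if register `0` holds `0`, and otherwise the set of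
the vertices `v` whose memory cell (the cell with address `v`) is not zero. -/
def answer (n : ℕ) (s : State) : Option (Finset (Fin n)) :=
  if s.reg 0 = 0 then none else some (Finset.univ.filter fun v : Fin n => s.mem v.val ≠ 0)

/-- The parameterized directed feedback vertex set problem can be solved in time `T n k`: a single
program answers every instance `(G, k)`, where `G` has `n` vertices, correctly within `T n k`
steps. -/
def SolvableInTime (T : ℕ → ℕ → ℕ) : Prop :=
  ∃ P : Program, ∀ (n : ℕ) (G : Digraph (Fin n)) (k : ℕ), ∃ (t : ℕ) (s : State),
    Runs P (inputState G k) t s ∧ t ≤ T n k ∧ IsCorrectAnswer G k (answer n s)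

/-- The parameterized directed feedback vertex set problem is fixed-parameter tractable: it can be
solved in time `g k * p n` for a function `g` and a polynomial `p` (which does not depend on
`k`). -/
def FixedParameterTractable : Prop :=
  ∃ (g : ℕ → ℕ) (p : Polynomial ℕ), SolvableInTime fun n k => g k * p.eval n

end DFVS

namespace DFVS

/-! ### Bounded runs of the random access machine -/

/-! The algorithm is iterative compression followed by a bounded search for separators. Suppose that
at most `k` vertices `sol` meet all cycles among the vertices before `iter`. Then the at most `k +
1` terminals `sol ∪ {iter}` meet all cycles among the vertices up to `iter`, and it remains to
compress them to a solution of size `k`, or to refute that there is one. Cycles are handled through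
`Hits`: a set is a feedback vertex set iff it meets every nonempty set of vertices in which each
vertex has a successor (`isFeedbackVertexSet_iff`).

Let `S` be a solution. If `S` contains a remaining terminal, delete that terminal. Otherwise some
remaining terminal `s` reaches no remaining terminal, itself included, in the graph without `S`
(`Hits.exists_valid`); the set `U` reached from `s` is bounded by vertices of `S`. A maximum family
of disjoint paths yields the minimum separator that is farthest from `s` (`IsFlow.separator`), and
by submodularity `S` may be exchanged so that it separates at least that far (`Hits.push`). Now
branch on a vertex `v` of the separator. Either `v` lies in front of the separator inside the
solution, and forcing it there makes the minimum separator strictly larger; or `v` is in the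
solution, and its deletion lowers the minimum by at most one (`count_bd_eraseEdge`). When the
separator is empty, `s` lies on no cycle that avoids the other terminals and is dropped
(`Hits.erase_source`).

The number of bits read plus the number of remaining terminals never exceeds `|T| + 2 * |deleted| +
l`, where `T` is the set of terminals and `l` bounds the current minimum separator from below: a
deletion pays two and costs at most one unit of `l`, and the other branch gains one unit of `l`. As
the deleted vertices and the rest of the solution number at most `k`, at most `3 * k + 1` bits are
read (`SearchInv`, `SearchInv.exists_advice`). The order in which terminals are drawn is coded as in
a Fisher-Yates shuffle, with `|T|!` possibilities. Hence there are at most `(k + 1)! * 2 ^ (3 * k +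
1) = 2 * (k + 1) * 8 ^ k * k!` sequences of advice (`Ground.prod_admissible_le`), and `k + 1 ≤ n` is
absorbed by the polynomial; for `n ≤ k` the set of all vertices is an answer.

The nondeterminism is removed by enumerating the advice lexicographically, once for each of the at
most `n` values of `iter`. A success moves on to the next vertex; when the enumeration is exhausted,
not even the current induced subgraph has a solution (`LoopInv.solves`). The body of this loop is
written in a small language of first-order updates of relations on a universe of `8 * n + 8`
elements. Each of its commands compiles to a machine program of polynomial cost
(`Cmd.runsIn_compile`, `Cmd.isPoly_cost`), so that only the number of iterations of the main loop
depends on `k` superpolynomially. -/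

/-- The program `P`, started in `s`, halts within `T` steps in a state that satisfies `Q`. -/
def RunsIn (P : Program) (s : State) (T : ℕ) (Q : State → Prop) : Prop :=
  ∃ t s', Runs P s t s' ∧ t ≤ T ∧ Q s'

theorem RunsIn.mono {P : Program} {s : State} {T T' : ℕ} {Q Q' : State → Prop}
    (h : RunsIn P s T Q) (hT : T ≤ T') (hQ : ∀ s', Q s' → Q' s') : RunsIn P s T' Q' := by
  obtain ⟨t, s', h1, h2, h3⟩ := h
  exact ⟨t, s', h1, h2.trans hT, hQ _ h3⟩

theorem RunsIn.seq {P P' : Program} {s : State} {T T' : ℕ} {Q R : State → Prop}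
    (h : RunsIn P s T Q) (h' : ∀ s', Q s' → RunsIn P' s' T' R) :
    RunsIn (.seq P P') s (T + T') R := by
  obtain ⟨t, s', h1, h2, h3⟩ := h
  obtain ⟨t', s'', h4, h5, h6⟩ := h' s' h3
  exact ⟨t + t', s'', .seq h1 h4, by omega, h6⟩

theorem RunsIn.ite {b : Test} {P P' : Program} {s : State} {T : ℕ} {Q : State → Prop}
    (h : b.Holds s → RunsIn P s T Q) (h' : ¬ b.Holds s → RunsIn P' s T Q) :
    RunsIn (.ite b P P') s (1 + T) Q := by
  by_cases hb : b.Holds s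
  · obtain ⟨t, s', h1, h2, h3⟩ := h hb
    exact ⟨1 + t, s', .ite_true hb h1, by omega, h3⟩
  · obtain ⟨t, s', h1, h2, h3⟩ := h' hb
    exact ⟨1 + t, s', .ite_false hb h1, by omega, h3⟩

theorem RunsIn.skip {s : State} {Q : State → Prop} (h : Q s) : RunsIn .skip s 1 Q :=
  ⟨1, _, .skip s, le_rfl, h⟩

theorem RunsIn.const {s : State} {x c : ℕ} {Q : State → Prop} (h : Q (s.setReg x c)) :
    RunsIn (.const x c) s 1 Q :=
  ⟨1, _, .const s x c, le_rfl, h⟩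

theorem RunsIn.copy {s : State} {x y : ℕ} {Q : State → Prop} (h : Q (s.setReg x (s.reg y))) :
    RunsIn (.copy x y) s 1 Q :=
  ⟨1, _, .copy s x y, le_rfl, h⟩

theorem RunsIn.succ {s : State} {x y : ℕ} {Q : State → Prop}
    (h : Q (s.setReg x (s.reg y + 1))) : RunsIn (.succ x y) s 1 Q :=
  ⟨1, _, .succ s x y, le_rfl, h⟩

theorem RunsIn.pred {s : State} {x y : ℕ} {Q : State → Prop}
    (h : Q (s.setReg x (s.reg y - 1))) : RunsIn (.pred x y) s 1 Q :=
  ⟨1, _, .pred s x y, le_rfl, h⟩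

theorem RunsIn.load {s : State} {x y : ℕ} {Q : State → Prop}
    (h : Q (s.setReg x (s.mem (s.reg y)))) : RunsIn (.load x y) s 1 Q :=
  ⟨1, _, .load s x y, le_rfl, h⟩

theorem RunsIn.store {s : State} {x y : ℕ} {Q : State → Prop}
    (h : Q (s.setMem (s.reg x) (s.reg y))) : RunsIn (.store x y) s 1 Q :=
  ⟨1, _, .store s x y, le_rfl, h⟩

/-- The invariant carries the index of the iteration, and the exact number `N` of iterations is
supplied beforehand; the bound counts `N + 1` evaluations of the test. -/
theorem RunsIn.loop {b : Test} {P : Program} {I : ℕ → State → Prop} {N T : ℕ} {s : State}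
    (h0 : I 0 s) (step : ∀ j < N, ∀ s, I j s → b.Holds s ∧ RunsIn P s T (I (j + 1)))
    (hN : ∀ s, I N s → ¬ b.Holds s) : RunsIn (.loop b P) s (N * (T + 1) + 1) (I N) := by
  suffices H : ∀ j i, i + j = N → ∀ s, I i s → RunsIn (.loop b P) s (j * (T + 1) + 1) (I N) from
    H N 0 (by omega) s h0
  intro j
  induction j with
  | zero =>
    intro i hi s hs
    obtain rfl : i = N := by omega
    exact ⟨1, s, .loop_false (hN s hs), by omega, hs⟩
  | succ j ih =>
    intro i hi s hs
    obtain ⟨hb, t, s', h1, h2, h3⟩ := step i (by omega) s hs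
    obtain ⟨t', s'', h4, h5, h6⟩ := ih (i + 1) (by omega) s' h3
    refine ⟨1 + t + t', s'', .loop_true hb h1 h4, ?_, h6⟩
    rw [Nat.succ_mul]
    omega

@[simp] theorem State.setReg_mem (s : State) (x a : ℕ) : (s.setReg x a).mem = s.mem := rfl
@[simp] theorem State.setMem_reg (s : State) (i a : ℕ) : (s.setMem i a).reg = s.reg := rfl
theorem State.setReg_reg (s : State) (x a y : ℕ) :
    (s.setReg x a).reg y = if y = x then a else s.reg y := by
  simp [State.setReg, Function.update_apply]
theorem State.setMem_mem (s : State) (i a j : ℕ) :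
    (s.setMem i a).mem j = if j = i then a else s.mem j := by
  simp [State.setMem, Function.update_apply]

/-! ### Scratch registers and arithmetic -/

/-- The `j`-th scratch register. -/
def scratch (j : ℕ) : ℕ := 2 * j + 1

@[simp] theorem scratch_inj {i j : ℕ} : scratch i = scratch j ↔ i = j := by
  simp [scratch]

@[simp] theorem two_mul_ne_scratch {i j : ℕ} : 2 * i ≠ scratch j := by
  simp only [scratch]; omega

@[simp] theorem scratch_ne_two_mul {i j : ℕ} : scratch j ≠ 2 * i := by
  simp only [scratch]; omega

/-- The states agree on the memory and on all registers but the scratch registers from `d` on. -/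
def SameBelow (d : ℕ) (s s' : State) : Prop :=
  s'.mem = s.mem ∧ ∀ r, (∀ j, d ≤ j → r ≠ scratch j) → s'.reg r = s.reg r

theorem SameBelow.refl (d : ℕ) (s : State) : SameBelow d s s := ⟨rfl, fun _ _ => rfl⟩

theorem SameBelow.trans {d d' : ℕ} {s s' s'' : State} (h : SameBelow d s s')
    (h' : SameBelow d' s' s'') (hd : d ≤ d') : SameBelow d s s'' :=
  ⟨h'.1.trans h.1, fun r hr =>
    (h'.2 r fun j hj => hr j (hd.trans hj)).trans (h.2 r hr)⟩

theorem SameBelow.setReg {d j : ℕ} {s s' : State} (h : SameBelow d s s') (hj : d ≤ j) (a : ℕ) :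
    SameBelow d s (s'.setReg (scratch j) a) :=
  ⟨h.1, fun r hr => by rw [State.setReg_reg, if_neg (hr j hj), h.2 r hr]⟩

theorem SameBelow.reg_scratch {d i : ℕ} {s s' : State} (h : SameBelow d s s') (hi : i < d) :
    s'.reg (scratch i) = s.reg (scratch i) :=
  h.2 _ fun j hj => by simp; omega

theorem SameBelow.reg_two_mul {d i : ℕ} {s s' : State} (h : SameBelow d s s') :
    s'.reg (2 * i) = s.reg (2 * i) :=
  h.2 _ fun j hj => by simp

/-- `reg a := reg a + reg b`, with `c` as a counter. -/
def addReg (a b c : ℕ) : Program :=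
  .seq (.const c 0) (.loop (.lt c b) (.seq (.succ a a) (.succ c c)))

theorem runsIn_addReg {a b c : ℕ} (hab : a ≠ b) (hac : a ≠ c) (hbc : b ≠ c) (s : State) :
    RunsIn (addReg a b c) s (3 * s.reg b + 2) fun s' =>
      s'.mem = s.mem ∧ s'.reg a = s.reg a + s.reg b ∧
        ∀ r, r ≠ a → r ≠ c → s'.reg r = s.reg r := by
  refine RunsIn.mono (T := 1 + (s.reg b * ((1 + 1) + 1) + 1)) ?_ (by omega) (fun _ h => h)
  refine RunsIn.seq (Q := fun s' => s' = s.setReg c 0) (RunsIn.const rfl) ?_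
  rintro _ rfl
  refine RunsIn.mono (RunsIn.loop (N := s.reg b) (T := 1 + 1)
    (I := fun j s' => s'.reg c = j ∧ s'.mem = s.mem ∧ s'.reg a = s.reg a + j ∧
      ∀ r, r ≠ a → r ≠ c → s'.reg r = s.reg r) ?_ ?_ ?_) le_rfl ?_
  · refine ⟨by simp [State.setReg_reg], rfl, by simp [State.setReg_reg, hac], ?_⟩
    intro r _ hr
    simp [State.setReg_reg, hr]
  · rintro j hj s' ⟨h1, h2, h3, h4⟩
    refine ⟨by simp only [Test.Holds, h1, h4 b hab.symm hbc]; exact hj, ?_⟩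
    refine RunsIn.seq (Q := fun s'' => s'' = s'.setReg a (s'.reg a + 1)) (RunsIn.succ rfl) ?_
    rintro _ rfl
    refine RunsIn.succ ⟨?_, h2, ?_, ?_⟩
    · simp [State.setReg_reg, hac.symm, h1]
    · simp [State.setReg_reg, hac, h3]; omega
    · intro r hra hrc
      simp [State.setReg_reg, hra, hrc, h4 r hra hrc]
  · rintro s' ⟨h1, h2, h3, h4⟩
    simp [Test.Holds, h1, h4 b hab.symm hbc]
  · rintro s' ⟨h1, h2, h3, h4⟩
    exact ⟨h2, h3, h4⟩

/-- `reg a := reg a + reg b * reg e`, with `c` and `c'` as counters. -/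
def mulAddReg (a b e c c' : ℕ) : Program :=
  .seq (.const c' 0) (.loop (.lt c' b) (.seq (addReg a e c) (.succ c' c')))

theorem runsIn_mulAddReg {a b e c c' : ℕ} (hab : a ≠ b) (hae : a ≠ e) (hac : a ≠ c)
    (hac' : a ≠ c') (hbc : b ≠ c) (hbc' : b ≠ c') (hec : e ≠ c) (hec' : e ≠ c') (hcc' : c ≠ c')
    (s : State) :
    RunsIn (mulAddReg a b e c c') s (s.reg b * (3 * s.reg e + 4) + 2) fun s' =>
      s'.mem = s.mem ∧ s'.reg a = s.reg a + s.reg b * s.reg e ∧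
        ∀ r, r ≠ a → r ≠ c → r ≠ c' → s'.reg r = s.reg r := by
  refine RunsIn.mono (T := 1 + (s.reg b * (((3 * s.reg e + 2) + 1) + 1) + 1)) ?_ (by ring_nf; omega)
    (fun _ h => h)
  refine RunsIn.seq (Q := fun s' => s' = s.setReg c' 0) (RunsIn.const rfl) ?_
  rintro _ rfl
  refine RunsIn.mono (RunsIn.loop (N := s.reg b) (T := (3 * s.reg e + 2) + 1)
    (I := fun j s' => s'.reg c' = j ∧ s'.mem = s.mem ∧ s'.reg a = s.reg a + j * s.reg e ∧
      ∀ r, r ≠ a → r ≠ c → r ≠ c' → s'.reg r = s.reg r) ?_ ?_ ?_) le_rfl ?_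
  · refine ⟨by simp [State.setReg_reg], rfl, by simp [State.setReg_reg, hac'], ?_⟩
    intro r _ _ hr
    simp [State.setReg_reg, hr]
  · rintro j hj s' ⟨h1, h2, h3, h4⟩
    refine ⟨by simp only [Test.Holds, h1, h4 b hab.symm hbc hbc']; exact hj, ?_⟩
    have he := h4 e hae.symm hec hec'
    refine RunsIn.seq (T := 3 * s.reg e + 2) (he ▸ runsIn_addReg hae hac hec s') ?_
    rintro s'' ⟨g1, g2, g3⟩
    refine RunsIn.succ ⟨?_, g1.trans h2, ?_, ?_⟩
    · simp [State.setReg_reg, g3 c' hac'.symm hcc'.symm, h1]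
    · simp [State.setReg_reg, hac', g2, h3]; ring
    · intro r hra hrc hrc'
      simp [State.setReg_reg, hrc', g3 r hra hrc, h4 r hra hrc hrc']
  · rintro s' ⟨h1, h2, h3, h4⟩
    simp [Test.Holds, h1, h4 b hab.symm hbc hbc']
  · rintro s' ⟨h1, h2, h3, h4⟩
    exact ⟨h2, h3, h4⟩

/-- The address of the cell `(x, y)` of the `r`-th matrix of format `m × m`. -/
def cell (m base r x y : ℕ) : ℕ := base + ((r * m + x) * m + y)

/-- Addresses are numerals in base `m` whose two last digits are the row and the column; the leading
digit, the number of the matrix, is unrestricted. -/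
theorem cell_inj {m base r x y r' x' y' : ℕ} (hx : x < m) (hy : y < m) (hx' : x' < m)
    (hy' : y' < m) (h : cell m base r x y = cell m base r' x' y') : r = r' ∧ x = x' ∧ y = y' := by
  have key : ∀ {a b a' b' : ℕ}, b < m → b' < m → a * m + b = a' * m + b' → a = a' ∧ b = b' := by
    intro a b a' b' hb hb' h
    have e : a = a' := by
      have := congrArg (· / m) h
      have hm : 0 < m := by omega
      simpa [Nat.mul_comm _ m, Nat.mul_add_div hm, Nat.div_eq_of_lt hb,
        Nat.div_eq_of_lt hb'] using this
    subst e
    exact ⟨rfl, by omega⟩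
  obtain ⟨h1, h2⟩ := key hy hy' (Nat.add_left_cancel h)
  obtain ⟨h3, h4⟩ := key hx hx' h1
  exact ⟨h3, h4, h2⟩

/-- Compute the address of a cell of the `r`-th matrix into the scratch register `d`; the format
and the base address are in the scratch registers `0` and `1`, the row and the column in the
registers `x` and `y`. -/
def cellAddr (d r x y : ℕ) : Program :=
  .seq (.copy (scratch (d + 1)) x) <|
  .seq (.const (scratch (d + 2)) r) <|
  .seq (mulAddReg (scratch (d + 1)) (scratch (d + 2)) (scratch 0) (scratch (d + 3))
    (scratch (d + 4))) <|
  .seq (.copy (scratch d) (scratch 1)) <|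
  .seq (mulAddReg (scratch d) (scratch (d + 1)) (scratch 0) (scratch (d + 3)) (scratch (d + 4))) <|
  addReg (scratch d) y (scratch (d + 3))

/-- A bound for the running time of `cellAddr`. -/
def cellCost (r m : ℕ) : ℕ := r * (3 * m + 4) + (r * m + m) * (3 * m + 4) + 3 * m + 9

/-- The indices sit in even registers and therefore cannot collide with the odd scratch registers
that the computation overwrites; `2 ≤ d` protects the format and the base address. -/
theorem runsIn_cellAddr {d r x y m : ℕ} (hd : 2 ≤ d) (s : State) (hm : s.reg (scratch 0) = m)
    (hx : s.reg (2 * x) < m) (hy : s.reg (2 * y) < m) :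
    RunsIn (cellAddr d r (2 * x) (2 * y)) s (cellCost r m) fun s' =>
      SameBelow d s s' ∧
        s'.reg (scratch d) = cell m (s.reg (scratch 1)) r (s.reg (2 * x)) (s.reg (2 * y)) := by
  refine RunsIn.mono (T := 1 + (1 + ((r * (3 * m + 4) + 2) + (1 +
    (((r * m + s.reg (2 * x)) * (3 * m + 4) + 2) + (3 * s.reg (2 * y) + 2)))))) ?_ ?_ (fun _ h => h)
  rotate_left
  -- The actual row index is replaced by `m`, so that the cost depends on `r` and `m` alone.
  · have : (r * m + s.reg (2 * x)) * (3 * m + 4) ≤ (r * m + m) * (3 * m + 4) := by gcongr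
    unfold cellCost
    omega
  refine RunsIn.seq (Q := fun s' => SameBelow d s s' ∧ s'.reg (scratch (d + 1)) = s.reg (2 * x))
    (RunsIn.copy ⟨(SameBelow.refl d s).setReg (by omega) _, by simp [State.setReg_reg]⟩) ?_
  rintro s1 ⟨h1, e1⟩
  refine RunsIn.seq (Q := fun s' => SameBelow d s s' ∧ s'.reg (scratch (d + 1)) = s.reg (2 * x) ∧
      s'.reg (scratch (d + 2)) = r)
    (RunsIn.const ⟨h1.setReg (by omega) _, by simp [State.setReg_reg, e1],
      by simp [State.setReg_reg]⟩) ?_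
  rintro s2 ⟨h2, e2, f2⟩
  have b2 : s2.reg (scratch 0) = m := by rw [h2.reg_scratch (by omega), hm]
  refine RunsIn.seq (Q := fun s' => SameBelow d s s' ∧
      s'.reg (scratch (d + 1)) = r * m + s.reg (2 * x)) ?_ ?_
  · refine RunsIn.mono (runsIn_mulAddReg (by simp) (by simp) (by simp) (by simp) (by simp)
      (by simp) (by simp) (by simp) (by simp) s2) (by rw [f2, b2]) ?_
    rintro s' ⟨g1, g2, g3⟩
    refine ⟨⟨g1.trans h2.1, fun q hq => ?_⟩, by rw [g2, e2, f2, b2]; ring⟩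
    rw [g3 q (hq _ (by omega)) (hq _ (by omega)) (hq _ (by omega)), h2.2 q hq]
  rintro s3 ⟨h3, e3⟩
  refine RunsIn.seq (Q := fun s' => SameBelow d s s' ∧
      s'.reg (scratch (d + 1)) = r * m + s.reg (2 * x) ∧
      s'.reg (scratch d) = s.reg (scratch 1)) (RunsIn.copy ⟨h3.setReg le_rfl _, ?_, ?_⟩) ?_
  · simp [State.setReg_reg, e3]
  · simp [State.setReg_reg, h3.reg_scratch (show 1 < d by omega)]
  rintro s4 ⟨h4, e4, f4⟩
  have b4 : s4.reg (scratch 0) = m := by rw [h4.reg_scratch (by omega), hm]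
  refine RunsIn.seq (Q := fun s' => SameBelow d s s' ∧
      s'.reg (scratch d) = s.reg (scratch 1) + (r * m + s.reg (2 * x)) * m) ?_ ?_
  · refine RunsIn.mono (runsIn_mulAddReg (by simp) (by simp; omega) (by simp) (by simp) (by simp)
      (by simp) (by simp) (by simp) (by simp) s4) (by rw [e4, b4]) ?_
    rintro s' ⟨g1, g2, g3⟩
    refine ⟨⟨g1.trans h4.1, fun q hq => ?_⟩, by rw [g2, e4, f4, b4]⟩
    rw [g3 q (hq _ (by omega)) (hq _ (by omega)) (hq _ (by omega)), h4.2 q hq]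
  rintro s5 ⟨h5, e5⟩
  have b5 := h5.reg_two_mul (i := y)
  refine RunsIn.mono (runsIn_addReg (by simp) (by simp) (by simp) s5) (by rw [b5]) ?_
  rintro s' ⟨g1, g2, g3⟩
  refine ⟨⟨g1.trans h5.1, fun q hq => ?_⟩, by rw [g2, e5, b5, cell]; ring⟩
  rw [g3 q (hq _ (by omega)) (hq _ (by omega)), h5.2 q hq]

end DFVS

namespace DFVS

/-! ### A language of first-order updates of relations on a finite universe -/

/-- The names of the element variables. `x`, `y`, `z`, `u` are bound in formulas. -/
inductive Var
  | x | y | z | u | order | budget | limit | zero | one | iter | pos | src | ptr | bit | digit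
  | vert | tok | side | walking | lvl | lvl' | tmp | active | count | halt | found
  deriving DecidableEq

/-- The names of the binary relations. -/
inductive Rel
  | edge | sol | allowed | advice | del | perm | inner | alive | start | term | used | arc | first
  | last | lin | lout | sink | rest | near | far
  deriving DecidableEq

/-- The register of a variable is `2 * v.idx`. -/
def Var.idx : Var → ℕ
  -- `order` owns register `0`, which holds `n` in the input and receives the verdict in the output.
  | order => 0 | x => 1 | y => 2 | z => 3 | u => 4 | budget => 5 | limit => 6 | zero => 7 | one => 8
  | iter => 9 | pos => 10 | src => 11 | ptr => 12 | bit => 13 | digit => 14 | vert => 15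
  | tok => 16 | side => 17 | walking => 18 | lvl => 19 | lvl' => 20 | tmp => 21 | active => 22
  | count => 23 | halt => 24 | found => 25

/-- The position of the matrix of a relation in the memory; the matrix at `0` is scratch space. -/
def Rel.idx : Rel → ℕ
  | edge => 1 | sol => 2 | allowed => 3 | advice => 4 | del => 5 | perm => 6 | inner => 7
  | alive => 8 | start => 9 | term => 10 | used => 11 | arc => 12 | first => 13 | last => 14
  | lin => 15 | lout => 16 | sink => 17 | rest => 18 | near => 19 | far => 20

theorem Var.idx_inj {v w : Var} : v.idx = w.idx ↔ v = w := by
  refine ⟨fun h => ?_, congrArg _⟩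
  cases v <;> cases w <;> first | rfl | simp [Var.idx] at h

theorem Rel.idx_inj {r q : Rel} : r.idx = q.idx ↔ r = q := by
  refine ⟨fun h => ?_, congrArg _⟩
  cases r <;> cases q <;> first | rfl | simp [Rel.idx] at h

theorem Rel.idx_ne_zero (r : Rel) : r.idx ≠ 0 := by
  cases r <;> simp [Rel.idx]

/-- A configuration of the relational language on the universe `Fin m`. -/
structure Conf (m : ℕ) where
  env : Var → Fin m
  rel : Rel → Fin m → Fin m → Prop

variable {m : ℕ}

/-- Assign the element `a` to the variable `v`. -/
def Conf.setVar (σ : Conf m) (v : Var) (a : Fin m) : Conf m :=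
  { σ with env := Function.update σ.env v a }

/-- Assign the relation `D` to the name `r`. -/
def Conf.setRel (σ : Conf m) (r : Rel) (D : Fin m → Fin m → Prop) : Conf m :=
  { σ with rel := Function.update σ.rel r D }

@[simp] theorem Conf.setVar_rel (σ : Conf m) (v : Var) (a : Fin m) : (σ.setVar v a).rel = σ.rel :=
  rfl
@[simp] theorem Conf.setRel_env (σ : Conf m) (r : Rel) (D : Fin m → Fin m → Prop) :
    (σ.setRel r D).env = σ.env := rfl
@[simp] theorem Conf.setVar_env (σ : Conf m) (v : Var) (a : Fin m) (w : Var) :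
    (σ.setVar v a).env w = if w = v then a else σ.env w := by
  simp [Conf.setVar, Function.update_apply]
@[simp] theorem Conf.setRel_rel (σ : Conf m) (r : Rel) (D : Fin m → Fin m → Prop) (q : Rel) :
    (σ.setRel r D).rel q = if q = r then D else σ.rel q := by
  simp [Conf.setRel, Function.update_apply]

@[ext] theorem Conf.ext' {σ τ : Conf m} (h : σ.env = τ.env) (h' : σ.rel = τ.rel) : σ = τ := by
  cases σ; cases τ; simp_all

theorem Conf.setVar_setRel (σ : Conf m) (v : Var) (a : Fin m) (r : Rel)
    (D : Fin m → Fin m → Prop) : (σ.setRel r D).setVar v a = (σ.setVar v a).setRel r D := rfl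

/-- First-order formulas. -/
inductive Fm where
  | rel (r : Rel) (v w : Var)
  | eq (v w : Var)
  | lt (v w : Var)
  | neg (φ : Fm)
  | and (φ ψ : Fm)
  | ex (v : Var) (φ : Fm)

/-- Satisfaction of formulas. -/
def Fm.Sat : Fm → Conf m → Prop
  | .rel r v w, σ => σ.rel r (σ.env v) (σ.env w)
  | .eq v w, σ => σ.env v = σ.env w
  | .lt v w, σ => σ.env v < σ.env w
  | .neg φ, σ => ¬ φ.Sat σ
  | .and φ ψ, σ => φ.Sat σ ∧ ψ.Sat σ
  | .ex v φ, σ => ∃ a, φ.Sat (σ.setVar v a)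

/-- Disjunction. -/
def Fm.or (φ ψ : Fm) : Fm := .neg (.and (.neg φ) (.neg ψ))
/-- The weak order. -/
def Fm.le (v w : Var) : Fm := .neg (.lt w v)

section Sat
variable (σ : Conf m) (r : Rel) (v w : Var) (φ ψ : Fm)
@[simp] theorem Fm.sat_rel : (Fm.rel r v w).Sat σ ↔ σ.rel r (σ.env v) (σ.env w) := Iff.rfl
@[simp] theorem Fm.sat_eq : (Fm.eq v w).Sat σ ↔ σ.env v = σ.env w := Iff.rfl
@[simp] theorem Fm.sat_lt : (Fm.lt v w).Sat σ ↔ σ.env v < σ.env w := Iff.rfl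
@[simp] theorem Fm.sat_neg : (Fm.neg φ).Sat σ ↔ ¬ φ.Sat σ := Iff.rfl
@[simp] theorem Fm.sat_and : (Fm.and φ ψ).Sat σ ↔ φ.Sat σ ∧ ψ.Sat σ := Iff.rfl
@[simp] theorem Fm.sat_ex : (Fm.ex v φ).Sat σ ↔ ∃ a, φ.Sat (σ.setVar v a) := Iff.rfl
@[simp] theorem Fm.sat_or : (Fm.or φ ψ).Sat σ ↔ φ.Sat σ ∨ ψ.Sat σ := by
  simp [Fm.or, or_iff_not_imp_left]
@[simp] theorem Fm.sat_le : (Fm.le v w).Sat σ ↔ σ.env v ≤ σ.env w := by simp [Fm.le]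
end Sat

open Classical in
/-- The least element that satisfies `p`, and `0` if there is none. -/
noncomputable def least [NeZero m] (p : Fin m → Prop) : Fin m :=
  if h : ∃ a, p a then WellFounded.min wellFounded_lt {a | p a} h else 0

theorem least_spec [NeZero m] {p : Fin m → Prop} (h : ∃ a, p a) : p (least p) := by
  rw [least, dif_pos h]
  exact WellFounded.min_mem wellFounded_lt {a | p a} h

theorem least_le [NeZero m] {p : Fin m → Prop} {a : Fin m} (h : p a) : least p ≤ a := by
  rw [least, dif_pos ⟨a, h⟩]
  exact not_lt.1 (WellFounded.not_lt_min wellFounded_lt {a | p a} h)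

theorem least_eq [NeZero m] {p : Fin m → Prop} {a : Fin m} (h : p a) (h' : ∀ b < a, ¬ p b) :
    least p = a :=
  le_antisymm (least_le h) (not_lt.1 fun hlt => h' _ hlt (least_spec ⟨a, h⟩))

theorem least_eq_zero [NeZero m] {p : Fin m → Prop} (h : ¬ ∃ a, p a) : least p = 0 := by
  rw [least, dif_neg h]

@[simp] theorem least_eq_left [NeZero m] (a : Fin m) : least (fun b => b = a) = a :=
  least_eq rfl fun _ hb h => (hb.ne h)

@[simp] theorem least_eq_right [NeZero m] (a : Fin m) : least (fun b => a = b) = a :=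
  least_eq rfl fun _ hb h => (hb.ne h.symm)

/-- Commands; `assign r φ` assigns the relation `{(x, y) | φ}` to `r`, `pick v φ` assigns the least
`v` with `φ` to `v`, and `rep P` repeats `P` as often as the universe has elements. -/
inductive Cmd where
  | skip
  | assign (r : Rel) (φ : Fm)
  | pick (v : Var) (φ : Fm)
  | seq (P Q : Cmd)
  | ite (φ : Fm) (P Q : Cmd)
  | rep (P : Cmd)

open Classical in
/-- The effect of a command. -/
noncomputable def Cmd.eval [NeZero m] : Cmd → Conf m → Conf m
  | .skip, σ => σ
  | .assign r φ, σ => σ.setRel r fun a b => φ.Sat ((σ.setVar .x a).setVar .y b)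
  | .pick v φ, σ => σ.setVar v (least fun a => φ.Sat (σ.setVar v a))
  | .seq P Q, σ => Q.eval (P.eval σ)
  | .ite φ P Q, σ => if φ.Sat σ then P.eval σ else Q.eval σ
  | .rep P, σ => (P.eval)^[m] σ

theorem Cmd.eval_seq [NeZero m] (P Q : Cmd) (σ : Conf m) :
    (Cmd.seq P Q).eval σ = Q.eval (P.eval σ) := rfl

theorem Cmd.eval_ite_pos [NeZero m] {φ : Fm} {P Q : Cmd} {σ : Conf m} (h : φ.Sat σ) :
    (Cmd.ite φ P Q).eval σ = P.eval σ := if_pos h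

theorem Cmd.eval_ite_neg [NeZero m] {φ : Fm} {P Q : Cmd} {σ : Conf m} (h : ¬ φ.Sat σ) :
    (Cmd.ite φ P Q).eval σ = Q.eval σ := if_neg h

theorem Cmd.eval_pick [NeZero m] (v : Var) (φ : Fm) (σ : Conf m) :
    (Cmd.pick v φ).eval σ = σ.setVar v (least fun a => φ.Sat (σ.setVar v a)) := rfl

theorem Cmd.eval_rep [NeZero m] (P : Cmd) (σ : Conf m) :
    (Cmd.rep P).eval σ = P.eval^[m] σ := rfl

/-- The relations that a command may change. -/
def Cmd.ModRel : Cmd → Rel → Prop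
  | .skip, _ => False
  | .assign r _, q => q = r
  | .pick _ _, _ => False
  | .seq P Q, q => P.ModRel q ∨ Q.ModRel q
  | .ite _ P Q, q => P.ModRel q ∨ Q.ModRel q
  | .rep P, q => P.ModRel q

/-- The variables that a command may change. -/
def Cmd.ModVar : Cmd → Var → Prop
  | .skip, _ => False
  | .assign _ _, _ => False
  | .pick v _, w => w = v
  | .seq P Q, w => P.ModVar w ∨ Q.ModVar w
  | .ite _ P Q, w => P.ModVar w ∨ Q.ModVar w
  | .rep P, w => P.ModVar w

theorem iterate_induction {α : Type*} {F : α → α} {I : ℕ → α → Prop} {a : α} (h0 : I 0 a)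
    (step : ∀ j b, I j b → I (j + 1) (F b)) (N : ℕ) : I N (F^[N] a) := by
  induction N with
  | zero => exact h0
  | succ N ih => rw [Function.iterate_succ_apply']; exact step _ _ ih

/-- Iterating a step that decreases a measure until a goal is reached reaches the goal. -/
theorem iterate_reaches {α : Type*} {F : α → α} {I G : α → Prop} {μ : α → ℕ}
    (hI : ∀ a, I a → I (F a)) (hG : ∀ a, I a → G a → G (F a))
    (hμ : ∀ a, I a → ¬ G a → G (F a) ∨ μ (F a) < μ a) {N : ℕ} {a : α} (ha : I a) (hN : μ a < N) :
    I (F^[N] a) ∧ G (F^[N] a) := by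
  have h := iterate_induction (F := F) (a := a) (I := fun j b => I b ∧ (G b ∨ μ b + j ≤ μ a))
    ⟨ha, Or.inr le_rfl⟩ (fun j b ⟨h1, h2⟩ => ⟨hI b h1, by
      by_cases hb : G b
      · exact Or.inl (hG b h1 hb)
      · rcases hμ b h1 hb with h | h
        · exact Or.inl h
        · rcases h2 with h2 | h2
          · exact absurd h2 hb
          · right; omega⟩) N
  refine ⟨h.1, h.2.resolve_right fun h2 => ?_⟩
  omega

/-- Frame rules. `ModRel` and `ModVar` are recursive in the syntax, so for concrete commands `simp`
discharges the side condition. -/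
theorem Cmd.eval_rel [NeZero m] {P : Cmd} {r : Rel} (h : ¬ P.ModRel r) (σ : Conf m) :
    (P.eval σ).rel r = σ.rel r := by
  induction P generalizing σ with
  | skip => rfl
  | assign q φ => simp only [ModRel] at h; simp [eval, h]
  | pick v φ => simp [eval]
  | seq P Q hP hQ =>
    simp only [ModRel, not_or] at h
    rw [eval, hQ h.2, hP h.1]
  | ite φ P Q hP hQ =>
    simp only [ModRel, not_or] at h
    rw [eval]; split_ifs
    · exact hP h.1 _
    · exact hQ h.2 _
  | rep P hP =>
    rw [eval]
    exact iterate_induction (I := fun _ τ => τ.rel r = σ.rel r) rfl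
      (fun _ τ hτ => (hP h τ).trans hτ) m

theorem Cmd.eval_env [NeZero m] {P : Cmd} {v : Var} (h : ¬ P.ModVar v) (σ : Conf m) :
    (P.eval σ).env v = σ.env v := by
  induction P generalizing σ with
  | skip => rfl
  | assign q φ => simp [eval]
  | pick w φ => simp only [ModVar] at h; simp [eval, h]
  | seq P Q hP hQ =>
    simp only [ModVar, not_or] at h
    rw [eval, hQ h.2, hP h.1]
  | ite φ P Q hP hQ =>
    simp only [ModVar, not_or] at h
    rw [eval]; split_ifs
    · exact hP h.1 _
    · exact hQ h.2 _
  | rep P hP =>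
    rw [eval]
    exact iterate_induction (I := fun _ τ => τ.env v = σ.env v) rfl
      (fun _ τ hτ => (hP h τ).trans hτ) m

/-- The formula mentions the relation. -/
def Fm.Uses : Fm → Rel → Prop
  | .rel r _ _, q => q = r
  | .eq _ _, _ => False
  | .lt _ _, _ => False
  | .neg φ, q => φ.Uses q
  | .and φ ψ, q => φ.Uses q ∨ ψ.Uses q
  | .ex _ φ, q => φ.Uses q

/-- The command mentions the relation. -/
def Cmd.Uses : Cmd → Rel → Prop
  | .skip, _ => False
  | .assign r φ, q => q = r ∨ φ.Uses q
  | .pick _ φ, q => φ.Uses q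
  | .seq P Q, q => P.Uses q ∨ Q.Uses q
  | .ite φ P Q, q => φ.Uses q ∨ P.Uses q ∨ Q.Uses q
  | .rep P, q => P.Uses q

theorem Fm.sat_setRel {φ : Fm} {r : Rel} (h : ¬ φ.Uses r) (σ : Conf m)
    (D : Fin m → Fin m → Prop) : φ.Sat (σ.setRel r D) ↔ φ.Sat σ := by
  induction φ generalizing σ with
  | rel q v w => simp only [Uses] at h; simp [Ne.symm h]
  | eq v w => simp
  | lt v w => simp
  | neg φ ih => rw [sat_neg, sat_neg, ih h]
  | and φ ψ hφ hψ =>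
    simp only [Uses, not_or] at h
    rw [sat_and, sat_and, hφ h.1, hψ h.2]
  | ex v φ ih => simp only [sat_ex, Conf.setVar_setRel, ih h]

/-- Applied with `advice` for `r`: the parts of a search step that do not consult the advice commute
with changing it. This makes precise which positions of the advice a step depends on. -/
theorem Cmd.eval_setRel [NeZero m] {P : Cmd} {r : Rel} (h : ¬ P.Uses r) (σ : Conf m)
    (D : Fin m → Fin m → Prop) : P.eval (σ.setRel r D) = (P.eval σ).setRel r D := by
  induction P generalizing σ with
  | skip => rfl
  | assign q φ =>
    simp only [Uses, not_or] at h
    simp only [eval, Conf.setVar_setRel, Fm.sat_setRel h.2]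
    refine Conf.ext' rfl ?_
    exact Function.update_comm h.1 _ _ _
  | pick v φ => simp only [eval, Conf.setVar_setRel, Fm.sat_setRel h]
  | seq P Q hP hQ =>
    simp only [Uses, not_or] at h
    rw [eval, eval, hP h.1, hQ h.2]
  | ite φ P Q hP hQ =>
    simp only [Uses, not_or] at h
    by_cases hφ : φ.Sat σ
    · rw [eval, eval, if_pos hφ, if_pos ((Fm.sat_setRel h.1 σ D).2 hφ), hP h.2.1]
    · rw [eval, eval, if_neg hφ, if_neg (mt (Fm.sat_setRel h.1 σ D).1 hφ), hQ h.2.2]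
  | rep P hP =>
    rw [eval, eval]
    exact (Function.Semiconj.iterate_right (f := fun τ : Conf m => τ.setRel r D)
      (fun τ => (hP h τ).symm) m σ).symm

/-! ### Compilation -/

open Classical in
/-- The number `1` for a true and `0` for a false proposition. -/
noncomputable def ind (p : Prop) : ℕ := if p then 1 else 0

@[simp] theorem ind_eq_zero {p : Prop} : ind p = 0 ↔ ¬ p := by simp [ind]
theorem ind_pos {p : Prop} (h : p) : ind p = 1 := if_pos h
theorem ind_neg {p : Prop} (h : ¬ p) : ind p = 0 := if_neg h
theorem ind_congr {p q : Prop} (h : p ↔ q) : ind p = ind q := by rw [propext h]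
theorem ind_le_one (p : Prop) : ind p ≤ 1 := by unfold ind; split_ifs <;> omega

/-- Repeat `P` for all values of the register `i` below the value of the scratch register `0`. -/
def forRange (i : ℕ) (P : Program) : Program :=
  .seq (.const i 0) (.loop (.lt i (scratch 0)) (.seq P (.succ i i)))

theorem runsIn_forRange {i N T : ℕ} {P : Program} {I : ℕ → State → Prop} {s : State}
    (h0 : I 0 (s.setReg i 0)) (hreg : ∀ j s, I j s → s.reg i = j ∧ s.reg (scratch 0) = N)
    (step : ∀ j < N, ∀ s, I j s → RunsIn P s T fun s' => I (j + 1) (s'.setReg i (s'.reg i + 1))) :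
    RunsIn (forRange i P) s (N * (T + 2) + 2) (I N) := by
  refine RunsIn.mono (T := 1 + (N * ((T + 1) + 1) + 1)) ?_ (by ring_nf; omega) (fun _ h => h)
  refine RunsIn.seq (Q := fun s' => s' = s.setReg i 0) (RunsIn.const rfl) ?_
  rintro _ rfl
  refine RunsIn.loop h0 (fun j hj s' hs' => ⟨?_, RunsIn.seq (step j hj s' hs') fun s'' h =>
    RunsIn.succ h⟩) (fun s' hs' => ?_)
  · simp only [Test.Holds, hreg j s' hs']; exact hj
  · simp [Test.Holds, hreg N s' hs']

/-- The register of a variable. -/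
def Var.reg (v : Var) : ℕ := 2 * v.idx

/-- The registers represent the variables and the size of the universe. -/
def RepVar (base : ℕ) (s : State) (σ : Conf m) : Prop :=
  s.reg (scratch 0) = m ∧ s.reg (scratch 1) = base ∧ ∀ v : Var, s.reg v.reg = (σ.env v).val

/-- The memory represents the relations. -/
def RepRel (base : ℕ) (s : State) (ρ : Rel → Fin m → Fin m → Prop) : Prop :=
  ∀ r (a b : Fin m), s.mem (cell m base r.idx a b) = ind (ρ r a b)

/-- The state of the machine represents the configuration. -/
def Rep (base : ℕ) (s : State) (σ : Conf m) : Prop :=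
  RepVar base s σ ∧ RepRel base s σ.rel

theorem Var.reg_ne_scratch (v : Var) (j : ℕ) : v.reg ≠ scratch j := two_mul_ne_scratch

theorem SameBelow.reg_var {d : ℕ} {s s' : State} (h : SameBelow d s s') (v : Var) :
    s'.reg v.reg = s.reg v.reg := h.reg_two_mul

theorem Rep.sameBelow {base d : ℕ} {s s' : State} {σ : Conf m} (h : Rep base s σ) (hd : 2 ≤ d)
    (h' : SameBelow d s s') : Rep base s' σ := by
  obtain ⟨⟨h1, h2, h3⟩, h4⟩ := h
  refine ⟨⟨?_, ?_, fun v => ?_⟩, fun r a b => ?_⟩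
  · rw [h'.reg_scratch (by omega), h1]
  · rw [h'.reg_scratch (by omega), h2]
  · rw [h'.reg_var, h3]
  · rw [h'.1, h4]

theorem Rep.setVar {base : ℕ} {s : State} {σ : Conf m} (h : Rep base s σ) (v : Var) (a : Fin m) :
    Rep base (s.setReg v.reg a) (σ.setVar v a) := by
  obtain ⟨⟨h1, h2, h3⟩, h4⟩ := h
  refine ⟨⟨?_, ?_, fun w => ?_⟩, h4⟩
  · rw [State.setReg_reg, if_neg (v.reg_ne_scratch 0).symm, h1]
  · rw [State.setReg_reg, if_neg (v.reg_ne_scratch 1).symm, h2]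
  · rw [State.setReg_reg, Conf.setVar_env, h3]
    have : w.reg = v.reg ↔ w = v := by simp [Var.reg, Var.idx_inj]
    simp only [this]
    split_ifs <;> rfl

/-- Compilation of formulas: the truth value is computed into the scratch register `d`. -/
def Fm.compile : Fm → ℕ → Program
  | .rel r v w, d => .seq (cellAddr d r.idx (2 * v.idx) (2 * w.idx)) (.load (scratch d) (scratch d))
  | .eq v w, d => .ite (.eq v.reg w.reg) (.const (scratch d) 1) (.const (scratch d) 0)
  | .lt v w, d => .ite (.lt v.reg w.reg) (.const (scratch d) 1) (.const (scratch d) 0)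
  | .neg φ, d => .seq (φ.compile d) <| .seq (.const (scratch (d + 1)) 0) <|
      .ite (.eq (scratch d) (scratch (d + 1))) (.const (scratch d) 1) (.const (scratch d) 0)
  | .and φ ψ, d => .seq (φ.compile d) <| .seq (.const (scratch (d + 1)) 0) <|
      .ite (.eq (scratch d) (scratch (d + 1))) .skip (ψ.compile d)
  | .ex v φ, d => .seq (.copy (scratch (d + 1)) v.reg) <| .seq (.const (scratch d) 0) <|
      .seq (.const v.reg 0) <| .seq (.loop (.lt v.reg (scratch 0)) <|
        .seq (φ.compile (d + 2)) <| .seq (.const (scratch (d + 3)) 0) <|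
        .seq (.ite (.eq (scratch (d + 2)) (scratch (d + 3))) .skip (.const (scratch d) 1)) <|
        .succ v.reg v.reg) <|
      .copy v.reg (scratch (d + 1))

/-- A bound for the running time of a compiled formula. -/
def Fm.cost : Fm → ℕ → ℕ
  | .rel r _ _, m => cellCost r.idx m + 1
  | .eq _ _, _ => 2
  | .lt _ _, _ => 2
  | .neg φ, m => φ.cost m + 3
  | .and φ ψ, m => φ.cost m + ψ.cost m + 3
  | .ex _ φ, m => m * (φ.cost m + 5) + 5

/-- The induction has to vary `d`, `s` and `σ` together: a quantifier evaluates its body in a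
modified configuration and two scratch registers further on. -/
theorem Fm.runsIn_compile {base : ℕ} (φ : Fm) {d : ℕ} (hd : 2 ≤ d) {s : State} {σ : Conf m}
    (h : Rep base s σ) :
    RunsIn (φ.compile d) s (φ.cost m) fun s' =>
      SameBelow d s s' ∧ s'.reg (scratch d) = ind (φ.Sat σ) := by
  induction φ generalizing d s σ with
  | rel r v w =>
    have hv := h.1.2.2 v
    have hw := h.1.2.2 w
    refine RunsIn.seq (runsIn_cellAddr hd s h.1.1 ?_ ?_) ?_
    · exact hv ▸ (σ.env v).2
    · exact hw ▸ (σ.env w).2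
    rintro s' ⟨h1, h2⟩
    refine RunsIn.load ⟨h1.setReg le_rfl _, ?_⟩
    rw [State.setReg_reg, if_pos rfl, h2, h1.1, h.1.2.1]
    change s.mem (cell m base r.idx (s.reg v.reg) (s.reg w.reg)) = _
    rw [hv, hw]
    exact h.2 r _ _
  | eq v w =>
    refine RunsIn.ite (T := 1) (fun hb => RunsIn.const ?_) (fun hb => RunsIn.const ?_)
    all_goals
      refine ⟨(SameBelow.refl d s).setReg le_rfl _, ?_⟩
      simp only [Test.Holds, h.1.2.2, Fin.val_inj] at hb
      simp [State.setReg_reg, ind, hb]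
  | lt v w =>
    refine RunsIn.ite (T := 1) (fun hb => RunsIn.const ?_) (fun hb => RunsIn.const ?_)
    all_goals
      refine ⟨(SameBelow.refl d s).setReg le_rfl _, ?_⟩
      simp only [Test.Holds, h.1.2.2, Fin.val_fin_lt] at hb
      simp [State.setReg_reg, ind, hb]
  | neg φ ih =>
    refine RunsIn.mono (T := φ.cost m + (1 + (1 + 1))) (RunsIn.seq (ih hd h) ?_) (by simp [cost])
      (fun _ h => h)
    rintro s1 ⟨h1, e1⟩
    refine RunsIn.seq (Q := fun s' => SameBelow d s s' ∧ s'.reg (scratch d) = ind (φ.Sat σ) ∧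
      s'.reg (scratch (d + 1)) = 0) (RunsIn.const ⟨h1.setReg (by omega) _,
        by simp [State.setReg_reg, e1], by simp [State.setReg_reg]⟩) ?_
    rintro s2 ⟨h2, e2, f2⟩
    refine RunsIn.ite (T := 1) (fun hb => RunsIn.const ?_) (fun hb => RunsIn.const ?_)
    all_goals
      refine ⟨h2.setReg le_rfl _, ?_⟩
      simp only [Test.Holds, e2, f2, ind_eq_zero] at hb
      simp [State.setReg_reg, ind, hb]
  | and φ ψ hφ hψ =>
    refine RunsIn.mono (T := φ.cost m + (1 + (1 + (ψ.cost m + 1)))) (RunsIn.seq (hφ hd h) ?_)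
      (by simp [cost]; omega) (fun _ h => h)
    rintro s1 ⟨h1, e1⟩
    refine RunsIn.seq (Q := fun s' => SameBelow d s s' ∧ s'.reg (scratch d) = ind (φ.Sat σ) ∧
      s'.reg (scratch (d + 1)) = 0) (RunsIn.const ⟨h1.setReg (by omega) _,
        by simp [State.setReg_reg, e1], by simp [State.setReg_reg]⟩) ?_
    rintro s2 ⟨h2, e2, f2⟩
    refine RunsIn.ite (fun hb => ?_) (fun hb => ?_)
    · refine RunsIn.mono (T := 1) (RunsIn.skip ⟨h2, ?_⟩) (by omega) (fun _ h => h)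
      simp only [Test.Holds, e2, f2, ind_eq_zero] at hb
      simp [e2, ind, hb]
    · simp only [Test.Holds, e2, f2, ind_eq_zero, not_not] at hb
      refine RunsIn.mono (hψ hd (h.sameBelow hd h2)) (by omega) ?_
      rintro s' ⟨h3, e3⟩
      exact ⟨h2.trans h3 le_rfl, by rw [e3]; exact ind_congr (by simp [hb])⟩
  | ex v φ ih =>
    refine RunsIn.mono (T := 1 + (1 + (1 + ((m * ((φ.cost m + (1 + ((1 + 1) + 1))) + 1) + 1) + 1))))
      ?_ (by simp only [cost]; ring_nf; omega) (fun _ h => h)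
    refine RunsIn.seq (Q := fun s' => s' = s.setReg (scratch (d + 1)) (s.reg v.reg))
      (RunsIn.copy rfl) ?_
    rintro _ rfl
    refine RunsIn.seq (RunsIn.const (Q := fun s' => SameBelow d s s' ∧
      s'.reg (scratch d) = 0 ∧ s'.reg (scratch (d + 1)) = s.reg v.reg) ⟨?_, ?_, ?_⟩) ?_
    · exact ((SameBelow.refl d s).setReg (by omega) _).setReg le_rfl _
    · simp [State.setReg_reg]
    · simp [State.setReg_reg]
    rintro s1 ⟨h1, e1, f1⟩
    refine RunsIn.seq (Q := fun s' => s' = s1.setReg v.reg 0) (RunsIn.const rfl) ?_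
    rintro _ rfl
    have hreg : v.reg ≠ scratch (d + 1) := v.reg_ne_scratch _
    refine RunsIn.seq (RunsIn.loop (N := m) (T := φ.cost m + (1 + ((1 + 1) + 1)))
      -- The loop overwrites the register of the bound variable, so the frame condition is stated
      -- for the state in which the old value has been put back.
      (I := fun j s' => s'.reg v.reg = j ∧ SameBelow d s (s'.setReg v.reg (s.reg v.reg)) ∧
        s'.reg (scratch d) = ind (∃ a : Fin m, a.val < j ∧ φ.Sat (σ.setVar v a)) ∧
        s'.reg (scratch (d + 1)) = s.reg v.reg) ?_ ?_ ?_) ?_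
    · refine ⟨by simp [State.setReg_reg], ?_, ?_, ?_⟩
      · refine ⟨h1.1, fun r hr => ?_⟩
        simp only [State.setReg_reg]
        split_ifs with hrv
        · rw [hrv]
        · exact h1.2 r hr
      · simp [State.setReg_reg, (v.reg_ne_scratch d).symm, e1, ind]
      · simp [State.setReg_reg, hreg.symm, f1]
    · rintro j hj s' ⟨g1, g2, g3, g4⟩
      have hm : s'.reg (scratch 0) = m := by
        have := g2.reg_scratch (i := 0) (by omega)
        rw [State.setReg_reg, if_neg (v.reg_ne_scratch 0).symm] at this
        rw [this, h.1.1]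
      refine ⟨by simp only [Test.Holds, g1, hm]; exact hj, ?_⟩
      have hrep : Rep base s' (σ.setVar v ⟨j, hj⟩) := by
        have := (h.sameBelow hd g2).setVar v ⟨j, hj⟩
        have e : (s'.setReg v.reg (s.reg v.reg)).setReg v.reg j = s' := by
          simp only [State.setReg, Function.update_idem, ← g1, Function.update_eq_self]
        rwa [e] at this
      refine RunsIn.seq (ih (by omega) hrep) ?_
      rintro s2 ⟨h2, e2⟩
      refine RunsIn.seq (Q := fun s'' => SameBelow (d + 2) s' s'' ∧
        s''.reg (scratch (d + 2)) = ind (φ.Sat (σ.setVar v ⟨j, hj⟩)) ∧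
        s''.reg (scratch (d + 3)) = 0) (RunsIn.const ⟨h2.setReg (by omega) _,
          by simp [State.setReg_reg, e2], by simp [State.setReg_reg]⟩) ?_
      rintro s3 ⟨h3, e3, f3⟩
      have e3' := h3.reg_scratch (i := d) (by omega)
      rw [g3] at e3'
      refine RunsIn.seq (Q := fun s'' => SameBelow d s' s'' ∧
        s''.reg (scratch (d + 1)) = s.reg v.reg ∧
        s''.reg (scratch d) = ind (∃ a : Fin m, a.val < j + 1 ∧ φ.Sat (σ.setVar v a))) ?_ ?_
      · have hsucc : (∃ a : Fin m, a.val < j + 1 ∧ φ.Sat (σ.setVar v a)) ↔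
            (∃ a : Fin m, a.val < j ∧ φ.Sat (σ.setVar v a)) ∨ φ.Sat (σ.setVar v ⟨j, hj⟩) := by
          constructor
          · rintro ⟨a, h1, h2⟩
            rcases Nat.lt_succ_iff_lt_or_eq.1 h1 with h | h
            · exact Or.inl ⟨a, h, h2⟩
            · right
              have : a = ⟨j, hj⟩ := Fin.ext h
              rwa [← this]
          · rintro (⟨a, h1, h2⟩ | h)
            · exact ⟨a, by omega, h2⟩
            · exact ⟨⟨j, hj⟩, by simp, h⟩
        have hb' : SameBelow d s' s3 := (SameBelow.refl d s').trans h3 (by omega)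
        refine RunsIn.ite (T := 1) (fun hb => RunsIn.skip ?_) (fun hb => RunsIn.const ?_)
        · simp only [Test.Holds, e3, f3, ind_eq_zero] at hb
          exact ⟨hb', by rw [h3.reg_scratch (by omega), g4],
            by rw [e3']; exact ind_congr (by rw [hsucc]; simp [hb])⟩
        · simp only [Test.Holds, e3, f3, ind_eq_zero, not_not] at hb
          refine ⟨hb'.setReg le_rfl _, ?_, ?_⟩
          · rw [State.setReg_reg, if_neg (by simp), h3.reg_scratch (by omega), g4]
          · rw [State.setReg_reg, if_pos rfl, ind_pos (hsucc.2 (Or.inr hb))]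
      · rintro s4 ⟨h4, f4, e4⟩
        refine RunsIn.succ ⟨?_, ⟨?_, fun r hr => ?_⟩, ?_, ?_⟩
        · rw [State.setReg_reg, if_pos rfl, h4.reg_var, g1]
        · exact h4.1.trans g2.1
        · have := g2.2 r hr
          simp only [State.setReg_reg] at this ⊢
          split_ifs with hrv
          · simp [hrv]
          · rw [if_neg hrv] at this
            rw [h4.2 r hr, this]
        · rw [State.setReg_reg, if_neg (v.reg_ne_scratch d).symm, e4]
        · rw [State.setReg_reg, if_neg hreg.symm, f4]
    · rintro s' ⟨g1, g2, g3, g4⟩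
      have hm : s'.reg (scratch 0) = m := by
        have := g2.reg_scratch (i := 0) (by omega)
        rw [State.setReg_reg, if_neg (v.reg_ne_scratch 0).symm] at this
        rw [this, h.1.1]
      simp [Test.Holds, g1, hm]
    · rintro s' ⟨g1, g2, g3, g4⟩
      refine RunsIn.copy ⟨by rw [g4]; exact g2, ?_⟩
      rw [State.setReg_reg, if_neg (v.reg_ne_scratch d).symm, g3]
      exact ind_congr (by simp)

/-- Compilation of commands; the scratch registers from `d` on are used. -/
def Cmd.compile : Cmd → ℕ → Program
  | .skip, _ => .skip
  -- Two passes through the buffer matrix `0` are needed because `φ` may mention `r`: the old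
  -- relation must stay intact until all truth values are known.
  | .assign r φ, d => .seq (.copy (scratch d) Var.x.reg) <| .seq (.copy (scratch (d + 1)) Var.y.reg)
      <| .seq (forRange Var.x.reg <| forRange Var.y.reg <| .seq (φ.compile (d + 2)) <|
        .seq (cellAddr (d + 3) 0 (2 * Var.x.idx) (2 * Var.y.idx)) <|
        .store (scratch (d + 3)) (scratch (d + 2))) <|
      .seq (forRange Var.x.reg <| forRange Var.y.reg <|
        .seq (cellAddr (d + 2) 0 (2 * Var.x.idx) (2 * Var.y.idx)) <|
        .seq (.load (scratch (d + 2)) (scratch (d + 2))) <|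
        .seq (cellAddr (d + 3) r.idx (2 * Var.x.idx) (2 * Var.y.idx)) <|
        .store (scratch (d + 3)) (scratch (d + 2))) <|
      .seq (.copy Var.x.reg (scratch d)) (.copy Var.y.reg (scratch (d + 1)))
  -- The scan runs downwards from the size of the universe, so the hit recorded last is the least
  -- one; the initial `0` survives if there is none.
  | .pick v φ, d => .seq (.const (scratch d) 0) <| .seq (.const (scratch (d + 1)) 0) <|
      .seq (.copy v.reg (scratch 0)) <| .seq (.loop (.lt (scratch (d + 1)) v.reg) <|
        .seq (.pred v.reg v.reg) <| .seq (φ.compile (d + 2)) <|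
        .ite (.eq (scratch (d + 2)) (scratch (d + 1))) .skip (.copy (scratch d) v.reg)) <|
      .copy v.reg (scratch d)
  | .seq P Q, d => .seq (P.compile d) (Q.compile d)
  | .ite φ P Q, d => .seq (φ.compile d) <| .seq (.const (scratch (d + 1)) 0) <|
      .ite (.eq (scratch d) (scratch (d + 1))) (Q.compile d) (P.compile d)
  | .rep P, d => forRange (scratch d) (P.compile (d + 1))

/-- A bound for the running time of a compiled command. -/
def Cmd.cost : Cmd → ℕ → ℕ
  | .skip, _ => 1
  | .assign r φ, m =>
      (m * ((m * ((φ.cost m + (cellCost 0 m + 1)) + 2) + 2) + 2) + 2) +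
      (m * ((m * ((cellCost 0 m + (1 + (cellCost r.idx m + 1))) + 2) + 2) + 2) + 2) + 4
  | .pick _ φ, m => m * (φ.cost m + 4) + 5
  | .seq P Q, m => P.cost m + Q.cost m
  | .ite φ P Q, m => φ.cost m + P.cost m + Q.cost m + 2
  | .rep P, m => m * (P.cost m + 2) + 2

end DFVS

/-! ### Correctness and running time of compiled commands -/

namespace DFVS
variable {m : ℕ}

/-- `J j i` describes the moment when exactly the pairs before `(j, i)` in lexicographic order are
done, and `carry` passes from the end of a row to the start of the next. The conditions `hx` and
`hy` make the invariant blind to the two counters. -/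
theorem runsIn_forPairs {x y N T : ℕ} {P : Program} {J : ℕ → ℕ → State → Prop} {s : State}
    (hxy : x ≠ y) (h0 : J 0 0 s) (hx : ∀ j i s a, J j i s → J j i (s.setReg x a))
    (hy : ∀ j i s a, J j i s → J j i (s.setReg y a))
    (hN : ∀ j i s, J j i s → s.reg (scratch 0) = N) (carry : ∀ j s, J j N s → J (j + 1) 0 s)
    (step : ∀ j < N, ∀ i < N, ∀ s, J j i s → s.reg x = j → s.reg y = i →
      RunsIn P s T fun s' => J j (i + 1) s' ∧ s'.reg x = j ∧ s'.reg y = i) :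
    RunsIn (forRange x (forRange y P)) s (N * ((N * (T + 2) + 2) + 2) + 2) (J N 0) := by
  refine RunsIn.mono (runsIn_forRange (N := N) (I := fun j s' => s'.reg x = j ∧ J j 0 s')
    ?_ ?_ ?_) le_rfl (fun _ h => h.2)
  · exact ⟨by simp [State.setReg_reg], hx _ _ _ _ h0⟩
  · rintro j s' ⟨h1, h2⟩
    exact ⟨h1, hN _ _ _ h2⟩
  · rintro j hj s' ⟨h1, h2⟩
    refine RunsIn.mono (runsIn_forRange (N := N)
      (I := fun i s' => s'.reg y = i ∧ s'.reg x = j ∧ J j i s') ?_ ?_ ?_) le_rfl ?_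
    · exact ⟨by simp [State.setReg_reg], by simp [State.setReg_reg, hxy, h1], hy _ _ _ _ h2⟩
    · rintro i s'' ⟨g1, g2, g3⟩
      exact ⟨g1, hN _ _ _ g3⟩
    · rintro i hi s'' ⟨g1, g2, g3⟩
      refine RunsIn.mono (step j hj i hi s'' g3 g2 g1) le_rfl ?_
      rintro s3 ⟨f1, f2, f3⟩
      exact ⟨by simp [State.setReg_reg, f3], by simp [State.setReg_reg, hxy, f2], hy _ _ _ _ f1⟩
    · rintro s'' ⟨g1, g2, g3⟩
      exact ⟨by simp [State.setReg_reg, g2], hx _ _ _ _ (carry _ _ g3)⟩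

theorem Var.reg_inj {v w : Var} : v.reg = w.reg ↔ v = w := by simp [Var.reg, Var.idx_inj]

/-- The registers represent the variables except for `x` and `y`, whose values in `s` are saved in
the scratch registers `d` and `d + 1`. -/
def Saved (d : ℕ) (s : State) (s' : State) : Prop :=
  (∀ v : Var, v ≠ .x → v ≠ .y → s'.reg v.reg = s.reg v.reg) ∧
    (∀ i < d, s'.reg (scratch i) = s.reg (scratch i)) ∧
    s'.reg (scratch d) = s.reg Var.x.reg ∧ s'.reg (scratch (d + 1)) = s.reg Var.y.reg

theorem Saved.setReg {d : ℕ} {s s' : State} (h : Saved d s s') {v : Var} (hv : v = .x ∨ v = .y)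
    (a : ℕ) : Saved d s (s'.setReg v.reg a) := by
  obtain ⟨h1, h2, h3, h4⟩ := h
  refine ⟨fun w hx hy => ?_, fun i hi => ?_, ?_, ?_⟩
  · rw [State.setReg_reg, if_neg, h1 w hx hy]
    rw [Var.reg_inj]
    rintro rfl
    rcases hv with h | h
    · exact hx h
    · exact hy h
  · rw [State.setReg_reg, if_neg (v.reg_ne_scratch _).symm, h2 i hi]
  · rw [State.setReg_reg, if_neg (v.reg_ne_scratch _).symm, h3]
  · rw [State.setReg_reg, if_neg (v.reg_ne_scratch _).symm, h4]

theorem Saved.sameBelow {d : ℕ} {s s' s'' : State} (h : Saved d s s')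
    (h' : ∀ r, (∀ j, d + 2 ≤ j → r ≠ scratch j) → s''.reg r = s'.reg r) : Saved d s s'' := by
  obtain ⟨h1, h2, h3, h4⟩ := h
  have hs : ∀ i < d + 2, s''.reg (scratch i) = s'.reg (scratch i) := fun i hi =>
    h' _ fun j hj => by simp; omega
  exact ⟨fun w hx hy => (h' _ fun j _ => w.reg_ne_scratch j).trans (h1 w hx hy),
    fun i hi => (hs i (by omega)).trans (h2 i hi), (hs _ (by omega)).trans h3,
    (hs _ (by omega)).trans h4⟩

theorem Saved.repVar {d base : ℕ} {s s' : State} {σ : Conf m} (hd : 2 ≤ d) (h : Saved d s s')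
    (hs : RepVar base s σ) {a b : Fin m} (ha : s'.reg Var.x.reg = a) (hb : s'.reg Var.y.reg = b) :
    RepVar base s' ((σ.setVar .x a).setVar .y b) := by
  refine ⟨by rw [h.2.1 0 (by omega), hs.1], by rw [h.2.1 1 (by omega), hs.2.1], fun v => ?_⟩
  by_cases hy : v = .y
  · subst hy; simp [hb]
  by_cases hx : v = .x
  · subst hx; simp [ha]
  · simp [hx, hy, h.1 v hx hy, hs.2.2 v]

theorem Cmd.runsIn_assign {base : ℕ} (r : Rel) (φ : Fm) {d : ℕ} (hd : 2 ≤ d) {s : State}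
    {σ : Conf m} (h : Rep base s σ) :
    RunsIn ((Cmd.assign r φ).compile d) s ((Cmd.assign r φ).cost m) fun s' =>
      Rep base s' (σ.setRel r fun a b => φ.Sat ((σ.setVar .x a).setVar .y b)) ∧
        ∀ j < d, s'.reg (scratch j) = s.reg (scratch j) := by
  set ψ : Fin m → Fin m → Prop := fun a b => φ.Sat ((σ.setVar .x a).setVar .y b) with hψ
  have hxy : Var.x.reg ≠ Var.y.reg := by simp [Var.reg, Var.idx]
  have hcell : ∀ {q q' : ℕ} {a b a' b' : Fin m}, cell m base q a b = cell m base q' a' b' →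
      q = q' ∧ a = a' ∧ b = b' := fun hc => by
    obtain ⟨h1, h2, h3⟩ := cell_inj (Fin.is_lt _) (Fin.is_lt _) (Fin.is_lt _) (Fin.is_lt _) hc
    exact ⟨h1, Fin.ext h2, Fin.ext h3⟩
  refine RunsIn.mono (T := 1 + (1 +
      ((m * ((m * ((φ.cost m + (cellCost 0 m + 1)) + 2) + 2) + 2) + 2) +
      ((m * ((m * ((cellCost 0 m + (1 + (cellCost r.idx m + 1))) + 2) + 2) + 2) + 2) + (1 + 1)))))
    ?_ (by simp only [Cmd.cost]; omega) (fun _ h => h)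
  refine RunsIn.seq (Q := fun s' => s' = s.setReg (scratch d) (s.reg Var.x.reg))
    (RunsIn.copy rfl) ?_
  rintro _ rfl
  refine RunsIn.seq (Q := fun s' => Saved d s s' ∧ RepRel base s' σ.rel)
    (RunsIn.copy ⟨⟨?_, ?_, ?_, ?_⟩, h.2⟩) ?_
  · intro v _ _
    simp [State.setReg_reg, v.reg_ne_scratch]
  · intro i hi
    rw [State.setReg_reg, if_neg (by simp; omega), State.setReg_reg, if_neg (by simp; omega)]
  · simp [State.setReg_reg]
  · simp [State.setReg_reg, Var.reg_ne_scratch]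
  rintro s1 ⟨h1, h1'⟩
  refine RunsIn.seq (runsIn_forPairs (N := m) (J := fun j i s' => Saved d s s' ∧
    RepRel base s' σ.rel ∧ ∀ a b : Fin m, (a.val < j ∨ a.val = j ∧ b.val < i) →
      s'.mem (cell m base 0 a b) = ind (ψ a b)) hxy ?_ ?_ ?_ ?_ ?_ ?_) ?_
  · exact ⟨h1, h1', fun a b hab => by omega⟩
  · rintro j i s' a ⟨g1, g2, g3⟩
    exact ⟨g1.setReg (Or.inl rfl) a, g2, g3⟩
  · rintro j i s' a ⟨g1, g2, g3⟩
    exact ⟨g1.setReg (Or.inr rfl) a, g2, g3⟩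
  · rintro j i s' ⟨g1, g2, g3⟩
    rw [g1.2.1 0 (by omega), h.1.1]
  · rintro j s' ⟨g1, g2, g3⟩
    exact ⟨g1, g2, fun a b hab => g3 a b (by have := b.2; omega)⟩
  · rintro j hj i hi s' ⟨g1, g2, g3⟩ ex ey
    have hrep : Rep base s' ((σ.setVar .x ⟨j, hj⟩).setVar .y ⟨i, hi⟩) :=
      ⟨g1.repVar hd h.1 ex ey, g2⟩
    refine RunsIn.seq (φ.runsIn_compile (by omega) hrep) ?_
    rintro s2 ⟨h2, e2⟩
    refine RunsIn.seq (runsIn_cellAddr (x := Var.x.idx) (y := Var.y.idx) (m := m) (by omega) s2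
      ?_ ?_ ?_) ?_
    · rw [h2.reg_scratch (by omega), hrep.1.1]
    · rw [h2.reg_two_mul]; change s'.reg Var.x.reg < m; omega
    · rw [h2.reg_two_mul]; change s'.reg Var.y.reg < m; omega
    rintro s3 ⟨h3, e3⟩
    rw [h2.reg_two_mul, h2.reg_two_mul, h2.reg_scratch (by omega), hrep.1.2.1] at e3
    change _ = cell m base 0 (s'.reg Var.x.reg) (s'.reg Var.y.reg) at e3
    rw [ex, ey] at e3
    have h4 := h2.trans h3 (by omega)
    refine RunsIn.store ⟨⟨g1.sameBelow h4.2, ?_, ?_⟩, ?_, ?_⟩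
    · intro q a b
      rw [State.setMem_mem, if_neg, h4.1, g2]
      rw [e3]
      intro hc
      exact q.idx_ne_zero (hcell (a' := ⟨j, hj⟩) (b' := ⟨i, hi⟩) hc).1
    · intro a b hab
      rw [State.setMem_mem, e3, h3.reg_scratch (by omega), e2]
      by_cases hc : a = ⟨j, hj⟩ ∧ b = ⟨i, hi⟩
      · rw [if_pos (by rw [hc.1, hc.2]), hc.1, hc.2]
      · rw [if_neg fun hc' => hc (hcell (a' := ⟨j, hj⟩) (b' := ⟨i, hi⟩) hc').2, h4.1, g3]
        rcases hab with hab | ⟨hab, hab'⟩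
        · exact Or.inl hab
        · refine Or.inr ⟨hab, lt_of_le_of_ne (by omega) fun hb => hc ⟨Fin.ext hab, Fin.ext hb⟩⟩
    · rw [State.setMem_reg, h4.reg_var, ex]
    · rw [State.setMem_reg, h4.reg_var, ey]
  rintro s2 ⟨h2, h2', h2''⟩
  -- During the second pass the memory represents a hybrid: the new relation on the pairs already
  -- copied, the old one elsewhere.
  refine RunsIn.seq (runsIn_forPairs (N := m) (J := fun j i s' => Saved d s s' ∧
    (∀ a b : Fin m, s'.mem (cell m base 0 a b) = ind (ψ a b)) ∧
    RepRel base s' (fun q a b => if q = r ∧ (a.val < j ∨ a.val = j ∧ b.val < i) then ψ a b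
      else σ.rel q a b)) hxy ?_ ?_ ?_ ?_ ?_ ?_) ?_
  · refine ⟨h2, fun a b => h2'' a b (Or.inl a.2), fun q a b => ?_⟩
    simpa using h2' q a b
  · rintro j i s' a ⟨g1, g2, g3⟩
    exact ⟨g1.setReg (Or.inl rfl) a, g2, g3⟩
  · rintro j i s' a ⟨g1, g2, g3⟩
    exact ⟨g1.setReg (Or.inr rfl) a, g2, g3⟩
  · rintro j i s' ⟨g1, g2, g3⟩
    rw [g1.2.1 0 (by omega), h.1.1]
  · rintro j s' ⟨g1, g2, g3⟩
    refine ⟨g1, g2, fun q a b => ?_⟩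
    have e : (a.val < j + 1 ∨ a.val = j + 1 ∧ b.val < 0) ↔ (a.val < j ∨ a.val = j ∧ b.val < m) := by
      have := b.2; omega
    simp only [e]
    exact g3 q a b
  · rintro j hj i hi s' ⟨g1, g2, g3⟩ ex ey
    have hrep := g1.repVar hd h.1 (a := ⟨j, hj⟩) (b := ⟨i, hi⟩) ex ey
    refine RunsIn.seq (runsIn_cellAddr (x := Var.x.idx) (y := Var.y.idx) (m := m) (by omega) s'
      hrep.1 ?_ ?_) ?_
    · change s'.reg Var.x.reg < m; omega
    · change s'.reg Var.y.reg < m; omega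
    rintro s3 ⟨h3, e3⟩
    rw [hrep.2.1] at e3
    change _ = cell m base 0 (s'.reg Var.x.reg) (s'.reg Var.y.reg) at e3
    rw [ex, ey] at e3
    refine RunsIn.seq (Q := fun s'' => SameBelow (d + 2) s' s'' ∧
      s''.reg (scratch (d + 2)) = ind (ψ ⟨j, hj⟩ ⟨i, hi⟩))
      (RunsIn.load ⟨h3.setReg le_rfl _, ?_⟩) ?_
    · rw [State.setReg_reg, if_pos rfl, e3, h3.1]
      exact g2 ⟨j, hj⟩ ⟨i, hi⟩
    rintro s4 ⟨h4, e4⟩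
    refine RunsIn.seq (runsIn_cellAddr (x := Var.x.idx) (y := Var.y.idx) (m := m) (by omega) s4
      ?_ ?_ ?_) ?_
    · rw [h4.reg_scratch (by omega), hrep.1]
    · rw [h4.reg_two_mul]; change s'.reg Var.x.reg < m; omega
    · rw [h4.reg_two_mul]; change s'.reg Var.y.reg < m; omega
    rintro s5 ⟨h5, e5⟩
    rw [h4.reg_two_mul, h4.reg_two_mul, h4.reg_scratch (by omega), hrep.2.1] at e5
    change _ = cell m base r.idx (s'.reg Var.x.reg) (s'.reg Var.y.reg) at e5
    rw [ex, ey] at e5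
    have h6 := h4.trans h5 (by omega)
    refine RunsIn.store ⟨⟨g1.sameBelow h6.2, ?_, ?_⟩, ?_, ?_⟩
    · intro a b
      rw [State.setMem_mem, if_neg, h6.1, g2]
      rw [e5]
      intro hc
      exact r.idx_ne_zero (hcell (a' := ⟨j, hj⟩) (b' := ⟨i, hi⟩) hc).1.symm
    · intro q a b
      rw [State.setMem_mem, e5, h5.reg_scratch (by omega), e4]
      by_cases hc : q = r ∧ a = ⟨j, hj⟩ ∧ b = ⟨i, hi⟩
      · obtain ⟨rfl, rfl, rfl⟩ := hc
        simp
      · rw [if_neg, h6.1, g3]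
        · refine ind_congr ?_
          have e : (q = r ∧ (a.val < j ∨ a.val = j ∧ b.val < i)) ↔
              (q = r ∧ (a.val < j ∨ a.val = j ∧ b.val < i + 1)) := by
            refine and_congr_right fun hq => ⟨fun h => by omega, fun h => ?_⟩
            rcases h with h | ⟨h, h'⟩
            · exact Or.inl h
            · exact Or.inr ⟨h, lt_of_le_of_ne (by omega) fun hb =>
                hc ⟨hq, Fin.ext h, Fin.ext hb⟩⟩
          simp only [e]
        · intro hc'
          have := hcell (a' := ⟨j, hj⟩) (b' := ⟨i, hi⟩) hc'
          exact hc ⟨Rel.idx_inj.1 this.1, this.2⟩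
    · rw [State.setMem_reg, h6.reg_var, ex]
    · rw [State.setMem_reg, h6.reg_var, ey]
  rintro s3 ⟨h3, -, h3'⟩
  refine RunsIn.seq (Q := fun s' => s' = s3.setReg Var.x.reg (s3.reg (scratch d)))
    (RunsIn.copy rfl) ?_
  rintro _ rfl
  refine RunsIn.copy ⟨⟨⟨?_, ?_, fun v => ?_⟩, fun q a b => ?_⟩, fun j hj => ?_⟩
  · simp [State.setReg_reg, (Var.reg_ne_scratch _ _).symm, h3.2.1 0 (by omega), h.1.1]
  · simp [State.setReg_reg, (Var.reg_ne_scratch _ _).symm, h3.2.1 1 (by omega), h.1.2.1]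
  · simp only [State.setReg_reg, (Var.reg_ne_scratch _ _).symm, if_false, Var.reg_inj,
      h3.2.2.1, h3.2.2.2, Conf.setRel_env]
    split_ifs with hy hx
    · rw [hy, h.1.2.2]
    · rw [hx, h.1.2.2]
    · rw [h3.1 v hx hy, h.1.2.2]
  · rw [State.setReg_mem, State.setReg_mem, h3' q a b, Conf.setRel_rel]
    by_cases hq : q = r <;> simp [hq]
  · simp [State.setReg_reg, (Var.reg_ne_scratch _ _).symm, h3.2.1 j hj]

theorem Rep.reg_eq {base d : ℕ} {s s' : State} {σ : Conf m} {v : Var} {a : Fin m} (hd : 2 ≤ d)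
    (h : Rep base s σ) (h' : SameBelow d s (s'.setReg v.reg (s.reg v.reg)))
    (ha : s'.reg v.reg = a) : Rep base s' (σ.setVar v a) := by
  have := (h.sameBelow hd h').setVar v a
  have e : (s'.setReg v.reg (s.reg v.reg)).setReg v.reg a = s' := by
    simp only [State.setReg, Function.update_idem, ← ha, Function.update_eq_self]
  rwa [e] at this

/-- After `j` rounds the scratch register holds the least witness among the elements from `m - j`
on; for `j = m` the restriction is void. -/
theorem Cmd.runsIn_pick [NeZero m] {base : ℕ} (v : Var) (φ : Fm) {d : ℕ} (hd : 2 ≤ d) {s : State}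
    {σ : Conf m} (h : Rep base s σ) :
    RunsIn ((Cmd.pick v φ).compile d) s ((Cmd.pick v φ).cost m) fun s' =>
      Rep base s' (σ.setVar v (least fun a => φ.Sat (σ.setVar v a))) ∧
        ∀ j < d, s'.reg (scratch j) = s.reg (scratch j) := by
  set p : Fin m → Prop := fun a => φ.Sat (σ.setVar v a) with hp
  refine RunsIn.mono (T := 1 + (1 + (1 + ((m * ((1 + (φ.cost m + (1 + 1))) + 1) + 1) + 1))))
    ?_ (by simp only [Cmd.cost]; ring_nf; omega) (fun _ h => h)
  refine RunsIn.seq (Q := fun s' => s' = s.setReg (scratch d) 0) (RunsIn.const rfl) ?_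
  rintro _ rfl
  refine RunsIn.seq (Q := fun s' => SameBelow d s s' ∧ s'.reg (scratch d) = 0 ∧
    s'.reg (scratch (d + 1)) = 0) (RunsIn.const
      ⟨((SameBelow.refl d s).setReg le_rfl _).setReg (by omega) _, ?_, ?_⟩) ?_
  · simp [State.setReg_reg]
  · simp [State.setReg_reg]
  rintro s1 ⟨h1, e1, f1⟩
  refine RunsIn.seq (Q := fun s' => s' = s1.setReg v.reg (s1.reg (scratch 0))) (RunsIn.copy rfl) ?_
  rintro _ rfl
  have hs0 : ∀ {s' : State} {d' a : ℕ}, 2 ≤ d' → SameBelow d' s (s'.setReg v.reg a) →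
      s'.reg (scratch 0) = m := fun hd' g => by
    have := g.reg_scratch (i := 0) (by omega)
    rwa [State.setReg_reg, if_neg (v.reg_ne_scratch 0).symm, h.1.1] at this
  refine RunsIn.seq (RunsIn.loop (N := m) (T := 1 + (φ.cost m + (1 + 1)))
    (I := fun j s' => s'.reg v.reg = m - j ∧ SameBelow d s (s'.setReg v.reg (s.reg v.reg)) ∧
      s'.reg (scratch (d + 1)) = 0 ∧
      s'.reg (scratch d) = (least fun a => m - j ≤ a.val ∧ p a).val) ?_ ?_ ?_) ?_
  · refine ⟨?_, ⟨h1.1, fun r hr => ?_⟩, ?_, ?_⟩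
    · rw [State.setReg_reg, if_pos rfl, h1.reg_scratch (by omega), h.1.1]; simp
    · simp only [State.setReg_reg]
      split_ifs with hrv
      · rw [hrv]
      · exact h1.2 r hr
    · rw [State.setReg_reg, if_neg (v.reg_ne_scratch _).symm, f1]
    -- No element is at least `m`, so the default value of `least` agrees with the constant stored
    -- at the beginning.
    · rw [State.setReg_reg, if_neg (v.reg_ne_scratch _).symm, e1, least_eq_zero]
      · simp
      · rintro ⟨a, h1, h2⟩
        have := a.2
        omega
  · rintro j hj s' ⟨g1, g2, g3, g4⟩
    refine ⟨by simp only [Test.Holds, g1, g3]; omega, ?_⟩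
    have hlt : m - (j + 1) < m := by omega
    refine RunsIn.seq (Q := fun s'' => s''.reg v.reg = m - (j + 1) ∧
      SameBelow d s (s''.setReg v.reg (s.reg v.reg)) ∧
      s''.reg (scratch (d + 1)) = 0 ∧
      s''.reg (scratch d) = (least fun a => m - j ≤ a.val ∧ p a).val)
      (RunsIn.pred ⟨?_, ?_, ?_, ?_⟩) ?_
    · rw [State.setReg_reg, if_pos rfl, g1]; omega
    · have e : (s'.setReg v.reg (s'.reg v.reg - 1)).setReg v.reg (s.reg v.reg) =
        s'.setReg v.reg (s.reg v.reg) := by simp [State.setReg]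
      rwa [e]
    · rw [State.setReg_reg, if_neg (v.reg_ne_scratch _).symm, g3]
    · rw [State.setReg_reg, if_neg (v.reg_ne_scratch _).symm, g4]
    rintro s2 ⟨k1, k2, k3, k4⟩
    have hrep : Rep base s2 (σ.setVar v ⟨m - (j + 1), hlt⟩) := h.reg_eq hd k2 k1
    refine RunsIn.seq (φ.runsIn_compile (by omega) hrep) ?_
    rintro s3 ⟨h3, e3⟩
    have k3' := h3.reg_scratch (i := d + 1) (by omega)
    have k4' := h3.reg_scratch (i := d) (by omega)
    have k1' := h3.reg_var v
    have k2' : SameBelow d s (s3.setReg v.reg (s.reg v.reg)) := by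
      refine ⟨h3.1.trans k2.1, fun r hr => ?_⟩
      have := k2.2 r hr
      simp only [State.setReg_reg] at this ⊢
      split_ifs with hrv
      · simp [hrv]
      · rw [if_neg hrv] at this
        rw [h3.2 r fun j hj => hr j (by omega), this]
    change _ = ind (p ⟨m - (j + 1), hlt⟩) at e3
    refine RunsIn.ite (T := 1) (fun hb => RunsIn.skip ?_) (fun hb => RunsIn.copy ?_)
    · simp only [Test.Holds, e3, k3', k3, ind_eq_zero] at hb
      refine ⟨by rw [k1', k1], k2', by rw [k3', k3], ?_⟩
      rw [k4', k4]
      congr 3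
      ext a
      refine and_congr_left fun ha => ⟨fun h => by omega, fun h => ?_⟩
      by_contra hlt'
      exact hb (by convert ha; omega)
    · simp only [Test.Holds, e3, k3', k3, ind_eq_zero, not_not] at hb
      refine ⟨by rw [State.setReg_reg, if_neg (v.reg_ne_scratch _), k1', k1], ?_, ?_, ?_⟩
      · refine ⟨k2'.1, fun r hr => ?_⟩
        have := k2'.2 r hr
        simp only [State.setReg_reg] at this ⊢
        rw [if_neg (hr d le_rfl)]
        exact this
      · rw [State.setReg_reg, if_neg (by simp), k3', k3]
      · rw [State.setReg_reg, if_pos rfl, k1', k1, least_eq (a := ⟨m - (j + 1), hlt⟩) ⟨le_rfl, hb⟩]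
        rintro b hb ⟨h1, -⟩
        exact absurd hb (not_lt.2 h1)
  · rintro s' ⟨g1, g2, g3, g4⟩
    simp [Test.Holds, g1, g3]
  · rintro s' ⟨g1, g2, g3, g4⟩
    have e : (fun a : Fin m => m - m ≤ a.val ∧ p a) = p := by ext a; simp
    rw [e] at g4
    refine RunsIn.copy ⟨?_, fun j hj => ?_⟩
    · refine Rep.reg_eq hd h (a := least p) ?_ ?_
      · have e : (s'.setReg v.reg (s'.reg (scratch d))).setReg v.reg (s.reg v.reg) =
          s'.setReg v.reg (s.reg v.reg) := by simp [State.setReg]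
        rwa [e]
      · rw [State.setReg_reg, if_pos rfl, g4]
    · have := g2.reg_scratch hj
      rw [State.setReg_reg, if_neg (v.reg_ne_scratch _).symm] at this ⊢
      exact this

/-- The compiled command computes the effect of the command. -/
theorem Cmd.runsIn_compile [NeZero m] {base : ℕ} (P : Cmd) {d : ℕ} (hd : 2 ≤ d) {s : State}
    {σ : Conf m} (h : Rep base s σ) :
    RunsIn (P.compile d) s (P.cost m) fun s' => Rep base s' (P.eval σ) ∧
      ∀ j < d, s'.reg (scratch j) = s.reg (scratch j) := by
  induction P generalizing d s σ with
  | skip => exact RunsIn.skip ⟨h, fun _ _ => rfl⟩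
  | assign r φ => exact Cmd.runsIn_assign r φ hd h
  | pick v φ => exact Cmd.runsIn_pick v φ hd h
  | seq P Q hP hQ =>
    refine RunsIn.seq (hP hd h) ?_
    rintro s1 ⟨h1, e1⟩
    refine RunsIn.mono (hQ hd h1) le_rfl ?_
    rintro s2 ⟨h2, e2⟩
    exact ⟨h2, fun j hj => (e2 j hj).trans (e1 j hj)⟩
  | ite φ P Q hP hQ =>
    refine RunsIn.mono (T := φ.cost m + (1 + (1 + (P.cost m + Q.cost m))))
      (RunsIn.seq (φ.runsIn_compile hd h) ?_) (by simp only [cost]; omega) (fun _ h => h)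
    rintro s1 ⟨h1, e1⟩
    refine RunsIn.seq (Q := fun s' => SameBelow d s s' ∧ s'.reg (scratch d) = ind (φ.Sat σ) ∧
      s'.reg (scratch (d + 1)) = 0) (RunsIn.const ⟨h1.setReg (by omega) _,
        by simp [State.setReg_reg, e1], by simp [State.setReg_reg]⟩) ?_
    rintro s2 ⟨h2, e2, f2⟩
    refine RunsIn.ite (fun hb => ?_) (fun hb => ?_)
    · simp only [Test.Holds, e2, f2, ind_eq_zero] at hb
      refine RunsIn.mono (hQ hd (h.sameBelow hd h2)) (by omega) ?_
      rintro s3 ⟨h3, e3⟩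
      exact ⟨by rwa [eval, if_neg hb], fun j hj => (e3 j hj).trans (h2.reg_scratch hj)⟩
    · simp only [Test.Holds, e2, f2, ind_eq_zero, not_not] at hb
      refine RunsIn.mono (hP hd (h.sameBelow hd h2)) (by omega) ?_
      rintro s3 ⟨h3, e3⟩
      exact ⟨by rwa [eval, if_pos hb], fun j hj => (e3 j hj).trans (h2.reg_scratch hj)⟩
  | rep P hP =>
    have hset : ∀ {s' : State} {τ : Conf m} (a : ℕ), Rep base s' τ →
        Rep base (s'.setReg (scratch d) a) τ := fun a h' =>
      h'.sameBelow hd ((SameBelow.refl d _).setReg le_rfl a)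
    refine RunsIn.mono (runsIn_forRange (N := m) (I := fun j s' => s'.reg (scratch d) = j ∧
      Rep base s' (P.eval^[j] σ) ∧ ∀ j < d, s'.reg (scratch j) = s.reg (scratch j)) ?_ ?_ ?_)
      le_rfl (fun s' h' => h'.2)
    · refine ⟨by simp [State.setReg_reg], hset _ h, fun j hj => ?_⟩
      rw [State.setReg_reg, if_neg (by simp; omega)]
    · rintro j s' ⟨h1, h2, h3⟩
      exact ⟨h1, h2.1.1⟩
    · rintro j hj s' ⟨h1, h2, h3⟩
      refine RunsIn.mono (hP (by omega) h2) le_rfl ?_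
      rintro s2 ⟨g1, g2⟩
      refine ⟨?_, ?_, fun i hi => ?_⟩
      · rw [State.setReg_reg, if_pos rfl, g2 d (by omega), h1]
      · rw [Function.iterate_succ_apply']
        exact hset _ g1
      · rw [State.setReg_reg, if_neg (by simp; omega), g2 i (by omega), h3 i hi]

/-! ### Polynomial cost -/

/-- The function is a polynomial with natural coefficients. -/
def IsPoly (f : ℕ → ℕ) : Prop := ∃ p : Polynomial ℕ, ∀ m, f m = p.eval m

theorem IsPoly.const (c : ℕ) : IsPoly fun _ => c := ⟨.C c, by simp⟩
theorem IsPoly.id : IsPoly fun m => m := ⟨.X, by simp⟩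
theorem IsPoly.add {f g : ℕ → ℕ} : IsPoly f → IsPoly g → IsPoly fun m => f m + g m := by
  rintro ⟨p, hp⟩ ⟨q, hq⟩; exact ⟨p + q, by simp [hp, hq]⟩
theorem IsPoly.mul {f g : ℕ → ℕ} : IsPoly f → IsPoly g → IsPoly fun m => f m * g m := by
  rintro ⟨p, hp⟩ ⟨q, hq⟩; exact ⟨p * q, by simp [hp, hq]⟩
theorem IsPoly.comp {f g : ℕ → ℕ} : IsPoly f → IsPoly g → IsPoly fun m => f (g m) := by
  rintro ⟨p, hp⟩ ⟨q, hq⟩; exact ⟨p.comp q, by simp [hp, hq]⟩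

theorem isPoly_cellCost (r : ℕ) : IsPoly (cellCost r) := by
  refine ⟨.C r * (3 * .X + 4) + (.C r * .X + .X) * (3 * .X + 4) + 3 * .X + 9, fun m => ?_⟩
  simp [cellCost]

theorem Fm.isPoly_cost (φ : Fm) : IsPoly φ.cost := by
  induction φ with
  | rel r v w => exact (isPoly_cellCost _).add (.const 1)
  | eq v w => exact .const 2
  | lt v w => exact .const 2
  | neg φ ih => exact ih.add (.const 3)
  | and φ ψ hφ hψ => exact (hφ.add hψ).add (.const 3)
  | ex v φ ih => exact (IsPoly.id.mul (ih.add (.const 5))).add (.const 5)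

theorem Cmd.isPoly_cost (P : Cmd) : IsPoly P.cost := by
  have hrange : ∀ {f : ℕ → ℕ}, IsPoly f → IsPoly fun m => m * (f m + 2) + 2 := fun hf =>
    (IsPoly.id.mul (hf.add (.const 2))).add (.const 2)
  induction P with
  | skip => exact .const 1
  | assign r φ =>
    exact ((hrange (hrange (φ.isPoly_cost.add ((isPoly_cellCost 0).add (.const 1))))).add
      (hrange (hrange ((isPoly_cellCost 0).add ((IsPoly.const 1).add
        ((isPoly_cellCost r.idx).add (.const 1))))))).add (.const 4)
  | pick v φ => exact (IsPoly.id.mul (φ.isPoly_cost.add (.const 4))).add (.const 5)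
  | seq P Q hP hQ => exact hP.add hQ
  | ite φ P Q hP hQ => exact ((φ.isPoly_cost.add hP).add hQ).add (.const 2)
  | rep P ih => exact hrange ih

end DFVS

namespace DFVS

/-! ### Vertex-disjoint paths and separators -/

/-! ### Distance levels in the residual network -/

section Levels
variable {V : Type*}

/-- `lev H snk used arc d b x`: the exit side (for `b = true`) or the entry side (for `b = false`)
of the vertex `x` is at distance at most `d` from the target in the residual network. -/
def lev (H : V → V → Prop) (snk used : V → Prop) (arc : V → V → Prop) :
    ℕ → Bool → V → Prop
  | 0, b, x => b = true ∧ snk x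
  | d + 1, false, x => lev H snk used arc d false x ∨ (¬ used x ∧ lev H snk used arc d true x) ∨
      ∃ z, arc z x ∧ lev H snk used arc d true z
  | d + 1, true, x => lev H snk used arc d true x ∨ (∃ y, H x y ∧ lev H snk used arc d false y) ∨
      (used x ∧ lev H snk used arc d false x)

variable {H : V → V → Prop} {snk used : V → Prop} {arc : V → V → Prop}

theorem lev_succ {d : ℕ} {b : Bool} {x : V} (h : lev H snk used arc d b x) :
    lev H snk used arc (d + 1) b x := by
  cases b <;> exact Or.inl h

theorem lev_mono {d d' : ℕ} (hd : d ≤ d') {b : Bool} {x : V} (h : lev H snk used arc d b x) :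
    lev H snk used arc d' b x := by
  induction d', hd using Nat.le_induction with
  | base => exact h
  | succ d' _ ih => exact lev_succ ih

/-- Each level is obtained from the previous one by the same monotone rule, so once a round adds
nothing, no later round does. -/
theorem lev_stable {d : ℕ} (h : ∀ b x, lev H snk used arc (d + 1) b x → lev H snk used arc d b x)
    (d' : ℕ) (b : Bool) (x : V) (h' : lev H snk used arc d' b x) : lev H snk used arc d b x := by
  induction d' generalizing b x with
  | zero => exact lev_mono (Nat.zero_le d) h'
  | succ d' ih =>
    apply h
    cases b
    · rcases h' with h' | ⟨h1, h2⟩ | ⟨z, h1, h2⟩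
      · exact lev_succ (ih _ _ h')
      · exact Or.inr (Or.inl ⟨h1, ih _ _ h2⟩)
      · exact Or.inr (Or.inr ⟨z, h1, ih _ _ h2⟩)
    · rcases h' with h' | ⟨y, h1, h2⟩ | ⟨h1, h2⟩
      · exact lev_succ (ih _ _ h')
      · exact Or.inr (Or.inl ⟨y, h1, ih _ _ h2⟩)
      · exact Or.inr (Or.inr ⟨h1, ih _ _ h2⟩)

end Levels

/-! ### Counting, and moving a token through a family of disjoint paths -/

section Flow
variable {V : Type*} [Fintype V]

theorem ind_split (p q : Prop) : ind p = ind (p ∧ q) + ind (p ∧ ¬ q) := by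
  by_cases hp : p <;> by_cases hq : q <;> simp [ind, hp, hq]

/-- The number of elements that satisfy a predicate. -/
noncomputable def count (p : V → Prop) : ℕ := ∑ x, ind (p x)

theorem count_mono {p q : V → Prop} (h : ∀ x, p x → q x) : count p ≤ count q := by
  refine Finset.sum_le_sum fun x _ => ?_
  by_cases hp : p x
  · rw [ind_pos hp, ind_pos (h x hp)]
  · simp [ind_neg hp]

theorem count_congr {p q : V → Prop} (h : ∀ x, p x ↔ q x) : count p = count q :=
  congrArg count (funext fun x => propext (h x))

theorem count_split (p q : V → Prop) :
    count p = count (fun x => p x ∧ q x) + count (fun x => p x ∧ ¬ q x) := by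
  simp only [count, ← Finset.sum_add_distrib]
  exact Finset.sum_congr rfl fun x _ => ind_split _ _

theorem count_eq_zero {p : V → Prop} : count p = 0 ↔ ∀ x, ¬ p x := by
  simp [count]

theorem count_pos {p : V → Prop} : 0 < count p ↔ ∃ x, p x := by
  rw [Nat.pos_iff_ne_zero, Ne, count_eq_zero]
  push Not
  rfl

theorem count_eq (x : V) : count (fun y => y = x) = 1 := by
  rw [count, Finset.sum_eq_single x (fun y _ hy => ind_neg hy) (by simp), ind_pos rfl]

theorem count_add_one {p : V → Prop} {x : V} (h : ¬ p x) :
    count (fun y => p y ∨ y = x) = count p + 1 := by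
  classical
  rw [count_split _ (fun y => y = x), add_comm]
  congr 1
  · refine count_congr fun y => ⟨fun h' => h'.1.resolve_right h'.2, fun h' => ⟨Or.inl h', ?_⟩⟩
    rintro rfl
    exact h h'
  · rw [← count_eq x]
    exact count_congr fun y => by tauto

theorem count_sub_one {p : V → Prop} {x : V} (h : p x) :
    count (fun y => p y ∧ y ≠ x) + 1 = count p := by
  classical
  rw [← count_add_one (p := fun y => p y ∧ y ≠ x) (x := x) (by simp)]
  refine count_congr fun y => ?_
  by_cases hy : y = x
  · simp [hy, h]
  · simp [hy]

theorem count_eq_card (p : V → Prop) [DecidablePred p] :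
    count p = (Finset.univ.filter p).card := by
  rw [Finset.card_filter]
  refine Finset.sum_congr rfl fun x _ => ?_
  by_cases h : p x <;> simp [ind, h]

/-- A family of vertex-disjoint paths from `src` to `snk` (and perhaps some cycles): `used` is the
set of its vertices, `arc` the set of its edges, `st` and `en` are the sets of the first and of the
last vertices. In addition one path may be incomplete: a token on the entry side of the vertex of
`tin` or on the exit side of the vertex of `tout` stands for the missing part. -/
structure IsFlow (H : V → V → Prop) (src snk used : V → Prop) (arc : V → V → Prop)
    (st en tin tout : V → Prop) : Prop where
  arc_sub : ∀ x y, arc x y → H x y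
  st_sub : ∀ x, st x → src x
  en_sub : ∀ x, en x → snk x
  in_eq : ∀ x, count (fun z => arc z x) + ind (st x) = ind (used x) + ind (tin x)
  out_eq : ∀ x, count (fun y => arc x y) + ind (en x) + ind (tout x) = ind (used x)

variable {H : V → V → Prop} {src snk used : V → Prop} {arc : V → V → Prop} {st en : V → Prop}

/-- The levels are stable from `2 * count J` on if they only contain vertices of `J`. -/
theorem lev_of_lev {J : V → Prop} (hJ : ∀ d b x, lev H snk used arc d b x → J x) {N : ℕ}
    (hN : 2 * count J ≤ N) {d : ℕ} {b : Bool} {x : V} (h : lev H snk used arc d b x) :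
    lev H snk used arc N b x := by
  set c : ℕ → ℕ := fun d => count (fun x => lev H snk used arc d false x) +
    count (fun x => lev H snk used arc d true x) with hc
  have hmono : ∀ d b, count (fun x => lev H snk used arc d b x) ≤
      count (fun x => lev H snk used arc (d + 1) b x) := fun d b => count_mono fun x => lev_succ
  have key : ∀ d, (∀ b x, lev H snk used arc (d + 1) b x → lev H snk used arc d b x) ∨
      c d < c (d + 1) := by
    intro d
    by_contra! hcon
    obtain ⟨⟨b, x, h1, h2⟩, h3⟩ := hcon
    have hlt : count (fun x => lev H snk used arc d b x) <
        count (fun x => lev H snk used arc (d + 1) b x) := by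
      rw [Nat.lt_iff_add_one_le, ← count_add_one h2]
      refine count_mono fun y hy => ?_
      rcases hy with hy | rfl
      · exact lev_succ hy
      · exact h1
    have h4 := hmono d false
    have h5 := hmono d true
    cases b <;> simp only [hc] at h3 <;> omega
  -- Otherwise the total size `c` of the two sides grows in each of the first `N + 1` rounds and
  -- exceeds `2 * count J`.
  obtain ⟨e, he, hst⟩ : ∃ e ≤ N, ∀ b x, lev H snk used arc (e + 1) b x →
      lev H snk used arc e b x := by
    by_contra! hcon
    have hgrow : ∀ e ≤ N + 1, e ≤ c e := by
      intro e he
      induction e with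
      | zero => omega
      | succ e ih =>
        have := ih (by omega)
        rcases key e with h | h
        · obtain ⟨b, x, h1, h2⟩ := hcon e (by omega)
          exact absurd (h b x h1) h2
        · omega
    have h1 := hgrow (N + 1) le_rfl
    have h2 : c (N + 1) ≤ count J + count J :=
      add_le_add (count_mono fun x => hJ _ _ x) (count_mono fun x => hJ _ _ x)
    omega
  exact lev_mono he (lev_stable hst d b x h)

/-- The graph is unchanged below a level. -/
def SameUpTo (H : V → V → Prop) (snk used₀ : V → Prop) (arc₀ : V → V → Prop) (used : V → Prop)
    (arc : V → V → Prop) (d : ℕ) : Prop :=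
  (∀ x, lev H snk used₀ arc₀ d false x → lev H snk used₀ arc₀ d true x → (used x ↔ used₀ x)) ∧
  ∀ z x, lev H snk used₀ arc₀ d false x → lev H snk used₀ arc₀ d true z → (arc z x ↔ arc₀ z x)

/-- If a path already began at `x`, the balance would make `x` used and without incoming arcs. Then
the entry side of `x` would have no residual move at all, hence no level. -/
theorem IsFlow.start (h : IsFlow H src snk used arc st en (fun _ => False) (fun _ => False))
    {x : V} (hx : src x) {d : ℕ} (hd : lev H snk used arc d false x) :
    ¬ st x ∧ IsFlow H src snk used arc (fun v => st v ∨ v = x) en (fun v => v = x)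
      (fun _ => False) := by
  have hst : ¬ st x := by
    intro hst
    have h1 := h.in_eq x
    rw [ind_pos hst, ind_neg not_false] at h1
    have hu := ind_le_one (used x)
    have hz : count (fun z => arc z x) = 0 := by omega
    have hux : used x := by
      by_contra hu
      rw [ind_neg hu] at h1
      omega
    rw [count_eq_zero] at hz
    induction d with
    | zero => simp [lev] at hd
    | succ d ih =>
      rcases hd with hd | ⟨h2, -⟩ | ⟨z, h2, -⟩
      · exact ih hd
      · exact h2 hux
      · exact hz z h2
  refine ⟨hst, h.arc_sub, ?_, h.en_sub, fun v => ?_, h.out_eq⟩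
  · rintro v (hv | rfl)
    · exact h.st_sub v hv
    · exact hx
  · have h1 := h.in_eq v
    by_cases hv : v = x
    · subst hv
      rw [ind_neg hst, ind_neg not_false] at h1
      rw [ind_pos (Or.inr rfl), ind_pos rfl]
      omega
    · simpa [hv] using h1

/-- This and the next four lemmas are the residual moves: through an unused vertex, back through a
used vertex, backwards along an arc, forwards along an edge, and off at a target. Each disturbs the
two balance equations only where the token leaves or arrives. -/
theorem IsFlow.enter {x : V}
    (h : IsFlow H src snk used arc st en (fun v => v = x) (fun _ => False)) (hx : ¬ used x) :
    IsFlow H src snk (fun v => used v ∨ v = x) arc st en (fun _ => False) (fun v => v = x) := by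
  refine ⟨h.arc_sub, h.st_sub, h.en_sub, fun v => ?_, fun v => ?_⟩
  · have h1 := h.in_eq v
    by_cases hv : v = x
    · subst hv
      simpa [ind, hx] using h1
    · simpa [hv] using h1
  · have h1 := h.out_eq v
    by_cases hv : v = x
    · subst hv
      simp [ind, hx] at h1 ⊢
      omega
    · simpa [hv] using h1

theorem IsFlow.leave {x : V}
    (h : IsFlow H src snk used arc st en (fun _ => False) (fun v => v = x)) (hx : used x) :
    IsFlow H src snk (fun v => used v ∧ v ≠ x) arc st en (fun v => v = x) (fun _ => False) := by
  refine ⟨h.arc_sub, h.st_sub, h.en_sub, fun v => ?_, fun v => ?_⟩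
  · have h1 := h.in_eq v
    by_cases hv : v = x
    · subst hv
      simpa [ind, hx] using h1
    · simpa [hv] using h1
  · have h1 := h.out_eq v
    by_cases hv : v = x
    · subst hv
      simp [ind, hx] at h1 ⊢
      omega
    · simpa [hv] using h1

theorem IsFlow.cancel {x z : V}
    (h : IsFlow H src snk used arc st en (fun v => v = x) (fun _ => False)) (hz : arc z x) :
    IsFlow H src snk used (fun v w => arc v w ∧ ¬ (v = z ∧ w = x)) st en (fun _ => False)
      (fun v => v = z) := by
  refine ⟨fun v w hvw => h.arc_sub v w hvw.1, h.st_sub, h.en_sub, fun v => ?_, fun v => ?_⟩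
  · have h1 := h.in_eq v
    by_cases hv : v = x
    · subst hv
      have h2 := count_sub_one (p := fun w => arc w v) hz
      simp [ind_pos, ind_neg] at h1 h2 ⊢
      omega
    · simpa [hv] using h1
  · have h1 := h.out_eq v
    by_cases hv : v = z
    · subst hv
      have h2 := count_sub_one (p := fun w => arc v w) hz
      simp [ind_pos, ind_neg] at h1 h2 ⊢
      omega
    · simpa [hv] using h1

theorem IsFlow.push {x y : V}
    (h : IsFlow H src snk used arc st en (fun _ => False) (fun v => v = x)) (hxy : H x y) :
    IsFlow H src snk used (fun v w => arc v w ∨ (v = x ∧ w = y)) st en (fun v => v = y)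
      (fun _ => False) := by
  -- The token on the exit side already accounts for the single unit of outflow of `x`, so `x` has
  -- no outgoing arc and the new one is really new.
  have hn : ¬ arc x y := by
    intro hn
    have h1 := h.out_eq x
    have h2 : 0 < count fun y => arc x y := count_pos.2 ⟨y, hn⟩
    rw [ind_pos (p := x = x) rfl] at h1
    have := ind_le_one (used x)
    omega
  refine ⟨?_, h.st_sub, h.en_sub, fun v => ?_, fun v => ?_⟩
  · rintro v w (hvw | ⟨rfl, rfl⟩)
    · exact h.arc_sub v w hvw
    · exact hxy
  · have h1 := h.in_eq v
    by_cases hv : v = y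
    · subst hv
      have h2 := count_add_one (p := fun w => arc w v) hn
      simp [ind_pos, ind_neg] at h1 h2 ⊢
      omega
    · simpa [hv] using h1
  · have h1 := h.out_eq v
    by_cases hv : v = x
    · subst hv
      have h2 := count_add_one (p := fun w => arc v w) hn
      simp [ind_pos, ind_neg] at h1 h2 ⊢
      omega
    · simpa [hv] using h1

theorem IsFlow.finish {x : V}
    (h : IsFlow H src snk used arc st en (fun _ => False) (fun v => v = x)) (hx : snk x) :
    IsFlow H src snk used arc st (fun v => en v ∨ v = x) (fun _ => False) (fun _ => False) := by
  have hn : ¬ en x := by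
    intro hn
    have h1 := h.out_eq x
    rw [ind_pos (p := x = x) rfl, ind_pos hn] at h1
    have := ind_le_one (used x)
    omega
  refine ⟨h.arc_sub, h.st_sub, ?_, h.in_eq, fun v => ?_⟩
  · rintro v (hv | rfl)
    · exact h.en_sub v hv
    · exact hx
  · have h1 := h.out_eq v
    by_cases hv : v = x
    · subst hv
      simp [ind_pos, ind_neg hn, ind_neg not_false] at h1 ⊢
      omega
    · simpa [hv] using h1

end Flow

/-! ### Separators -/

section Cut
variable {V : Type*} [Fintype V]

/-- The boundary of `U` and the vertex `s`: the vertices outside of `U` to which there is an edge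
from `s` or from `U`. -/
def bd (E : V → V → Prop) (s : V) (U : V → Prop) (y : V) : Prop :=
  ¬ U y ∧ (E s y ∨ ∃ x, U x ∧ E x y)

/-- Neither `U` nor its boundary meet `T`. -/
def Valid (E : V → V → Prop) (s : V) (T U : V → Prop) : Prop :=
  ∀ y, T y → ¬ U y ∧ ¬ bd E s U y

variable {E : V → V → Prop} {s : V} {T A : V → Prop}

/-- The edges between the vertices outside of `A` and `T`. -/
def innerEdge (E : V → V → Prop) (T A : V → Prop) (x y : V) : Prop :=
  E x y ∧ (¬ T x ∧ ¬ A x) ∧ (¬ T y ∧ ¬ A y)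

/-- The first vertices of the paths from `s` or `A` to `T`. -/
def source (E : V → V → Prop) (s : V) (T A : V → Prop) (y : V) : Prop :=
  (¬ T y ∧ ¬ A y) ∧ (E s y ∨ ∃ x, A x ∧ E x y)

/-- The last vertices of the paths from `s` or `A` to `T`. -/
def target (E : V → V → Prop) (T A : V → Prop) (x : V) : Prop :=
  (¬ T x ∧ ¬ A x) ∧ ∃ t, T t ∧ E x t

variable {used : V → Prop} {arc : V → V → Prop} {st en : V → Prop}

/-- Weak duality with its defect made explicit. Sum the balance at entry sides over `U` and its
boundary, and at exit sides over `U`. All paths start there because `A` lies in `U`; none ends in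
`U` because the boundary avoids `T`. What an edge out of `U` contributes on one side it contributes
on the other, and only arcs from outside `U` and unused boundary vertices are left over. -/
theorem IsFlow.count_bd (h : IsFlow (innerEdge E T A) (source E s T A) (target E T A) used arc st en
    (fun _ => False) (fun _ => False)) {U : V → Prop} (hU : Valid E s T U)
    (hA : ∀ x, A x → U x) :
    count (bd E s U) = count st + ∑ z, ∑ y, ind (arc z y ∧ ¬ U z ∧ (U y ∨ bd E s U y)) +
      count (fun y => bd E s U y ∧ ¬ used y) := by
  have hin : ∀ (p : V → Prop), ∑ z, ∑ y, ind (arc z y ∧ p y) + count (fun y => st y ∧ p y) =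
      count (fun y => used y ∧ p y) := by
    intro p
    rw [Finset.sum_comm, count, count, ← Finset.sum_add_distrib]
    refine Finset.sum_congr rfl fun y _ => ?_
    have := h.in_eq y
    by_cases hp : p y
    · simpa [hp, ind_neg, count] using this
    · simp [hp, ind]
  have hout : ∑ z, ∑ y, ind (arc z y ∧ U z) = count (fun y => used y ∧ U y) := by
    refine Finset.sum_congr rfl fun z _ => ?_
    have := h.out_eq z
    by_cases hp : U z
    · have hen : ¬ en z := by
        intro hen
        obtain ⟨-, t, ht, hzt⟩ := h.en_sub z hen
        exact (hU t ht).2 ⟨(hU t ht).1, Or.inr ⟨z, hp, hzt⟩⟩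
      simpa [hp, hen, ind_neg, count] using this
    · simp [hp, ind]
  have h1 := hin U
  have h2 := hin (bd E s U)
  have h3 : count st = count (fun y => st y ∧ U y) + count (fun y => st y ∧ bd E s U y) := by
    rw [count_split st U]
    congr 1
    refine count_congr fun y => and_congr_right fun hy => ⟨fun hn => ⟨hn, ?_⟩, fun hb => hb.1⟩
    rcases (h.st_sub y hy).2 with hs | ⟨x, hx, hxy⟩
    · exact Or.inl hs
    · exact Or.inr ⟨x, hA x hx, hxy⟩
  have h4 : count (bd E s U) = count (fun y => used y ∧ bd E s U y) +
      count (fun y => bd E s U y ∧ ¬ used y) := by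
    rw [count_split (bd E s U) used]
    congr 1
    exact count_congr fun y => and_comm
  have h5 : ∑ z, ∑ y, ind (arc z y ∧ U z) + ∑ z, ∑ y, ind (arc z y ∧ ¬ U z ∧ (U y ∨ bd E s U y)) =
      ∑ z, ∑ y, ind (arc z y ∧ U y) + ∑ z, ∑ y, ind (arc z y ∧ bd E s U y) := by
    simp only [← Finset.sum_add_distrib]
    refine Finset.sum_congr rfl fun z _ => Finset.sum_congr rfl fun y _ => ?_
    by_cases hzy : arc z y
    · by_cases hz : U z <;> by_cases hy : U y
      · simp [hzy, hz, hy, ind, bd]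
      · have : bd E s U y := ⟨hy, Or.inr ⟨z, hz, (h.arc_sub z y hzy).1⟩⟩
        simp [hzy, hz, hy, ind, this]
      · simp [hzy, hz, hy, ind, bd]
      · simp [hzy, hz, hy, ind_neg]
    · simp [hzy, ind]
  omega

/-- A maximal family of disjoint paths from `A` to `T` yields the minimum separator that is
farthest from `A`. -/
theorem IsFlow.separator (h : IsFlow (innerEdge E T A) (source E s T A) (target E T A) used arc st
    en (fun _ => False) (fun _ => False))
    (hmax : ∀ x, source E s T A x → ∀ d, ¬ lev (innerEdge E T A) (target E T A) used arc d false x)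
    {U₀ : V → Prop} (hU₀ : Valid E s T U₀) (hA₀ : ∀ x, A x → U₀ x) {R : V → Prop}
    (hR : ∀ x, R x ↔ A x ∨ (¬ T x ∧
      ∀ d, ¬ lev (innerEdge E T A) (target E T A) used arc d true x)) :
    Valid E s T R ∧ ∀ U, Valid E s T U → (∀ x, A x → U x) →
      count (bd E s R) ≤ count (bd E s U) ∧
      ∀ v, bd E s R v → U v → count (bd E s R) < count (bd E s U) := by
  set L := lev (innerEdge E T A) (target E T A) used arc with hL
  have hAT : ∀ x, A x → ¬ T x := fun x hx ht => (hU₀ x ht).1 (hA₀ x hx)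
  have hJ : ∀ d b x, L d b x → ¬ T x ∧ ¬ A x := by
    intro d
    induction d with
    | zero => rintro b x ⟨-, hx⟩; exact hx.1
    | succ d ih =>
      rintro (_ | _) x hx
      · rcases hx with hx | ⟨-, hx⟩ | ⟨z, hx, -⟩
        · exact ih _ _ hx
        · exact ih _ _ hx
        · exact (h.arc_sub _ _ hx).2.2
      · rcases hx with hx | ⟨y, hx, -⟩ | ⟨-, hx⟩
        · exact ih _ _ hx
        · exact hx.2.1
        · exact ih _ _ hx
  have hRout : ∀ x, R x → ∀ d, ¬ L d true x := by
    intro x hx d hd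
    rcases (hR x).1 hx with hx | hx
    · exact (hJ d _ x hd).2 hx
    · exact hx.2 d hd
  have hRT : ∀ x, R x → ¬ T x := by
    intro x hx
    rcases (hR x).1 hx with hx | hx
    · exact hAT x hx
    · exact hx.1
  have hRE : ∀ x y, R x → E x y → ¬ T y := by
    intro x y hx hxy ht
    by_cases hxA : A x
    · exact (hU₀ y ht).2 ⟨(hU₀ y ht).1, Or.inr ⟨x, hA₀ x hxA, hxy⟩⟩
    · exact hRout x hx 0 ⟨rfl, ⟨hRT x hx, hxA⟩, y, ht, hxy⟩
  have hsE : ∀ y, E s y → ¬ T y := fun y hy ht => (hU₀ y ht).2 ⟨(hU₀ y ht).1, Or.inl hy⟩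
  have hRv : Valid E s T R := by
    refine fun y hy => ⟨fun hRy => hRT y hRy hy, ?_⟩
    rintro ⟨-, hs | ⟨x, hx, hxy⟩⟩
    · exact hsE y hs hy
    · exact hRE x y hx hxy hy
  -- On the boundary the exit side has a level and the entry side has none: the cut runs through
  -- these vertices.
  have hbd : ∀ y, bd E s R y → (∃ d, L d true y) ∧ ∀ d, ¬ L d false y := by
    intro y hy
    have hyT : ¬ T y := fun hT => (hRv y hT).2 hy
    have hyA : ¬ A y := fun hA => hy.1 ((hR y).2 (Or.inl hA))
    constructor
    · by_contra! hcon
      exact hy.1 ((hR y).2 (Or.inr ⟨hyT, hcon⟩))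
    · intro d hd
      rcases hy.2 with hs | ⟨x, hx, hxy⟩
      · exact hmax y ⟨⟨hyT, hyA⟩, Or.inl hs⟩ d hd
      · by_cases hxA : A x
        · exact hmax y ⟨⟨hyT, hyA⟩, Or.inr ⟨x, hxA, hxy⟩⟩ d hd
        · exact hRout x hx (d + 1) (Or.inr (Or.inl ⟨y, ⟨hxy, ⟨hRT x hx, hxA⟩, hyT, hyA⟩, hd⟩))
  have hRA : ∀ x, A x → R x := fun x hx => (hR x).2 (Or.inl hx)
  -- Both defect terms vanish for `R`, since an offending arc or an unused boundary vertex would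
  -- give a level to an entry or exit side that has none.
  have hcount : count (bd E s R) = count st := by
    rw [h.count_bd hRv hRA]
    have h1 : ∑ z, ∑ y, ind (arc z y ∧ ¬ R z ∧ (R y ∨ bd E s R y)) = 0 := by
      refine Finset.sum_eq_zero fun z _ => Finset.sum_eq_zero fun y _ => ?_
      rw [ind_eq_zero]
      rintro ⟨hzy, hz, hy⟩
      obtain ⟨d, hd⟩ : ∃ d, L d true z := by
        by_contra! hcon
        exact hz ((hR z).2 (Or.inr ⟨(h.arc_sub z y hzy).2.1.1, hcon⟩))
      have hyin : L (d + 1) false y := Or.inr (Or.inr ⟨z, hzy, hd⟩)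
      rcases hy with hy | hy
      · have hu : used y := by
          by_contra hu
          have := h.in_eq y
          have h0 : 0 < count fun z => arc z y := count_pos.2 ⟨z, hzy⟩
          rw [ind_neg hu, ind_neg not_false] at this
          omega
        exact hRout y hy (d + 2) (Or.inr (Or.inr ⟨hu, hyin⟩))
      · exact (hbd y hy).2 _ hyin
    have h2 : count (fun y => bd E s R y ∧ ¬ used y) = 0 := by
      rw [count_eq_zero]
      rintro y ⟨hy, hu⟩
      obtain ⟨⟨d, hd⟩, hn⟩ := hbd y hy
      exact hn (d + 1) (Or.inr (Or.inl ⟨hu, hd⟩))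
    omega
  refine ⟨hRv, fun U hU hAU => ?_⟩
  have hcU := h.count_bd hU hAU
  refine ⟨by omega, fun v hv hvU => ?_⟩
  by_contra hlt
  have h1 : ∑ z, ∑ y, ind (arc z y ∧ ¬ U z ∧ (U y ∨ bd E s U y)) = 0 := by omega
  have h2 : count (fun y => bd E s U y ∧ ¬ used y) = 0 := by omega
  rw [count_eq_zero] at h2
  have h1' : ∀ z y, arc z y → (U y ∨ bd E s U y) → U z := by
    intro z y hzy hy
    by_contra hz
    rw [Finset.sum_eq_zero_iff] at h1
    have := h1 z (Finset.mem_univ z)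
    rw [Finset.sum_eq_zero_iff] at this
    have := this y (Finset.mem_univ y)
    rw [ind_eq_zero] at this
    exact this ⟨hzy, hz, hy⟩
  -- Complementary slackness: with both defects of `U` zero, no residual move leads from an exit
  -- side in `U`, or from an entry side in `U` or its boundary, to a place outside of these.
  -- Therefore none of them has a level, whereas `v`, being on the boundary of `R`, does have one on
  -- its exit side.
  have hclosed : ∀ d x, (U x → ¬ L d true x) ∧ (U x ∨ bd E s U x → ¬ L d false x) := by
    intro d
    induction d with
    | zero =>
      refine fun x => ⟨fun hx hd => ?_, fun _ hd => absurd hd.1 (by simp)⟩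
      obtain ⟨-, -, t, ht, hxt⟩ := hd
      exact (hU t ht).2 ⟨(hU t ht).1, Or.inr ⟨x, hx, hxt⟩⟩
    | succ d ih =>
      refine fun x => ⟨fun hx hd => ?_, fun hx hd => ?_⟩
      · rcases hd with hd | ⟨y, hxy, hd⟩ | ⟨-, hd⟩
        · exact (ih x).1 hx hd
        · refine (ih y).2 ?_ hd
          by_cases hy : U y
          · exact Or.inl hy
          · exact Or.inr ⟨hy, Or.inr ⟨x, hx, hxy.1⟩⟩
        · exact (ih x).2 (Or.inl hx) hd
      · rcases hd with hd | ⟨hu, hd⟩ | ⟨z, hzx, hd⟩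
        · exact (ih x).2 hx hd
        · rcases hx with hx | hx
          · exact (ih x).1 hx hd
          · exact h2 x ⟨hx, hu⟩
        · exact (ih z).1 (h1' z x hzx hx) hd
  obtain ⟨d, hd⟩ := (hbd v hv).1
  exact (hclosed d v).1 hvU hd

end Cut

end DFVS

namespace DFVS
open DFVS.Var DFVS.Rel

/-! ### Computing vertex-disjoint paths -/

variable {m : ℕ}

/-- The unary relation on the diagonal of a binary relation. -/
def Conf.set (σ : Conf m) (r : Rel) (a : Fin m) : Prop := σ.rel r a a

@[simp] theorem Conf.setVar_set (σ : Conf m) (v : Var) (a : Fin m) : (σ.setVar v a).set = σ.set :=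
  rfl

@[simp] theorem Conf.setRel_set (σ : Conf m) (r : Rel) (D : Fin m → Fin m → Prop) (q : Rel) :
    (σ.setRel r D).set q = if q = r then fun a => D a a else σ.set q := by
  ext a
  by_cases h : q = r <;> simp [Conf.set, h]

/-- `v` is the predecessor of `w`. -/
def Fm.isPred (v w : Var) : Fm := .and (.lt v w) (.neg (.ex .u (.and (.lt v .u) (.lt .u w))))

/-- Falsity. -/
def Fm.bot : Fm := .lt .x .x

@[simp] theorem Fm.sat_bot (σ : Conf m) : ¬ Fm.bot.Sat σ := by simp [Fm.bot]

theorem fin_isPred {a b : Fin m} : (a < b ∧ ∀ c, a < c → b ≤ c) ↔ a.val + 1 = b.val := by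
  constructor
  · rintro ⟨h1, h2⟩
    have h3 : a.val < b.val := h1
    by_contra hne
    have := b.2
    have h4 := h2 ⟨a.val + 1, by omega⟩ (Nat.lt_succ_self _)
    have h5 : b.val ≤ a.val + 1 := h4
    omega
  · intro h
    refine ⟨Fin.lt_def.2 (by omega), fun c hc => ?_⟩
    have := Fin.lt_def.1 hc
    exact Fin.le_def.2 (by omega)

theorem Fm.sat_isPred {v w : Var} (hv : v ≠ .u) (hw : w ≠ .u) (σ : Conf m) :
    (Fm.isPred v w).Sat σ ↔ (σ.env v).val + 1 = (σ.env w).val := by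
  simp [Fm.isPred, hv, hw, ← fin_isPred]

/-- Shift the levels of the exit sides. -/
def levelOut : Cmd :=
  .assign lout <| .or (.and (.eq y zero) (.rel term x x)) <| .ex z <| .and (.isPred z y) <|
    .or (.rel lout x z) <| .or (.ex u <| .and (.rel inner x u) (.rel lin u z)) <|
    .and (.rel used x x) (.rel lin x z)

/-- Shift the levels of the entry sides. -/
def levelIn : Cmd :=
  .assign lin <| .ex z <| .and (.isPred z y) <|
    .or (.rel lin x z) <| .or (.and (.neg (.rel used x x)) (.rel lout x z)) <|
    .ex u <| .and (.rel arc u x) (.rel lout u z)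

/-- Compute the levels of the residual network. -/
def levels : Cmd := .rep (.seq levelOut levelIn)

/-- The levels of the residual network of a configuration. -/
def Conf.lev (σ : Conf m) : ℕ → Bool → Fin m → Prop :=
  DFVS.lev (σ.rel inner) (σ.set term) (σ.set used) (σ.rel arc)

theorem exists_isPred {d : Fin m} {e : ℕ} (he : d.val = e + 1) (p : Fin m → Prop) :
    (∃ c : Fin m, c.val + 1 = d.val ∧ p c) ↔ p ⟨e, by omega⟩ := by
  refine ⟨fun ⟨c, hc, hp⟩ => ?_, fun hp => ⟨_, by simp [he], hp⟩⟩
  have : c = ⟨e, by omega⟩ := Fin.ext (by simp; omega)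
  rwa [← this]

/-- Round `t` makes the columns up to `t` correct. Column `d` depends only on column `d - 1`, so it
does not matter that `levelIn` already sees the shifted `lout`. -/
theorem eval_levels [NeZero m] {σ : Conf m} (h0 : σ.env zero = 0) (a d : Fin m) :
    ((levels.eval σ).rel lout a d ↔ σ.lev d true a) ∧
    ((levels.eval σ).rel lin a d ↔ σ.lev d false a) := by
  have key := iterate_induction (F := (Cmd.seq levelOut levelIn).eval) (a := σ)
    (I := fun t τ => (τ.rel inner = σ.rel inner ∧ τ.rel term = σ.rel term ∧
      τ.rel used = σ.rel used ∧ τ.rel arc = σ.rel arc ∧ τ.env zero = 0) ∧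
      ∀ a d : Fin m, d.val < t → (τ.rel lout a d ↔ σ.lev d true a) ∧
        (τ.rel lin a d ↔ σ.lev d false a)) ⟨⟨rfl, rfl, rfl, rfl, h0⟩, by simp⟩ ?_ m
  · exact key.2 a d d.2
  rintro t τ ⟨⟨h1, h2, h3, h4, h5⟩, ih⟩
  have ih1 : ∀ a d : Fin m, d.val < t → (τ.rel lout a d ↔ σ.lev d true a) :=
    fun a d hd => (ih a d hd).1
  have ih2 : ∀ a d : Fin m, d.val < t → (τ.rel lin a d ↔ σ.lev d false a) :=
    fun a d hd => (ih a d hd).2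
  have hout : ∀ a d : Fin m, d.val < t + 1 →
      ((levelOut.eval τ).rel lout a d ↔ σ.lev d true a) := by
    intro a d hd
    simp only [levelOut, Cmd.eval, Conf.setRel_rel, reduceCtorEq, if_true, if_false,
      Fm.sat_or, Fm.sat_and, Fm.sat_eq, Fm.sat_rel, Fm.sat_ex, Conf.setVar_env, Conf.setVar_rel,
      Fm.sat_isPred, ne_eq, not_false_eq_true, h1, h2, h3, h5]
    rcases Nat.eq_zero_or_pos d.val with hz | hz
    · obtain rfl : d = 0 := Fin.ext hz
      simp [Conf.lev, lev, Conf.set]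
    · have hz' : d ≠ 0 := fun h => by simp [h] at hz
      obtain ⟨e, he⟩ : ∃ e, d.val = e + 1 := ⟨d.val - 1, by omega⟩
      simp only [hz', false_and, false_or, exists_isPred he]
      rw [he, ih1 _ _ (by simp; omega), ih2 _ _ (by simp; omega)]
      simp only [ih2 _ ⟨e, by omega⟩ (by simp; omega)]
      rfl
  have e1 : ∀ r, r ≠ lout → (levelOut.eval τ).rel r = τ.rel r := fun r hr =>
    Cmd.eval_rel (by simp [levelOut, Cmd.ModRel, hr]) τ
  refine ⟨by simp [levelOut, levelIn, Cmd.eval, h1, h2, h3, h4, h5], fun a d hd => ?_⟩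
  rw [Cmd.eval]
  refine ⟨?_, ?_⟩
  · rw [Cmd.eval_rel (by simp [levelIn, Cmd.ModRel])]
    exact hout a d hd
  · simp only [levelIn, Cmd.eval, Conf.setRel_rel, reduceCtorEq, if_true,
      Fm.sat_or, Fm.sat_and, Fm.sat_neg, Fm.sat_rel, Fm.sat_ex, Conf.setVar_env, Conf.setVar_rel,
      Fm.sat_isPred, ne_eq, not_false_eq_true, if_false]
    rw [e1 lin (by simp), e1 used (by simp), e1 arc (by simp), h3, h4]
    rcases Nat.eq_zero_or_pos d.val with hz | hz
    · simp [Conf.lev, lev, hz]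
    · obtain ⟨e, he⟩ : ∃ e, d.val = e + 1 := ⟨d.val - 1, by omega⟩
      simp only [exists_isPred he]
      simp only [hout _ ⟨e, by omega⟩ (by simp; omega), ih2 _ ⟨e, by omega⟩ (by simp; omega)]
      rw [he]
      rfl

/-! ### Augmenting -/

/-- The token, on the exit side of a last vertex, completes its path. -/
def walkEnd : Cmd :=
  .seq (.assign last <| .or (.rel last x x) (.eq x tok)) (.pick walking (.eq walking zero))

/-- Move the token from an entry side one level down. -/
def walkIn : Cmd :=
  .seq
    (.ite (.and (.neg (.rel used tok tok)) (.rel lout tok lvl'))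
      (.assign used <| .or (.rel used x x) (.eq x tok)) <|
      .seq (.pick vert <| .and (.rel arc vert tok) (.rel lout vert lvl')) <|
      .seq (.assign arc <| .and (.rel arc x y) (.neg (.and (.eq x vert) (.eq y tok)))) <|
      .pick tok (.eq tok vert)) <|
    .pick side (.eq side one)

/-- Move the token from an exit side one level down. -/
def walkOut : Cmd :=
  .seq
    (.ite (.and (.rel used tok tok) (.rel lin tok lvl'))
      (.assign used <| .and (.rel used x x) (.neg (.eq x tok))) <|
      .seq (.pick vert <| .and (.rel inner tok vert) (.rel lin vert lvl')) <|
      .seq (.assign arc <| .or (.rel arc x y) (.and (.eq x tok) (.eq y vert))) <|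
      .pick tok (.eq tok vert)) <|
    .pick side (.eq side zero)

/-- Move the token one level down. -/
def walkStep : Cmd :=
  .ite (.eq walking zero) .skip <|
  .seq (.pick lvl <| .or (.and (.eq side zero) (.rel lin tok lvl))
    (.and (.neg (.eq side zero)) (.rel lout tok lvl))) <|
  .ite (.eq lvl zero) walkEnd <|
  .seq (.pick lvl' (.isPred lvl' lvl)) <| .ite (.eq side zero) walkIn walkOut

/-- The flow of a configuration. -/
def Conf.Flow (σ : Conf m) (tin tout : Fin m → Prop) : Prop :=
  IsFlow (σ.rel inner) (σ.set start) (σ.set term) (σ.set used) (σ.rel arc) (σ.set first)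
    (σ.set last) tin tout

/-- The level of the token. -/
noncomputable def Conf.tokenLevel [NeZero m] (σ : Conf m) : Fin m :=
  least fun d => σ.env side = 0 ∧ σ.rel lin (σ.env tok) d ∨
    σ.env side ≠ 0 ∧ σ.rel lout (σ.env tok) d

/-- The invariant of the walk of the token that starts in `σ₀`. -/
structure WalkInv [NeZero m] (σ₀ σ : Conf m) : Prop where
  inner_eq : σ.rel inner = σ₀.rel inner
  start_eq : σ.rel start = σ₀.rel start
  term_eq : σ.rel term = σ₀.rel term
  lin_eq : ∀ a d : Fin m, σ.rel lin a d ↔ σ₀.lev d false a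
  lout_eq : ∀ a d : Fin m, σ.rel lout a d ↔ σ₀.lev d true a
  zero_eq : σ.env zero = 0
  one_eq : σ.env one ≠ 0
  flow_eq : if σ.env walking = 0 then σ.Flow (fun _ => False) (fun _ => False) else
    ∃ e : Fin m, σ₀.lev e (decide (σ.env side ≠ 0)) (σ.env tok) ∧
      SameUpTo (σ₀.rel .inner) (σ₀.set .term) (σ₀.set used) (σ₀.rel arc) (σ.set used) (σ.rel arc) e ∧
      if σ.env side = 0 then σ.Flow (fun v => v = σ.env tok) (fun _ => False)
        else σ.Flow (fun _ => False) (fun v => v = σ.env tok)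

theorem least_isPred [NeZero m] {d : Fin m} {e : ℕ} (he : d.val = e + 1) :
    least (fun c : Fin m => c.val + 1 = d.val) = ⟨e, by omega⟩ :=
  least_eq (by simp [he]) fun b hb h => by
    have := Fin.lt_def.1 hb
    simp at this
    omega

/-- The state of the walk after a step to a lower level. -/
theorem WalkInv.of_step [NeZero m] {σ₀ σ τ : Conf m} (h : WalkInv σ₀ σ) {l d : Fin m}
    (hd : l.val = d.val + 1)
    (hrel : ∀ r, r ≠ used → r ≠ arc → τ.rel r = σ.rel r) (h0 : τ.env zero = σ.env zero)
    (h1 : τ.env one = σ.env one) (hw : τ.env walking ≠ 0)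
    (hlev : σ₀.lev d (decide (τ.env side ≠ 0)) (τ.env tok))
    (hsame : SameUpTo (σ₀.rel inner) (σ₀.set term) (σ₀.set used) (σ₀.rel arc) (τ.set used)
      (τ.rel arc) d)
    (hflow : if τ.env side = 0 then τ.Flow (fun v => v = τ.env tok) (fun _ => False)
        else τ.Flow (fun _ => False) (fun v => v = τ.env tok)) :
    WalkInv σ₀ τ ∧ τ.tokenLevel < l := by
  have hin : ∀ a d : Fin m, τ.rel lin a d ↔ σ₀.lev d false a := by
    rw [hrel _ (by simp) (by simp)]; exact h.lin_eq
  have hout : ∀ a d : Fin m, τ.rel lout a d ↔ σ₀.lev d true a := by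
    rw [hrel _ (by simp) (by simp)]; exact h.lout_eq
  refine ⟨⟨?_, ?_, ?_, hin, hout, by rw [h0, h.zero_eq], by rw [h1]; exact h.one_eq, ?_⟩, ?_⟩
  · rw [hrel _ (by simp) (by simp), h.inner_eq]
  · rw [hrel _ (by simp) (by simp), h.start_eq]
  · rw [hrel _ (by simp) (by simp), h.term_eq]
  · rw [if_neg hw]
    exact ⟨d, hlev, hsame, hflow⟩
  · refine lt_of_le_of_lt (b := d) (least_le ?_) (Fin.lt_def.2 (by omega))
    by_cases hs : τ.env side = 0
    · exact Or.inl ⟨hs, (hin _ _).2 (by simpa [hs] using hlev)⟩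
    · exact Or.inr ⟨hs, (hout _ _).2 (by simpa [hs] using hlev)⟩

/-- The token has level `d + 1` but not `d`, so the definition of `lev` supplies a residual move of
the initial flow to level `d`. By `SameUpTo` this move is still available, although the flow has
meanwhile been changed. -/
theorem walkIn_spec [NeZero m] {σ₀ σ : Conf m} (h : WalkInv σ₀ σ) (hw : σ.env walking ≠ 0)
    {l d : Fin m} (hd : l.val = d.val + 1) (hlvl : σ.env lvl' = d)
    (hflow : σ.Flow (fun v => v = σ.env tok) (fun _ => False))
    (hlev : σ₀.lev l false (σ.env tok)) (hn : ¬ σ₀.lev d false (σ.env tok))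
    (hsame : SameUpTo (σ₀.rel inner) (σ₀.set term) (σ₀.set used) (σ₀.rel arc) (σ.set used)
      (σ.rel arc) l) :
    WalkInv σ₀ (walkIn.eval σ) ∧ (walkIn.eval σ).tokenLevel < l := by
  have hone := h.one_eq
  have hsat : (Fm.and (.neg (.rel used tok tok)) (.rel lout tok lvl')).Sat σ ↔
      ¬ σ.set used (σ.env tok) ∧ σ₀.lev d true (σ.env tok) := by
    simp [hlvl, h.lout_eq, Conf.set]
  rw [walkIn, Cmd.eval_seq]
  by_cases hif : (Fm.and (.neg (.rel used tok tok)) (.rel lout tok lvl')).Sat σ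
  · rw [Cmd.eval_ite_pos hif]
    rw [hsat] at hif
    simp only [Cmd.eval]
    refine h.of_step hd (fun r h1 h2 => by simp [h1]) (by simp) (by simp) (by simpa) ?_ ?_ ?_
    · simpa [hone] using hif.2
    · refine ⟨fun v hv hv' => ?_, fun z v hv hz => ?_⟩
      · have := hsame.1 v (lev_mono (by omega) hv) (lev_mono (by omega) hv')
        -- The only vertex whose status changes is the one of the token, and it has no level `d`; so
        -- agreement below the new level persists.
        have hne : v ≠ σ.env tok := by rintro rfl; exact hn hv
        simp only [Conf.set] at this
        simp [Conf.set, hne, this]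
      · simpa using hsame.2 z v (lev_mono (by omega) hv) (lev_mono (by omega) hz)
    · have := IsFlow.enter hflow hif.1
      simp [hone, Conf.Flow]
      exact this
  · rw [Cmd.eval_ite_neg hif]
    rw [hsat] at hif
    have hex : ∃ a, σ.rel arc a (σ.env tok) ∧ σ₀.lev d true a := by
      rw [hd] at hlev
      rcases hlev with hlev | ⟨hu, hlev⟩ | ⟨z, hz, hlev⟩
      · exact absurd hlev hn
      · refine absurd ⟨?_, hlev⟩ hif
        rw [hsame.1 _ (by rw [hd]; exact Or.inr (Or.inl ⟨hu, hlev⟩)) (lev_mono (by omega) hlev)]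
        exact hu
      · refine ⟨z, ?_, hlev⟩
        rw [hsame.2 _ _ (by rw [hd]; exact Or.inr (Or.inr ⟨z, hz, hlev⟩)) (lev_mono (by omega) hlev)]
        exact hz
    have hspec := least_spec hex
    set a := least fun a => σ.rel arc a (σ.env tok) ∧ σ₀.lev d true a with ha
    have hev : σ.setVar vert (least fun a => (Fm.and (.rel arc vert tok) (.rel lout vert lvl')).Sat
        (σ.setVar vert a)) = σ.setVar vert a := by
      congr 2
      ext a
      simp [hlvl, h.lout_eq]
    simp only [Cmd.eval]
    rw [hev]
    refine h.of_step hd (fun r h1 h2 => by simp [h2]) (by simp) (by simp) (by simpa) ?_ ?_ ?_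
    · simpa [hone] using hspec.2
    · refine ⟨fun v hv hv' => ?_, fun z v hv hz => ?_⟩
      · simpa [Conf.set] using hsame.1 v (lev_mono (by omega) hv) (lev_mono (by omega) hv')
      · have := hsame.2 z v (lev_mono (by omega) hv) (lev_mono (by omega) hz)
        have hne : v ≠ σ.env tok := by rintro rfl; exact hn hv
        simp [this, hne]
    · have := IsFlow.cancel hflow hspec.1
      simp [hone, Conf.Flow, -not_and]
      exact this

theorem walkOut_spec [NeZero m] {σ₀ σ : Conf m} (h : WalkInv σ₀ σ) (hw : σ.env walking ≠ 0)
    {l d : Fin m} (hd : l.val = d.val + 1) (hlvl : σ.env lvl' = d)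
    (hflow : σ.Flow (fun _ => False) (fun v => v = σ.env tok))
    (hlev : σ₀.lev l true (σ.env tok)) (hn : ¬ σ₀.lev d true (σ.env tok))
    (hsame : SameUpTo (σ₀.rel inner) (σ₀.set term) (σ₀.set used) (σ₀.rel arc) (σ.set used)
      (σ.rel arc) l) :
    WalkInv σ₀ (walkOut.eval σ) ∧ (walkOut.eval σ).tokenLevel < l := by
  have hzero := h.zero_eq
  have hsat : (Fm.and (.rel used tok tok) (.rel lin tok lvl')).Sat σ ↔
      σ.set used (σ.env tok) ∧ σ₀.lev d false (σ.env tok) := by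
    simp [hlvl, h.lin_eq, Conf.set]
  rw [walkOut, Cmd.eval_seq]
  by_cases hif : (Fm.and (.rel used tok tok) (.rel lin tok lvl')).Sat σ
  · rw [Cmd.eval_ite_pos hif]
    rw [hsat] at hif
    simp only [Cmd.eval]
    refine h.of_step hd (fun r h1 h2 => by simp [h1]) (by simp) (by simp) (by simpa) ?_ ?_ ?_
    · simpa [hzero] using hif.2
    · refine ⟨fun v hv hv' => ?_, fun z v hv hz => ?_⟩
      · have := hsame.1 v (lev_mono (by omega) hv) (lev_mono (by omega) hv')
        have hne : v ≠ σ.env tok := by rintro rfl; exact hn hv'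
        simp only [Conf.set] at this
        simp [Conf.set, hne, this]
      · simpa using hsame.2 z v (lev_mono (by omega) hv) (lev_mono (by omega) hz)
    · have := IsFlow.leave hflow hif.1
      simp [hzero, Conf.Flow]
      exact this
  · rw [Cmd.eval_ite_neg hif]
    rw [hsat] at hif
    have hex : ∃ a, σ.rel inner (σ.env tok) a ∧ σ₀.lev d false a := by
      rw [hd] at hlev
      rcases hlev with hlev | ⟨z, hz, hlev⟩ | ⟨hu, hlev⟩
      · exact absurd hlev hn
      · refine ⟨z, ?_, hlev⟩
        rw [h.inner_eq]
        exact hz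
      · refine absurd ⟨?_, hlev⟩ hif
        rw [hsame.1 _ (lev_mono (by omega) hlev) (by rw [hd]; exact Or.inr (Or.inr ⟨hu, hlev⟩))]
        exact hu
    have hspec := least_spec hex
    set a := least fun a => σ.rel inner (σ.env tok) a ∧ σ₀.lev d false a with ha
    have hev : σ.setVar vert (least fun a => (Fm.and (.rel inner tok vert) (.rel lin vert lvl')).Sat
        (σ.setVar vert a)) = σ.setVar vert a := by
      congr 2
      ext a
      simp [hlvl, h.lin_eq]
    simp only [Cmd.eval]
    rw [hev]
    refine h.of_step hd (fun r h1 h2 => by simp [h2]) (by simp) (by simp) (by simpa) ?_ ?_ ?_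
    · simpa [hzero] using hspec.2
    · refine ⟨fun v hv hv' => ?_, fun z v hv hz => ?_⟩
      · simpa [Conf.set] using hsame.1 v (lev_mono (by omega) hv) (lev_mono (by omega) hv')
      · have := hsame.2 z v (lev_mono (by omega) hv) (lev_mono (by omega) hz)
        have hne : z ≠ σ.env tok := by rintro rfl; exact hn hz
        simp [this, hne]
    · have := IsFlow.push hflow hspec.1
      simp [hzero, Conf.Flow]
      exact this

/-- The move is made from the least level `l` of the token, not from the level `e` that the
invariant remembers, since minimality excludes the case of a move that stays at the same place. At
level zero the token is on the exit side of a target and the path is completed. -/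
theorem walkStep_spec [NeZero m] {σ₀ σ : Conf m} (h : WalkInv σ₀ σ) (hw : σ.env walking ≠ 0) :
    WalkInv σ₀ (walkStep.eval σ) ∧ ((walkStep.eval σ).env walking = 0 ∨
      (walkStep.eval σ).tokenLevel < σ.tokenLevel) := by
  have hf := h.flow_eq
  rw [if_neg hw] at hf
  obtain ⟨e, he, hsame, hflow⟩ := hf
  have hex : ∃ d, σ.env side = 0 ∧ σ.rel lin (σ.env tok) d ∨
      σ.env side ≠ 0 ∧ σ.rel lout (σ.env tok) d := by
    by_cases hs : σ.env side = 0
    · exact ⟨e, Or.inl ⟨hs, (h.lin_eq _ _).2 (by simpa [hs] using he)⟩⟩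
    · exact ⟨e, Or.inr ⟨hs, (h.lout_eq _ _).2 (by simpa [hs] using he)⟩⟩
  have hspec := least_spec hex
  change _ ∧ σ.rel .lin (σ.env tok) σ.tokenLevel ∨ _ ∧ σ.rel .lout (σ.env tok) σ.tokenLevel at hspec
  have hmin : ∀ d < σ.tokenLevel, ¬ (σ.env side = 0 ∧ σ.rel .lin (σ.env tok) d ∨
      σ.env side ≠ 0 ∧ σ.rel .lout (σ.env tok) d) := fun d hd h => absurd hd (not_lt.2 (least_le h))
  have hle : σ.tokenLevel ≤ e := by
    by_contra hlt
    refine hmin e (not_le.1 hlt) ?_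
    by_cases hs : σ.env side = 0
    · exact Or.inl ⟨hs, (h.lin_eq _ _).2 (by simpa [hs] using he)⟩
    · exact Or.inr ⟨hs, (h.lout_eq _ _).2 (by simpa [hs] using he)⟩
  set l := σ.tokenLevel with hl
  replace hsame : SameUpTo (σ₀.rel .inner) (σ₀.set .term) (σ₀.set used) (σ₀.rel arc) (σ.set used)
      (σ.rel arc) l :=
    ⟨fun x hx hx' => hsame.1 x (lev_mono hle hx) (lev_mono hle hx'),
      fun z x hx hz => hsame.2 z x (lev_mono hle hx) (lev_mono hle hz)⟩
  have hmin' : ∀ d < l, ¬ σ₀.lev d (decide (σ.env side ≠ 0)) (σ.env tok) := by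
    intro d hd hlev
    by_cases hs : σ.env side = 0
    · exact hmin d hd (Or.inl ⟨hs, (h.lin_eq _ _).2 (by simpa [hs] using hlev)⟩)
    · exact hmin d hd (Or.inr ⟨hs, (h.lout_eq _ _).2 (by simpa [hs] using hlev)⟩)
  have hlev : σ₀.lev l (decide (σ.env side ≠ 0)) (σ.env tok) := by
    rcases hspec with ⟨hs, hr⟩ | ⟨hs, hr⟩
    · simpa [hs] using (h.lin_eq _ _).1 hr
    · simpa [hs] using (h.lout_eq _ _).1 hr
  have hev : walkStep.eval σ = Cmd.eval (.ite (.eq lvl zero) walkEnd <|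
      .seq (.pick lvl' (.isPred lvl' lvl)) <| .ite (.eq side zero) walkIn walkOut)
      (σ.setVar lvl l) := by
    rw [walkStep, Cmd.eval, if_neg (by simpa [h.zero_eq] using hw), Cmd.eval, Cmd.eval]
    congr 2
    simp [hl, Conf.tokenLevel, h.zero_eq]
  rw [hev, Cmd.eval]
  split_ifs with hif
  · simp only [Fm.sat_eq, Conf.setVar_env, reduceCtorEq, if_true, if_false, h.zero_eq] at hif
    rw [hif] at hlev
    have hs : σ.env side ≠ 0 := by simpa using hlev.1
    rw [if_neg hs] at hflow
    have h0 := h.zero_eq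
    have hend := IsFlow.finish hflow (x := σ.env tok) (by rw [Conf.set, h.term_eq]; exact hlev.2)
    refine ⟨⟨?_, ?_, ?_, ?_, ?_, ?_, ?_, ?_⟩, Or.inl ?_⟩
    · simp [walkEnd, Cmd.eval, h.inner_eq]
    · simp [walkEnd, Cmd.eval, h.start_eq]
    · simp [walkEnd, Cmd.eval, h.term_eq]
    · simpa [walkEnd, Cmd.eval] using h.lin_eq
    · simpa [walkEnd, Cmd.eval] using h.lout_eq
    · simp [walkEnd, Cmd.eval, h0]
    · simpa [walkEnd, Cmd.eval] using h.one_eq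
    · rw [if_pos (by simp [walkEnd, Cmd.eval, h0])]
      simp [walkEnd, Cmd.eval, Conf.Flow]
      exact hend
    · simp [walkEnd, Cmd.eval, h0]
  · simp only [Fm.sat_eq, Conf.setVar_env, reduceCtorEq, if_true, if_false, h.zero_eq] at hif
    obtain ⟨d, hd⟩ : ∃ d, l.val = d + 1 :=
      ⟨l.val - 1, by have := Fin.val_ne_zero_iff.2 hif; omega⟩
    have hdm : d < m := by omega
    have hn := hmin' ⟨d, hdm⟩ (Fin.lt_def.2 (by simp; omega))
    have hpick : Cmd.eval (.pick lvl' (.isPred lvl' lvl)) (σ.setVar lvl l) =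
        (σ.setVar lvl l).setVar lvl' ⟨d, hdm⟩ := by
      rw [Cmd.eval, ← least_isPred hd]
      congr 2
      ext c
      simp [Fm.sat_isPred]
    rw [Cmd.eval, hpick, Cmd.eval]
    have hinv : WalkInv σ₀ ((σ.setVar lvl l).setVar lvl' ⟨d, hdm⟩) := by
      refine ⟨h.inner_eq, h.start_eq, h.term_eq, h.lin_eq, h.lout_eq, by simp [h.zero_eq],
        by simpa using h.one_eq, ?_⟩
      rw [if_neg (by simpa using hw)]
      refine ⟨l, by simpa using hlev, hsame, ?_⟩
      simpa [Conf.Flow] using hflow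
    split_ifs with hs
    · simp only [Fm.sat_eq, Conf.setVar_env, reduceCtorEq, if_false, h.zero_eq] at hs
      rw [if_pos hs] at hflow
      have := walkIn_spec hinv (by simpa using hw) (l := l) (d := ⟨d, hdm⟩) hd (by simp)
        (by simpa [Conf.Flow] using hflow) (by simpa [hs] using hlev)
        (by simpa [hs] using hn) hsame
      exact ⟨this.1, Or.inr this.2⟩
    · simp only [Fm.sat_eq, Conf.setVar_env, reduceCtorEq, if_false, h.zero_eq] at hs
      rw [if_neg hs] at hflow
      have := walkOut_spec hinv (by simpa using hw) (l := l) (d := ⟨d, hdm⟩) hd (by simp)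
        (by simpa [Conf.Flow] using hflow) (by simpa [hs] using hlev)
        (by simpa [hs] using hn) hsame
      exact ⟨this.1, Or.inr this.2⟩

/-- Start a token and let it walk to the target, if this is possible. -/
def augment : Cmd :=
  .ite (.ex tok <| .and (.rel start tok tok) (.ex y <| .rel lin tok y))
    (.seq (.pick tok <| .and (.rel start tok tok) (.ex y <| .rel lin tok y)) <|
      .seq (.assign first <| .or (.rel first x x) (.eq x tok)) <|
      .seq (.pick walking (.eq walking one)) <|
      .seq (.pick side (.eq side zero)) (.rep walkStep)) .skip

/-- The invariant of the augmentations. -/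
structure FlowInv (σ₀ σ : Conf m) [NeZero m] : Prop where
  inner_eq : σ.rel inner = σ₀.rel inner
  start_eq : σ.rel start = σ₀.rel start
  term_eq : σ.rel term = σ₀.rel term
  zero_eq : σ.env zero = 0
  one_eq : σ.env one ≠ 0
  flow_eq : σ.Flow (fun _ => False) (fun _ => False)

/-- The level of the token is below `m` and drops with every step of the walk, so `m` repetitions
bring it home. -/
theorem augment_spec [NeZero m] {σ : Conf m} (h : FlowInv σ σ)
    (hin : ∀ a d : Fin m, σ.rel lin a d ↔ σ.lev d false a)
    (hout : ∀ a d : Fin m, σ.rel lout a d ↔ σ.lev d true a)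
    (hex : ∃ a, σ.set start a ∧ ∃ d, σ.rel lin a d) :
    FlowInv σ (augment.eval σ) ∧
      count ((augment.eval σ).set first) = count (σ.set first) + 1 := by
  have hspec := least_spec hex
  set a := least fun a => σ.set start a ∧ ∃ d, σ.rel lin a d with ha
  obtain ⟨hst, d, hd⟩ := hspec
  have hstart := IsFlow.start h.flow_eq hst ((hin _ _).1 hd)
  set τ : Conf m := (((σ.setVar tok a).setRel first fun b _ => σ.rel first b b ∨ b = a).setVar
    walking (σ.env one)).setVar side 0 with hτ
  have hev : augment.eval σ = walkStep.eval^[m] τ := by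
    have e : Cmd.eval (.pick tok <| .and (.rel start tok tok) (.ex y <| .rel lin tok y)) σ =
        σ.setVar tok a := by
      rw [Cmd.eval_pick, ha]
      congr 2
    rw [augment, Cmd.eval_ite_pos (by simpa [Conf.set] using hex), Cmd.eval_seq, Cmd.eval_seq,
      Cmd.eval_seq, Cmd.eval_seq, Cmd.eval_rep, e]
    congr 1
    simp [hτ, Cmd.eval, h.zero_eq]
  have hinv : WalkInv σ τ := by
    refine ⟨by simp [hτ], by simp [hτ], by simp [hτ], by simpa [hτ] using hin,
      by simpa [hτ] using hout, by simpa [hτ] using h.zero_eq, by simpa [hτ] using h.one_eq, ?_⟩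
    rw [if_neg (by simpa [hτ] using h.one_eq)]
    refine ⟨d, by simpa [hτ] using (hin _ _).1 hd, ⟨by simp [hτ], by simp [hτ]⟩, ?_⟩
    rw [if_pos (by simp [hτ])]
    simp [hτ, Conf.Flow]
    exact hstart.2
  have hfirst : τ.set first = fun b => σ.set first b ∨ b = a := by
    simp [hτ, Conf.set]
  have key := iterate_reaches (F := walkStep.eval) (a := τ) (N := m)
    (I := fun ρ => WalkInv σ ρ ∧ ρ.rel first = τ.rel first) (G := fun ρ => ρ.env walking = 0)
    (μ := fun ρ => ρ.tokenLevel.val) ?_ ?_ ?_ ⟨hinv, rfl⟩ τ.tokenLevel.2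
  · rw [← hev] at key
    obtain ⟨⟨h1, h2⟩, h3⟩ := key
    refine ⟨⟨h1.inner_eq, h1.start_eq, h1.term_eq, h1.zero_eq, h1.one_eq, ?_⟩, ?_⟩
    · have := h1.flow_eq
      rwa [if_pos h3] at this
    · have e : (augment.eval σ).set first = fun b => σ.set first b ∨ b = a := by
        rw [← hfirst]
        ext b
        rw [Conf.set, h2]
        rfl
      rw [e, count_add_one hstart.1]
  · rintro ρ ⟨h1, h2⟩
    refine ⟨?_, ?_⟩
    · by_cases hw : ρ.env walking = 0
      · rw [walkStep, Cmd.eval_ite_pos (by simpa [h1.zero_eq] using hw)]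
        exact h1
      · exact (walkStep_spec h1 hw).1
    · rw [Cmd.eval_rel (by simp [walkStep, walkEnd, walkIn, walkOut, Cmd.ModRel]), h2]
  · rintro ρ ⟨h1, h2⟩ hw
    rw [walkStep, Cmd.eval_ite_pos (by simpa [h1.zero_eq] using hw)]
    exact hw
  · rintro ρ ⟨h1, h2⟩ hw
    exact (walkStep_spec h1 hw).2

/-- Compute a maximum number of vertex-disjoint paths and the levels of its residual network. -/
def maxFlow : Cmd :=
  .seq (.assign used .bot) <| .seq (.assign arc .bot) <| .seq (.assign first .bot) <|
  .seq (.assign last .bot) <| .seq (.rep <| .seq levels augment) levels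

theorem FlowInv.levels [NeZero m] {σ₀ σ : Conf m} (h : FlowInv σ₀ σ) :
    FlowInv σ₀ (levels.eval σ) ∧ (levels.eval σ).lev = σ.lev ∧
      (levels.eval σ).set first = σ.set first := by
  have hr : ∀ r, r ≠ lin → r ≠ lout → (DFVS.levels.eval σ).rel r = σ.rel r := fun r h1 h2 =>
    Cmd.eval_rel (by simp [DFVS.levels, levelIn, levelOut, Cmd.ModRel, h1, h2]) σ
  have hs : ∀ r, r ≠ lin → r ≠ lout → (DFVS.levels.eval σ).set r = σ.set r := fun r h1 h2 => by
    ext a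
    rw [Conf.set, hr r h1 h2]
    rfl
  have hv : ∀ v, (DFVS.levels.eval σ).env v = σ.env v := fun v =>
    Cmd.eval_env (by simp [DFVS.levels, levelIn, levelOut, Cmd.ModVar]) σ
  refine ⟨⟨?_, ?_, ?_, ?_, ?_, ?_⟩, ?_, ?_⟩
  · rw [hr _ (by simp) (by simp), h.inner_eq]
  · rw [hr _ (by simp) (by simp), h.start_eq]
  · rw [hr _ (by simp) (by simp), h.term_eq]
  · rw [hv, h.zero_eq]
  · rw [hv]; exact h.one_eq
  · have := h.flow_eq
    simp only [Conf.Flow] at this ⊢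
    rwa [hr _ (by simp) (by simp), hr _ (by simp) (by simp), hs _ (by simp) (by simp),
      hs _ (by simp) (by simp), hs _ (by simp) (by simp), hs _ (by simp) (by simp),
      hs _ (by simp) (by simp)]
  · simp only [Conf.lev]
    rw [hr _ (by simp) (by simp), hr _ (by simp) (by simp), hs _ (by simp) (by simp),
      hs _ (by simp) (by simp)]
  · exact hs _ (by simp) (by simp)

/-- All vertices of the network lie in `J`. Hence there are at most `count J < m` paths and `m`
rounds suffice; and the levels are stable from `2 * count J < m` on, so elements of the universe can
serve as their indices. -/
theorem maxFlow_spec [NeZero m] {σ : Conf m} (hzero : σ.env zero = 0) (hone : σ.env one ≠ 0)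
    {J : Fin m → Prop} (hJ : 2 * count J < m)
    (hinner : ∀ a b, σ.rel inner a b → J a ∧ J b) (hterm : ∀ a, σ.set term a → J a)
    (hstart : ∀ a, σ.set start a → J a) :
    FlowInv σ (maxFlow.eval σ) ∧
      (∀ a, σ.set start a → ∀ d, ¬ (maxFlow.eval σ).lev d false a) ∧
      ∀ a, (∃ d, (maxFlow.eval σ).rel lout a d) ↔ ∃ d, (maxFlow.eval σ).lev d true a := by
  set τ : Conf m := ((((σ.setRel used fun _ _ => False).setRel arc fun _ _ => False).setRel first
    fun _ _ => False).setRel last fun _ _ => False) with hτ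
  have hev : maxFlow.eval σ = levels.eval ((Cmd.seq levels augment).eval^[m] τ) := by
    rw [maxFlow, Cmd.eval_seq, Cmd.eval_seq, Cmd.eval_seq, Cmd.eval_seq, Cmd.eval_seq, Cmd.eval_rep]
    congr 2
    simp [hτ, Cmd.eval]
  have hinv : FlowInv σ τ := by
    refine ⟨by simp [hτ], by simp [hτ], by simp [hτ], by simpa [hτ] using hzero,
      by simpa [hτ] using hone, ?_⟩
    simp only [hτ, Conf.Flow]
    constructor <;> simp [count, ind]
  have hlevJ : ∀ {ρ : Conf m}, FlowInv σ ρ → ∀ d b a, ρ.lev d b a → J a := by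
    intro ρ hρ d
    induction d with
    | zero =>
      rintro b a ⟨-, ha⟩
      rw [Conf.set, hρ.term_eq] at ha
      exact hterm a ha
    | succ d ih =>
      have hi := hρ.inner_eq
      rintro (_ | _) a ha
      · rcases ha with ha | ⟨-, ha⟩ | ⟨z, ha, -⟩
        · exact ih _ _ ha
        · exact ih _ _ ha
        · have := hρ.flow_eq.arc_sub _ _ ha
          rw [hi] at this
          exact (hinner _ _ this).2
      · rcases ha with ha | ⟨y, ha, -⟩ | ⟨-, ha⟩
        · exact ih _ _ ha
        · rw [hi] at ha
          exact (hinner _ _ ha).1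
        · exact ih _ _ ha
  have htop : ∀ {ρ : Conf m}, FlowInv σ ρ → ∀ b a, (∃ d, ρ.lev d b a) → ∃ d : Fin m, ρ.lev d b a :=
    fun hρ b a ⟨d, hd⟩ => ⟨⟨2 * count J, hJ⟩, lev_of_lev (hlevJ hρ) le_rfl hd⟩
  have hcount : ∀ {ρ : Conf m}, FlowInv σ ρ → count (ρ.set first) ≤ count J := fun {ρ} hρ =>
    count_mono fun a ha => hstart a (by
      have := hρ.flow_eq.st_sub a ha
      rwa [Conf.set, hρ.start_eq] at this)
  have haug : ∀ {ρ : Conf m}, FlowInv σ ρ → FlowInv σ ((Cmd.seq levels augment).eval ρ) ∧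
      ((∀ a, σ.set start a → ∀ d, ¬ ρ.lev d false a) →
        ((Cmd.seq levels augment).eval ρ).lev = ρ.lev) ∧
      ((¬ ∀ a, σ.set start a → ∀ d, ¬ ρ.lev d false a) →
        count (((Cmd.seq levels augment).eval ρ).set first) = count (ρ.set first) + 1) := by
    intro ρ hρ
    obtain ⟨h1, h2, h3⟩ := hρ.levels
    have h4 := eval_levels hρ.zero_eq
    have hst : (levels.eval ρ).set start = σ.set start := by
      ext a
      rw [Conf.set, h1.start_eq]
      rfl
    rw [Cmd.eval_seq]
    by_cases hex : ∃ a, (levels.eval ρ).set start a ∧ ∃ d, (levels.eval ρ).rel lin a d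
    · have h5 := augment_spec ⟨rfl, rfl, rfl, h1.zero_eq, h1.one_eq, h1.flow_eq⟩
        (fun a d => by rw [h2]; exact (h4 a d).2) (fun a d => by rw [h2]; exact (h4 a d).1) hex
      refine ⟨⟨?_, ?_, ?_, h5.1.zero_eq, h5.1.one_eq, h5.1.flow_eq⟩, fun hn => ?_, fun _ => ?_⟩
      · rw [h5.1.inner_eq, h1.inner_eq]
      · rw [h5.1.start_eq, h1.start_eq]
      · rw [h5.1.term_eq, h1.term_eq]
      · obtain ⟨a, ha, d, hd⟩ := hex
        rw [hst] at ha
        exact absurd ((h4 a d).2.1 hd) (hn a ha d)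
      · rw [h5.2, h3]
    · rw [augment, Cmd.eval_ite_neg (by simpa [Conf.set] using hex), Cmd.eval]
      refine ⟨h1, fun _ => h2, fun hn => ?_⟩
      push Not at hn
      obtain ⟨a, ha, hd⟩ := hn
      obtain ⟨d, hd⟩ := htop hρ _ _ hd
      exact absurd ⟨a, by rwa [hst], d, (h4 a d).2.2 hd⟩ hex
  have key := iterate_reaches (F := (Cmd.seq levels augment).eval) (a := τ) (N := m)
    (I := fun ρ => FlowInv σ ρ) (G := fun ρ => ∀ a, σ.set start a → ∀ d, ¬ ρ.lev d false a)
    (μ := fun ρ => count J - count (ρ.set first)) (fun ρ (hρ : FlowInv σ ρ) => (haug hρ).1)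
    (fun ρ (hρ : FlowInv σ ρ) hG => by rw [(haug hρ).2.1 hG]; exact hG)
    (fun ρ (hρ : FlowInv σ ρ) hG => by
      right
      have h1 := (haug hρ).2.2 hG
      have h2 := hcount (haug hρ).1
      omega) hinv (by omega)
  obtain ⟨h1, h2, h3⟩ := key.1.levels
  have h4 := eval_levels key.1.zero_eq
  rw [hev]
  refine ⟨h1, by rw [h2]; exact key.2, fun a => ⟨fun ⟨d, hd⟩ => ?_, fun hd => ?_⟩⟩
  · exact ⟨d, by rw [h2]; exact (h4 a d).1.1 hd⟩
  · rw [h2] at hd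
    obtain ⟨d, hd⟩ := htop key.1 _ _ hd
    exact ⟨d, (h4 a d).1.2 hd⟩

end DFVS

namespace DFVS

/-! ### Feedback vertex sets and separators -/

section Push
variable {V : Type*}

/-- `X` meets every nonempty set of vertices in which every vertex has a successor. -/
def Hits (E : V → V → Prop) (X : V → Prop) : Prop :=
  ∀ Y : V → Prop, (∀ y, Y y → ¬ X y ∧ ∃ z, Y z ∧ E y z) → ∀ y, ¬ Y y

variable {E E' : V → V → Prop} {s : V} {T S A R U : V → Prop}

theorem Hits.mono (h : Hits E S) (hE : ∀ x y, E' x y → E x y) {S' : V → Prop}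
    (hS : ∀ x y, S x → E' x y → S' x) : Hits E' S' := by
  refine fun Y hY => h Y fun y hy => ?_
  obtain ⟨h1, z, hz, hyz⟩ := hY y hy
  exact ⟨fun hSy => h1 (hS y z hSy hyz), z, hz, hE _ _ hyz⟩

/-- If every terminal could reach a terminal without meeting `S`, the vertices that can reach a
terminal in this way would form a nonempty set, closed under taking some successor and disjoint from
`S`. So some terminal `s` reaches none, and `U` is everything reachable from `s` outside of `S`. -/
theorem Hits.exists_valid (hT : ∃ t, T t) (hS : Hits E S) (hST : ∀ x, T x → ¬ S x) :
    ∃ s U, T s ∧ Valid E s T U ∧ ∀ x, bd E s U x → S x := by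
  set E₁ : V → V → Prop := fun x y => E x y ∧ ¬ S x ∧ ¬ S y with hE₁
  obtain ⟨s, hs, hreach⟩ : ∃ s, T s ∧ ∀ t, T t → ¬ Relation.TransGen E₁ s t := by
    by_contra! hcon
    obtain ⟨t₀, ht₀⟩ := hT
    refine hS (fun y => ∃ t, T t ∧ Relation.TransGen E₁ y t) (fun y ⟨t, ht, hyt⟩ => ?_) t₀
      (hcon t₀ ht₀)
    rcases Relation.TransGen.head'_iff.1 hyt with ⟨z, hyz, hzt⟩
    refine ⟨hyz.2.1, z, ?_, hyz.1⟩
    rcases Relation.reflTransGen_iff_eq_or_transGen.1 hzt with rfl | hzt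
    · exact hcon _ ht
    · exact ⟨t, ht, hzt⟩
  have hbd : ∀ x, bd E s (fun x => Relation.TransGen E₁ s x) x → S x := by
    rintro x ⟨hx, h⟩
    by_contra hSx
    rcases h with h | ⟨y, hy, hyx⟩
    · exact hx (.single ⟨h, hST s hs, hSx⟩)
    · refine hx (hy.tail ⟨hyx, ?_, hSx⟩)
      obtain ⟨z, -, hz⟩ := Relation.TransGen.tail'_iff.1 hy
      exact hz.2.2
  refine ⟨s, fun x => Relation.TransGen E₁ s x, hs, fun t ht => ⟨hreach t ht, fun h => ?_⟩,
    hbd⟩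
  exact hST t ht (hbd t h)

/-- A set closed under successors that avoids the other terminals must contain `s`. The successor of
`s` in it lies in `R`, which no edge leaves, and from there on the set stays in `R`, where there is
no terminal. -/
theorem Hits.erase_source (hs : T s) (hT : Hits E T) (hR : Valid E s T R) (hbd : ∀ x, ¬ bd E s R x) :
    Hits E fun x => T x ∧ x ≠ s := by
  refine fun Y hY => ?_
  have hYR : ∀ y, ¬ (Y y ∧ R y) := by
    refine hT (fun y => Y y ∧ R y) fun y ⟨hy, hRy⟩ => ⟨fun hTy => (hR y hTy).1 hRy, ?_⟩
    obtain ⟨-, z, hz, hyz⟩ := hY y hy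
    refine ⟨z, ⟨hz, ?_⟩, hyz⟩
    by_contra hRz
    exact hbd z ⟨hRz, Or.inr ⟨y, hRy, hyz⟩⟩
  refine hT Y fun y hy => ?_
  obtain ⟨h1, z, hz, hyz⟩ := hY y hy
  refine ⟨fun hTy => ?_, z, hz, hyz⟩
  obtain rfl : y = s := by
    by_contra hne
    exact h1 ⟨hTy, hne⟩
  refine hYR z ⟨hz, ?_⟩
  by_contra hRz
  exact hbd z ⟨hRz, Or.inl hyz⟩

theorem Valid.union (hU : Valid E s T U) (hR : Valid E s T R) :
    Valid E s T fun x => U x ∨ R x := by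
  intro y hy
  have h1 := hU y hy
  have h2 := hR y hy
  refine ⟨by tauto, ?_⟩
  rintro ⟨hn, h | ⟨x, hx | hx, hxy⟩⟩
  · exact h1.2 ⟨h1.1, Or.inl h⟩
  · exact h1.2 ⟨h1.1, Or.inr ⟨x, hx, hxy⟩⟩
  · exact h2.2 ⟨h2.1, Or.inr ⟨x, hx, hxy⟩⟩

theorem Valid.inter (hU : Valid E s T U) :
    Valid E s T fun x => U x ∧ R x := by
  intro y hy
  have h1 := hU y hy
  refine ⟨by tauto, ?_⟩
  rintro ⟨hn, h | ⟨x, hx, hxy⟩⟩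
  · exact h1.2 ⟨h1.1, Or.inl h⟩
  · exact h1.2 ⟨h1.1, Or.inr ⟨x, hx.1, hxy⟩⟩

/-- Submodularity holds vertex by vertex: a vertex on one of the boundaries on the left is on one of
those on the right, and a vertex on both is on both. -/
theorem count_bd_submodular [Fintype V] :
    count (bd E s fun x => U x ∨ R x) + count (bd E s fun x => U x ∧ R x) ≤
      count (bd E s U) + count (bd E s R) := by
  simp only [count, ← Finset.sum_add_distrib]
  refine Finset.sum_le_sum fun y _ => ?_
  have h1 : bd E s (fun x => U x ∨ R x) y → bd E s U y ∨ bd E s R y := by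
    rintro ⟨hn, h | ⟨x, hx | hx, hxy⟩⟩
    · exact Or.inl ⟨by tauto, Or.inl h⟩
    · exact Or.inl ⟨by tauto, Or.inr ⟨x, hx, hxy⟩⟩
    · exact Or.inr ⟨by tauto, Or.inr ⟨x, hx, hxy⟩⟩
  have h2 : bd E s (fun x => U x ∧ R x) y → bd E s U y ∨ bd E s R y := by
    rintro ⟨hn, h⟩
    by_cases hU : U y
    · refine Or.inr ⟨by tauto, ?_⟩
      rcases h with h | ⟨x, hx, hxy⟩
      · exact Or.inl h
      · exact Or.inr ⟨x, hx.2, hxy⟩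
    · refine Or.inl ⟨hU, ?_⟩
      rcases h with h | ⟨x, hx, hxy⟩
      · exact Or.inl h
      · exact Or.inr ⟨x, hx.1, hxy⟩
  have h3 : bd E s (fun x => U x ∨ R x) y → bd E s (fun x => U x ∧ R x) y →
      bd E s U y ∧ bd E s R y := by
    rintro ⟨hn, -⟩ ⟨-, h⟩
    refine ⟨⟨by tauto, ?_⟩, ⟨by tauto, ?_⟩⟩
    · rcases h with h | ⟨x, hx, hxy⟩
      · exact Or.inl h
      · exact Or.inr ⟨x, hx.1, hxy⟩
    · rcases h with h | ⟨x, hx, hxy⟩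
      · exact Or.inl h
      · exact Or.inr ⟨x, hx.2, hxy⟩
  unfold ind
  split_ifs <;> first | omega | tauto

/-- A solution that separates some set around `A` from `T` can be changed such that it separates a
set around the farthest minimum separator. -/
theorem Hits.push [Fintype V] (hT : Hits E T) (hS : Hits E S) (hU : Valid E s T U)
    (hAU : ∀ x, A x → U x) (hbd : ∀ x, bd E s U x → S x)
    (hR : Valid E s T R) (hAR : ∀ x, A x → R x)
    (hmin : ∀ U, Valid E s T U → (∀ x, A x → U x) → count (bd E s R) ≤ count (bd E s U)) :
    ∃ S' U' : V → Prop, Hits E S' ∧ count S' ≤ count S ∧ Valid E s T U' ∧ (∀ x, R x → U' x) ∧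
      ∀ x, bd E s U' x → S' x := by
  set U' : V → Prop := fun x => U x ∨ R x with hU'
  set S' : V → Prop := fun x => (S x ∧ ¬ U' x) ∨ bd E s U' x with hS'
  have hval := hU.union hR
  refine ⟨S', U', fun Y hY => ?_, ?_, hval, fun x hx => Or.inr hx, fun x hx => Or.inr hx⟩
  -- A closed set that avoids `S'` cannot leave `U'` once it is inside, as the way out is blocked by
  -- the new boundary; but inside `U'` there are no terminals.
  · have hYU : ∀ y, ¬ (Y y ∧ U' y) := by
      refine hT (fun y => Y y ∧ U' y) fun y ⟨hy, hUy⟩ => ⟨fun hTy => (hval y hTy).1 hUy, ?_⟩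
      obtain ⟨-, z, hz, hyz⟩ := hY y hy
      refine ⟨z, ⟨hz, ?_⟩, hyz⟩
      by_contra hUz
      exact (hY z hz).1 (Or.inr ⟨hUz, Or.inr ⟨y, hUy, hyz⟩⟩)
    refine hS Y fun y hy => ⟨fun hSy => ?_, (hY y hy).2⟩
    exact (hY y hy).1 (Or.inl ⟨hSy, fun hUy => hYU y ⟨hy, hUy⟩⟩)
  -- The intersection also separates, so its boundary is no smaller than that of `R`. By
  -- submodularity the boundary of the union is then no larger than that of `U`, and replacing the
  -- one by the other costs nothing.
  · have h1 := hmin (fun x => U x ∧ R x) hU.inter fun x hx => ⟨hAU x hx, hAR x hx⟩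
    have h2 := count_bd_submodular (E := E) (s := s) (U := U) (R := R)
    have h3 : count S' ≤ count (fun x => S x ∧ ¬ bd E s U x) + count (bd E s U') := by
      rw [count_split S' (bd E s U'), add_comm]
      refine add_le_add (count_mono fun x ⟨hx, hn⟩ => ?_) (count_mono fun x hx => hx.2)
      rcases hx with ⟨hSx, hUx⟩ | hx
      · refine ⟨hSx, fun hb => hn ⟨hUx, ?_⟩⟩
        rcases hb.2 with h | ⟨y, hy, hyx⟩
        · exact Or.inl h
        · exact Or.inr ⟨y, Or.inl hy, hyx⟩
      · exact absurd hx hn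
    have h4 : count S = count (fun x => S x ∧ bd E s U x) + count (fun x => S x ∧ ¬ bd E s U x) :=
      count_split _ _
    have h5 : count (bd E s U) ≤ count (fun x => S x ∧ bd E s U x) :=
      count_mono fun x hx => ⟨hbd x hx, hx⟩
    change count (bd E s U') + _ ≤ _ at h2
    omega

/-- The edges that remain after the deletion of a vertex. -/
def eraseEdge (E : V → V → Prop) (v x y : V) : Prop := E x y ∧ x ≠ v ∧ y ≠ v

theorem bd_eraseEdge {v y : V} (h : bd (eraseEdge E v) s U y) : bd E s U y ∧ y ≠ v := by
  obtain ⟨hn, h | ⟨x, hx, hxy⟩⟩ := h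
  · exact ⟨⟨hn, Or.inl h.1⟩, h.2.2⟩
  · exact ⟨⟨hn, Or.inr ⟨x, hx, hxy.1⟩⟩, hxy.2.2⟩

theorem Valid.eraseEdge (h : Valid E s T U) (v : V) : Valid (eraseEdge E v) s T U :=
  fun y hy => ⟨(h y hy).1, fun hb => (h y hy).2 (bd_eraseEdge hb).1⟩

/-- A separator after the deletion of `v` becomes one before it when `v` is taken out of `U` and
allowed on the boundary. Because `v` is not in `A`, the smaller set still contains `A`. -/
theorem count_bd_eraseEdge [Fintype V] {v : V} {N : ℕ} (hvs : v ≠ s) (hvT : ¬ T v)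
    (hvA : ¬ A v) (hmin : ∀ U, Valid E s T U → (∀ x, A x → U x) → N ≤ count (bd E s U))
    (hU : Valid (DFVS.eraseEdge E v) s T U) (hA : ∀ x, A x → U x) :
    N ≤ count (bd (DFVS.eraseEdge E v) s U) + 1 := by
  have hsub : ∀ y, bd E s (fun x => U x ∧ x ≠ v) y → bd (DFVS.eraseEdge E v) s U y ∨ y = v := by
    rintro y ⟨hn, h⟩
    by_cases hyv : y = v
    · exact Or.inr hyv
    · refine Or.inl ⟨fun hy => hn ⟨hy, hyv⟩, ?_⟩
      rcases h with h | ⟨x, ⟨hx, hxv⟩, hxy⟩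
      · exact Or.inl ⟨h, hvs.symm, hyv⟩
      · exact Or.inr ⟨x, hx, hxy, hxv, hyv⟩
  have h1 := hmin (fun x => U x ∧ x ≠ v) (fun y hy => ⟨fun h => (hU y hy).1 h.1, fun h => ?_⟩)
    fun x hx => ⟨hA x hx, by rintro rfl; exact hvA hx⟩
  · have h2 := count_mono hsub
    by_cases hb : bd (DFVS.eraseEdge E v) s U v
    · exact absurd rfl (bd_eraseEdge hb).2
    · rw [count_add_one hb] at h2
      omega
  · rcases hsub y h with h | rfl
    · exact (hU y hy).2 h
    · exact hvT hy

end Push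

end DFVS

namespace DFVS
open DFVS.Var DFVS.Rel
variable {m : ℕ}

/-! ### One step of the search for a small feedback vertex set -/

/-- Increment the pointer to the next bit of the advice. -/
def nextBit : Cmd := .seq (.pick tmp (.eq tmp ptr)) (.pick ptr (.isPred tmp ptr))

/-- Compute the farthest minimum separator between `src` with `near` and the sinks; `far` is the
set of vertices in front of it. -/
def separate : Cmd :=
  .seq (.assign alive <| .and (.rel edge x y) <| .and (.le x iter) <| .and (.le y iter) <|
    .and (.neg (.rel del x x)) (.neg (.rel del y y))) <|
  .seq (.assign sink <| .or (.eq x src) (.ex z (.rel perm z x))) <|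
  .seq (.assign inner <| .and (.rel alive x y) <|
    .and (.and (.neg (.rel sink x x)) (.neg (.rel near x x)))
      (.and (.neg (.rel sink y y)) (.neg (.rel near y y)))) <|
  .seq (.assign start <| .and (.and (.neg (.rel sink x x)) (.neg (.rel near x x))) <|
    .or (.rel alive src x) (.ex z <| .and (.rel near z z) (.rel alive z x))) <|
  .seq (.assign term <| .and (.and (.neg (.rel sink x x)) (.neg (.rel near x x))) <|
    .ex z <| .and (.rel sink z z) (.rel alive x z)) <|
  .seq maxFlow <|
  .assign far <| .or (.rel near x x) <| .and (.neg (.rel sink x x)) (.neg (.ex z (.rel lout x z)))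

/-- The vertex is in the separator. -/
def boundary : Fm :=
  .and (.neg (.rel far vert vert)) <| .or (.rel alive src vert) <|
    .ex z <| .and (.rel far z z) (.rel alive z vert)

/-- Delete a vertex of the separator, or add it to `near`. -/
def branchRest : Cmd :=
  .seq (.ite (.eq bit zero) (.assign near <| .or (.rel far x x) (.eq x vert)) <|
    .seq (.assign del <| .or (.rel del x x) (.eq x vert)) (.assign near <| .rel far x x)) nextBit

/-- Choose a vertex of the separator and branch on it. -/
def branch : Cmd :=
  .seq (.pick vert boundary) <| .seq (.pick bit <| .rel advice ptr bit) branchRest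

/-- Delete the chosen terminal, or make it the new source. -/
def beginRest : Cmd :=
  .seq (.pick src <| .rel perm digit src) <|
  .seq (.assign perm <| .and (.neg (.eq x pos)) <| .or (.and (.eq x digit) (.rel perm pos y)) <|
    .and (.neg (.eq x digit)) (.rel perm x y)) <|
  .seq (.ite (.eq bit zero) (.seq (.assign near .bot) (.pick active (.eq active one))) <|
    .assign del <| .or (.rel del x x) (.eq x src)) nextBit

/-- Choose the next terminal. -/
def begin : Cmd :=
  .ite (.ex x <| .ex y <| .rel perm x y)
    (.seq (.pick pos <| .and (.ex y <| .rel perm pos y) <|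
        .neg <| .ex z <| .and (.lt pos z) (.ex y <| .rel perm z y)) <|
      .seq (.pick digit <| .rel advice pos digit) <|
      .seq (.pick bit <| .rel advice ptr bit) beginRest) .skip

/-- One step of the search that is guided by the advice. -/
def searchStep : Cmd :=
  .ite (.eq active zero) begin <|
  .seq separate <| .ite (.ex vert boundary) branch <| .pick active (.eq active zero)

/-- The terminals of the search. -/
def Conf.terminal (σ : Conf m) (a : Fin m) : Prop := σ.set sol a ∨ a = σ.env iter

/-- The edges that are not deleted. -/
def Conf.live (σ : Conf m) (a b : Fin m) : Prop :=
  σ.rel edge a b ∧ a ≤ σ.env iter ∧ b ≤ σ.env iter ∧ ¬ σ.set del a ∧ ¬ σ.set del b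

/-- The positions of the remaining terminals. -/
def Conf.dom (σ : Conf m) (a : Fin m) : Prop := ∃ b, σ.rel perm a b

/-- The remaining terminals. -/
def Conf.rng (σ : Conf m) (b : Fin m) : Prop := ∃ a, σ.rel perm a b

/-- The remaining terminals and the current source. -/
def Conf.sinks (σ : Conf m) (b : Fin m) : Prop := b = σ.env src ∨ σ.rng b

/-- The conditions on a configuration that the search does not touch. -/
structure Ground [NeZero m] (σ : Conf m) : Prop where
  zero_eq : σ.env zero = 0
  one_eq : (σ.env one).val = 1
  iter_lt : (σ.env iter).val < (σ.env order).val
  budget_lt : (σ.env budget).val < (σ.env order).val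
  limit_eq : (σ.env limit).val = (σ.env order).val + 3 * (σ.env budget).val + 1
  -- The slack lets the universe accommodate the pointer into the advice, the levels of the network
  -- and the number of steps of a search.
  size : 8 * (σ.env order).val < m
  terminal_le : ∀ a, σ.terminal a → a ≤ σ.env iter
  terminal_count : count σ.terminal ≤ (σ.env budget).val + 1

/-- The invariant of a successful search. -/
structure SearchInv [NeZero m] (σ : Conf m) : Prop extends Ground σ where
  perm_fun : ∀ a b b', σ.rel perm a b → σ.rel perm a b' → b = b'
  perm_inj : ∀ a a' b, σ.rel perm a b → σ.rel perm a' b → a = a'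
  -- The remaining positions are an initial segment of the terminals, because the largest one is
  -- always vacated. So position `i` offers a choice among the terminals up to `i`.
  dom_iff : ∃ c : ℕ, ∀ a, σ.dom a ↔ σ.terminal a ∧ a.val < c
  le_ptr : (σ.env order).val ≤ (σ.env ptr).val
  of_inactive : σ.env active = 0 → Hits σ.live σ.rng ∧ ∃ S : Fin m → Prop, Hits σ.live S ∧
    count S + count (σ.set del) ≤ (σ.env budget).val ∧
    -- The account of the bits: drawing a terminal moves one unit from `count σ.dom` to the pointer,
    -- and a deletion adds two units of credit.
    (σ.env ptr).val + count σ.dom ≤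
      (σ.env order).val + count σ.terminal + 2 * count (σ.set del)
  of_active : σ.env active ≠ 0 → ¬ σ.rng (σ.env src) ∧ Hits σ.live σ.sinks ∧
    ∃ (S U : Fin m → Prop) (l : ℕ), Hits σ.live S ∧
    count S + count (σ.set del) ≤ (σ.env budget).val ∧
    Valid σ.live (σ.env src) σ.sinks U ∧ (∀ a, σ.set near a → U a) ∧
    (∀ a, bd σ.live (σ.env src) U a → S a) ∧
    (∀ U, Valid σ.live (σ.env src) σ.sinks U → (∀ a, σ.set near a → U a) →
      l ≤ count (bd σ.live (σ.env src) U)) ∧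
    -- While a source is active, the lower bound `l` on its separators counts as further credit.
    (σ.env ptr).val + count σ.dom ≤
      (σ.env order).val + count σ.terminal + 2 * count (σ.set del) + l

theorem count_le_val (a : Fin m) : count (fun b => b ≤ a) = a.val + 1 := by
  rw [count_eq_card, ← Fin.card_Iic]
  congr 1
  ext b
  simp

theorem not_modRel_maxFlow {r : Rel} : ¬ maxFlow.ModRel r ↔
    r ≠ used ∧ r ≠ arc ∧ r ≠ first ∧ r ≠ last ∧ r ≠ lin ∧ r ≠ lout := by
  simp [maxFlow, augment, levels, levelOut, levelIn, walkStep, walkEnd, walkIn, walkOut, Cmd.ModRel]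
  tauto

theorem not_modVar_maxFlow {v : Var} : ¬ maxFlow.ModVar v ↔
    v ≠ tok ∧ v ≠ walking ∧ v ≠ side ∧ v ≠ lvl ∧ v ≠ lvl' ∧ v ≠ vert := by
  simp [maxFlow, augment, levels, levelOut, levelIn, walkStep, walkEnd, walkIn, walkOut, Cmd.ModVar]
  tauto

/-- The set `U₀` only certifies that a separator exists at all, that is, that no edge leads directly
from the source or `near` to a sink. -/
theorem separate_spec [NeZero m] {σ : Conf m} (h : Ground σ) {U₀ : Fin m → Prop}
    (hU₀ : Valid σ.live (σ.env src) σ.sinks U₀) (hA : ∀ a, σ.set near a → U₀ a) :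
    ∃ R : Fin m → Prop, (separate.eval σ).set far = R ∧ (separate.eval σ).rel alive = σ.live ∧
      (∀ a, σ.set near a → R a) ∧ Valid σ.live (σ.env src) σ.sinks R ∧
      ∀ U, Valid σ.live (σ.env src) σ.sinks U → (∀ a, σ.set near a → U a) →
      count (bd σ.live (σ.env src) R) ≤ count (bd σ.live (σ.env src) U) ∧
      ∀ v, bd σ.live (σ.env src) R v → U v →
        count (bd σ.live (σ.env src) R) < count (bd σ.live (σ.env src) U) := by
  set τ : Conf m := ((((σ.setRel alive σ.live).setRel sink fun a _ => σ.sinks a).setRel inner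
    (innerEdge σ.live σ.sinks (σ.set near))).setRel start
      fun a _ => source σ.live (σ.env src) σ.sinks (σ.set near) a).setRel term
      fun a _ => target σ.live σ.sinks (σ.set near) a with hτ
  have hev : separate.eval σ = Cmd.eval (.assign far <| .or (.rel near x x) <|
      .and (.neg (.rel sink x x)) (.neg (.ex z (.rel lout x z)))) (maxFlow.eval τ) := by
    simp only [separate, Cmd.eval_seq]
    congr 2
    have e1 : Cmd.eval (.assign alive <| .and (.rel edge x y) <| .and (.le x iter) <|
        .and (.le y iter) <| .and (.neg (.rel del x x)) (.neg (.rel del y y))) σ =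
        σ.setRel alive σ.live := by
      rw [Cmd.eval]
      congr 1
      ext a b
      simp [Conf.live, Conf.set]
    have e2 : Cmd.eval (.assign sink <| .or (.eq x src) (.ex z (.rel perm z x)))
        (σ.setRel alive σ.live) = (σ.setRel alive σ.live).setRel sink fun a _ => σ.sinks a := by
      rw [Cmd.eval]
      congr 1
      ext a b
      simp [Conf.sinks, Conf.rng]
    rw [e1, e2]
    simp only [Cmd.eval, hτ]
    congr 3
    ext a b
    simp
    exact Iff.rfl
  -- Live edges stay among the vertices up to `iter`, fewer than an eighth of the universe.
  have hflow := maxFlow_spec (σ := τ) (J := fun a => a ≤ σ.env iter) (by simp [hτ, h.zero_eq])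
    (by
      have := h.one_eq
      simp only [hτ, Conf.setRel_env]
      intro h0
      rw [h0] at this
      simp at this)
    (by rw [count_le_val]; have h1 := h.iter_lt; have h2 := h.size; omega)
    (fun a b hab => by
      simp [hτ] at hab
      exact ⟨hab.1.2.1, hab.1.2.2.1⟩)
    (fun a ha => by
      simp [hτ] at ha
      obtain ⟨-, t, -, ht⟩ := ha
      exact ht.2.1)
    (fun a ha => by
      simp [hτ] at ha
      rcases ha.2 with ha | ⟨t, -, ha⟩
      · exact ha.2.2.1
      · exact ha.2.2.1)
  obtain ⟨hinv, hmax, hout⟩ := hflow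
  have hmod : ∀ r, ¬ maxFlow.ModRel r → (maxFlow.eval τ).rel r = τ.rel r := fun r hr =>
    Cmd.eval_rel hr τ
  have hset : ∀ r D, (maxFlow.eval τ).rel r = D → (maxFlow.eval τ).set r = fun a => D a a := by
    rintro r _ rfl
    rfl
  have hinner : (maxFlow.eval τ).rel inner = innerEdge σ.live σ.sinks (σ.set near) := by
    rw [hinv.inner_eq]; simp [hτ]
  have hstart : (maxFlow.eval τ).set start = source σ.live (σ.env src) σ.sinks (σ.set near) := by
    rw [hset start _ hinv.start_eq]; simp [hτ]
  have hterm : (maxFlow.eval τ).set term = target σ.live σ.sinks (σ.set near) := by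
    rw [hset term _ hinv.term_eq]; simp [hτ]
  have hfl := hinv.flow_eq
  simp only [Conf.Flow, Conf.lev, hinner, hstart, hterm] at hfl hmax hout
  have hfar : ∀ a, (separate.eval σ).set far a ↔ σ.set near a ∨ (¬ σ.sinks a ∧
      ∀ d, ¬ lev (innerEdge σ.live σ.sinks (σ.set near)) (target σ.live σ.sinks (σ.set near))
        ((maxFlow.eval τ).set used) ((maxFlow.eval τ).rel arc) d true a) := by
    intro a
    have := hout a
    have hne := hmod near (by simp [not_modRel_maxFlow])
    have hsi := hmod sink (by simp [not_modRel_maxFlow])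
    rw [hev]
    simp [Cmd.eval, Conf.set, hne, hsi] at this ⊢
    rw [← not_exists, this]
    simp [hτ]
  obtain ⟨h1, h2⟩ := IsFlow.separator hfl (by simpa [hτ] using hmax) hU₀ hA hfar
  refine ⟨_, rfl, ?_, fun a ha => (hfar a).2 (Or.inl ha), h1, h2⟩
  rw [hev, Cmd.eval_rel (by simp [Cmd.ModRel]), hmod _ (by simp [not_modRel_maxFlow])]
  simp [hτ]

end DFVS

namespace DFVS
open DFVS.Var DFVS.Rel
variable {m : ℕ}

/-! ### The search succeeds for some advice -/

/-- The configurations agree on everything that the search does not change. -/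
structure SameInput (σ τ : Conf m) : Prop where
  sol_eq : τ.rel sol = σ.rel sol
  edge_eq : τ.rel edge = σ.rel edge
  zero_eq : τ.env zero = σ.env zero
  one_eq : τ.env one = σ.env one
  iter_eq : τ.env iter = σ.env iter
  order_eq : τ.env order = σ.env order
  budget_eq : τ.env budget = σ.env budget
  limit_eq : τ.env limit = σ.env limit

theorem SameInput.refl (σ : Conf m) : SameInput σ σ := ⟨rfl, rfl, rfl, rfl, rfl, rfl, rfl, rfl⟩

theorem SameInput.trans {σ τ ρ : Conf m} (h : SameInput σ τ) (h' : SameInput τ ρ) :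
    SameInput σ ρ :=
  ⟨h'.1.trans h.1, h'.2.trans h.2, h'.3.trans h.3, h'.4.trans h.4, h'.5.trans h.5,
    h'.6.trans h.6, h'.7.trans h.7, h'.8.trans h.8⟩

theorem SameInput.symm {σ τ : Conf m} (h : SameInput σ τ) : SameInput τ σ :=
  ⟨h.1.symm, h.2.symm, h.3.symm, h.4.symm, h.5.symm, h.6.symm, h.7.symm, h.8.symm⟩

theorem SameInput.terminal {σ τ : Conf m} (h : SameInput σ τ) : τ.terminal = σ.terminal := by
  ext a
  rw [Conf.terminal, Conf.terminal, Conf.set, Conf.set, h.sol_eq, h.iter_eq]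

theorem SameInput.ground [NeZero m] {σ τ : Conf m} (h : SameInput σ τ) (hσ : Ground σ) :
    Ground τ := by
  obtain ⟨h1, h2, h3, h4, h5, h6, h7, h8⟩ := hσ
  refine ⟨?_, ?_, ?_, ?_, ?_, ?_, ?_, ?_⟩
  all_goals
    simpa only [h.terminal, h.zero_eq, h.one_eq, h.iter_eq, h.order_eq, h.budget_eq, h.limit_eq]

theorem SameInput.live {σ τ : Conf m} (h : SameInput σ τ) (hd : τ.rel del = σ.rel del) :
    τ.live = σ.live := by
  ext a b
  simp only [Conf.live, h.iter_eq, h.edge_eq, Conf.set, hd]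

theorem SameInput.live_erase {σ τ : Conf m} (h : SameInput σ τ) {v : Fin m}
    (hd : ∀ a, τ.set del a ↔ σ.set del a ∨ a = v) : τ.live = eraseEdge σ.live v := by
  ext a b
  simp only [Conf.live, h.iter_eq, h.edge_eq, hd, eraseEdge]
  tauto

theorem Cmd.sameInput [NeZero m] {P : Cmd} (σ : Conf m) (h1 : ¬ P.ModRel sol) (h2 : ¬ P.ModRel edge)
    (h3 : ∀ v, P.ModVar v → v ≠ zero ∧ v ≠ one ∧ v ≠ iter ∧ v ≠ order ∧ v ≠ budget ∧ v ≠ limit) :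
    SameInput σ (P.eval σ) := by
  refine ⟨P.eval_rel h1 σ, P.eval_rel h2 σ, ?_, ?_, ?_, ?_, ?_, ?_⟩
  all_goals
    exact P.eval_env (fun h => by simpa using h3 _ h) σ

theorem not_modRel_separate {r : Rel} : ¬ separate.ModRel r ↔
    (r ≠ alive ∧ r ≠ sink ∧ r ≠ Rel.inner ∧ r ≠ start ∧ r ≠ term ∧ r ≠ far) ∧
    r ≠ used ∧ r ≠ arc ∧ r ≠ first ∧ r ≠ last ∧ r ≠ lin ∧ r ≠ lout := by
  simp only [separate, Cmd.ModRel, not_or, not_modRel_maxFlow]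
  tauto

theorem not_modVar_separate {v : Var} : ¬ separate.ModVar v ↔
    v ≠ tok ∧ v ≠ walking ∧ v ≠ side ∧ v ≠ lvl ∧ v ≠ lvl' ∧ v ≠ vert := by
  simp only [separate, Cmd.ModVar, not_or, not_modVar_maxFlow]
  tauto

theorem eval_nextBit [NeZero m] {σ : Conf m} {p : Fin m} (h : p.val = (σ.env ptr).val + 1) :
    nextBit.eval σ = (σ.setVar tmp (σ.env ptr)).setVar ptr p := by
  rw [nextBit, Cmd.eval_seq, Cmd.eval_pick tmp]
  have e : (fun a => (Fm.eq tmp ptr).Sat (σ.setVar tmp a)) = fun a => a = σ.env ptr := by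
    ext a
    simp
  rw [e, least_eq_left, Cmd.eval_pick]
  congr 1
  refine least_eq ?_ fun b hb => ?_
  · simp [Fm.sat_isPred, h]
  · have := Fin.lt_def.1 hb
    simp [Fm.sat_isPred]
    omega

theorem sat_boundary (σ : Conf m) :
    boundary.Sat σ ↔ bd (σ.rel alive) (σ.env src) (σ.set far) (σ.env vert) := by
  simp [boundary, bd, Conf.set]

/-- The positions of the advice that the search has not read. -/
def Conf.unread (σ : Conf m) (i : Fin m) : Prop :=
  σ.dom i ∨ σ.env ptr ≤ i ∧ σ.env order ≤ i

/-- The values of the advice. -/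
def Conf.admissible (σ : Conf m) (i a : Fin m) : Prop :=
  (i < σ.env order ∧ (σ.terminal i ∧ σ.terminal a ∧ a ≤ i ∨ ¬ σ.terminal i ∧ a.val = 0)) ∨
    σ.env order ≤ i ∧ (i < σ.env limit ∧ a.val ≤ 1 ∨ a.val = 0)

/-- The configuration with given advice. -/
def Conf.withAdvice (σ : Conf m) (g : Fin m → Fin m) : Conf m :=
  σ.setRel advice fun i a => g i = a

/-- The search is finished. -/
def Conf.finished [NeZero m] (σ : Conf m) : Prop := σ.env active = 0 ∧ ∀ a, ¬ σ.dom a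

open Classical in
/-- A bound for the number of remaining steps of the search. -/
noncomputable def Conf.weight [NeZero m] (σ : Conf m) : ℕ :=
  2 * count σ.dom + (if σ.env active = 0 then 0 else 1) + ((σ.env limit).val - (σ.env ptr).val)

/-! ### Drawing a terminal as in a Fisher-Yates shuffle -/

section Swap
variable {p : Fin m → Fin m → Prop} {w d s : Fin m}

/-- Remove `d` from the domain of a bijection, move `w` to its place. -/
def swapOut (p : Fin m → Fin m → Prop) (w d x y : Fin m) : Prop :=
  x ≠ w ∧ (x = d ∧ p w y ∨ x ≠ d ∧ p x y)

theorem swapOut_fun (hf : ∀ a b b', p a b → p a b' → b = b') (a b b' : Fin m)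
    (h : swapOut p w d a b) (h' : swapOut p w d a b') : b = b' := by
  obtain ⟨-, ⟨h1, h2⟩ | ⟨h1, h2⟩⟩ := h <;> obtain ⟨-, ⟨h3, h4⟩ | ⟨h3, h4⟩⟩ := h'
  · exact hf _ _ _ h2 h4
  · exact absurd h1 h3
  · exact absurd h3 h1
  · exact hf _ _ _ h2 h4

theorem swapOut_inj (hi : ∀ a a' b, p a b → p a' b → a = a') (a a' b : Fin m)
    (h : swapOut p w d a b) (h' : swapOut p w d a' b) : a = a' := by
  obtain ⟨h0, ⟨h1, h2⟩ | ⟨h1, h2⟩⟩ := h <;> obtain ⟨h5, ⟨h3, h4⟩ | ⟨h3, h4⟩⟩ := h'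
  · rw [h1, h3]
  · exact absurd (hi _ _ _ h4 h2) h5
  · exact absurd (hi _ _ _ h2 h4) h0
  · exact hi _ _ _ h2 h4

theorem swapOut_dom (hd : ∃ b, p d b) (hw : ∃ b, p w b) (a : Fin m) :
    (∃ b, swapOut p w d a b) ↔ (∃ b, p a b) ∧ a ≠ w := by
  by_cases h : a = d
  · subst h
    simp [swapOut, hd, hw, and_comm]
  · simp [swapOut, h, and_comm]

/-- The position `w` disappears from the domain while the value at `d` disappears from the range;
the value at `w` is saved by moving it to `d`. The case `w = d` needs no separate treatment. -/
theorem swapOut_rng (hf : ∀ a b b', p a b → p a b' → b = b')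
    (hi : ∀ a a' b, p a b → p a' b → a = a') (hd : p d s) (b : Fin m) :
    (∃ a, swapOut p w d a b) ↔ (∃ a, p a b) ∧ b ≠ s := by
  constructor
  · rintro ⟨a, h0, ⟨h1, h2⟩ | ⟨h1, h2⟩⟩
    · refine ⟨⟨_, h2⟩, ?_⟩
      rintro rfl
      exact h0 (h1.trans (hi _ _ _ hd h2))
    · refine ⟨⟨_, h2⟩, ?_⟩
      rintro rfl
      exact h1 (hi _ _ _ h2 hd)
  · rintro ⟨⟨a, ha⟩, hb⟩
    have had : a ≠ d := by
      rintro rfl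
      exact hb (hf _ _ _ ha hd)
    by_cases haw : a = w
    · subst haw
      exact ⟨d, had.symm, Or.inl ⟨rfl, ha⟩⟩
    · exact ⟨a, haw, Or.inr ⟨had, ha⟩⟩

end Swap

/-- The configuration after a terminal has been chosen. -/
theorem beginRest_spec [NeZero m] {σ : Conf m} {p s : Fin m} (hp : p.val = (σ.env ptr).val + 1)
    (hf : ∀ a b b', σ.rel perm a b → σ.rel perm a b' → b = b')
    (hs : σ.rel perm (σ.env digit) s) (h0 : σ.env zero = 0) :
    let τ := beginRest.eval σ
    SameInput σ τ ∧ τ.env src = s ∧ τ.env ptr = p ∧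
    τ.rel perm = swapOut (σ.rel perm) (σ.env pos) (σ.env digit) ∧
    (σ.env bit = 0 → (∀ a, ¬ τ.set near a) ∧ τ.env active = σ.env one ∧ τ.rel del = σ.rel del) ∧
    (σ.env bit ≠ 0 → τ.env active = σ.env active ∧ ∀ a, τ.set del a ↔ σ.set del a ∨ a = s) := by
  intro τ
  have hsame : SameInput σ τ := Cmd.sameInput σ (by simp [beginRest, nextBit, Cmd.ModRel])
    (by simp [beginRest, nextBit, Cmd.ModRel]) fun v => by
      simp only [beginRest, nextBit, Cmd.ModVar]
      intro h
      refine ⟨?_, ?_, ?_, ?_, ?_, ?_⟩ <;> rintro rfl <;> simp at h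
  have hτ : τ = beginRest.eval σ := rfl
  have e : (fun a => (Fm.rel perm digit src).Sat (σ.setVar src a)) = fun a => s = a := by
    ext a
    simp
    exact ⟨fun h => hf _ _ _ hs h, fun h => h ▸ hs⟩
  rw [beginRest, Cmd.eval_seq, Cmd.eval_pick, e, least_eq_right, Cmd.eval_seq, Cmd.eval_seq] at hτ
  have e2 : Cmd.eval (.assign perm <| .and (.neg (.eq x pos)) <| .or (.and (.eq x digit) (.rel perm pos y)) <|
    .and (.neg (.eq x digit)) (.rel perm x y)) (σ.setVar src s) =
      (σ.setVar src s).setRel perm (swapOut (σ.rel perm) (σ.env pos) (σ.env digit)) := by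
    rw [Cmd.eval]
    congr 1
    ext a b
    simp [swapOut]
  rw [e2] at hτ
  refine ⟨hsame, ?_⟩
  rw [hτ]
  by_cases hb : σ.env bit = 0
  · rw [Cmd.eval_ite_pos (by simp [hb, h0]), eval_nextBit (p := p) (by simpa [Cmd.eval] using hp)]
    simp [Cmd.eval, hb]
  · rw [Cmd.eval_ite_neg (by simp [hb, h0]), eval_nextBit (p := p) (by simpa [Cmd.eval] using hp)]
    simp [Cmd.eval, hb, Conf.set]

/-- The configuration after a vertex of the separator has been chosen. -/
theorem branchRest_spec [NeZero m] {σ : Conf m} {p : Fin m} (hp : p.val = (σ.env ptr).val + 1)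
    (h0 : σ.env zero = 0) :
    let τ := branchRest.eval σ
    SameInput σ τ ∧ τ.env src = σ.env src ∧ τ.env ptr = p ∧ τ.rel perm = σ.rel perm ∧
    τ.env active = σ.env active ∧
    (σ.env bit = 0 → (∀ a, τ.set near a ↔ σ.set far a ∨ a = σ.env vert) ∧
      τ.rel del = σ.rel del) ∧
    (σ.env bit ≠ 0 → (∀ a, τ.set near a ↔ σ.set far a) ∧
      ∀ a, τ.set del a ↔ σ.set del a ∨ a = σ.env vert) := by
  intro τ
  have hsame : SameInput σ τ := Cmd.sameInput σ (by simp [branchRest, nextBit, Cmd.ModRel])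
    (by simp [branchRest, nextBit, Cmd.ModRel]) fun v => by
      simp only [branchRest, nextBit, Cmd.ModVar]
      intro h
      refine ⟨?_, ?_, ?_, ?_, ?_, ?_⟩ <;> rintro rfl <;> simp at h
  have hτ : τ = branchRest.eval σ := rfl
  rw [branchRest, Cmd.eval_seq] at hτ
  refine ⟨hsame, ?_⟩
  rw [hτ]
  by_cases hb : σ.env bit = 0
  · rw [Cmd.eval_ite_pos (by simp [hb, h0]), eval_nextBit (p := p) (by simpa [Cmd.eval] using hp)]
    simp [Cmd.eval, hb, Conf.set]
  · rw [Cmd.eval_ite_neg (by simp [hb, h0]), eval_nextBit (p := p) (by simpa [Cmd.eval] using hp)]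
    simp [Cmd.eval, hb, Conf.set]

/-- The advice enters only through its values at `w` and at the pointer; everything after these two
lookups commutes with it. -/
theorem eval_begin [NeZero m] {σ : Conf m} {w : Fin m} (ha : σ.env active = σ.env zero)
    (hw : σ.dom w) (hmax : ∀ a, σ.dom a → a ≤ w) (g : Fin m → Fin m) :
    searchStep.eval (σ.withAdvice g) =
      (beginRest.eval (((σ.setVar pos w).setVar digit (g w)).setVar bit
        (g (σ.env ptr)))).withAdvice g := by
  have e1 : (Fm.ex x <| .ex y <| .rel perm x y).Sat (σ.withAdvice g) := by
    obtain ⟨b, hb⟩ := hw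
    simp only [Conf.withAdvice]
    simp
    exact ⟨w, b, hb⟩
  have e2 : (least fun a => (Fm.and (.ex y <| .rel perm pos y) <| .neg <| .ex z <|
      .and (.lt pos z) (.ex y <| .rel perm z y)).Sat ((σ.withAdvice g).setVar pos a)) = w := by
    refine least_eq ?_ fun b hb h => ?_
    · simp [Conf.withAdvice]
      exact ⟨hw, fun a ha b hab => absurd (hmax a ⟨b, hab⟩) (not_le.2 ha)⟩
    · simp [Conf.withAdvice] at h
      obtain ⟨c, hc⟩ := hw
      exact h.2 w hb c hc
  rw [searchStep, Cmd.eval_ite_pos (by simpa [Conf.withAdvice] using ha), begin,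
    Cmd.eval_ite_pos e1, Cmd.eval_seq, Cmd.eval_pick, e2, Cmd.eval_seq, Cmd.eval_seq]
  have e3 : Cmd.eval (.pick digit <| .rel advice pos digit) ((σ.withAdvice g).setVar pos w) =
      ((σ.withAdvice g).setVar pos w).setVar digit (g w) := by
    rw [Cmd.eval_pick]
    congr 1
    simp [Conf.withAdvice]
  rw [e3]
  have e4 : Cmd.eval (.pick bit <| .rel advice ptr bit)
      (((σ.withAdvice g).setVar pos w).setVar digit (g w)) =
      (((σ.setVar pos w).setVar digit (g w)).setVar bit (g (σ.env ptr))).withAdvice g := by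
    rw [Cmd.eval_pick]
    simp only [Conf.withAdvice, ← Conf.setVar_setRel]
    congr 1
    simp
  rw [e4]
  exact Cmd.eval_setRel (by simp [beginRest, nextBit, Fm.isPred, Fm.bot, Fm.or, Cmd.Uses, Fm.Uses]) _ _

theorem Hits.restrict {σ : Conf m} {S : Fin m → Prop} (h : Hits σ.live S) :
    Hits σ.live fun a => S a ∧ ¬ σ.set del a :=
  h.mono (fun _ _ h => h) fun _ _ hS hE => ⟨hS, hE.2.2.2.1⟩

theorem Hits.erase {V : Type*} {E : V → V → Prop} {S : V → Prop} (h : Hits E S) (v : V) :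
    Hits (eraseEdge E v) fun a => S a ∧ a ≠ v :=
  h.mono (fun _ _ h => h.1) fun _ _ hS hE => ⟨hS, hE.2.1⟩

end DFVS

/-! ### Progress of the guided search -/

namespace DFVS
open DFVS.Var DFVS.Rel
variable {m : ℕ}

theorem SearchInv.dom_lt [NeZero m] {σ : Conf m} (h : SearchInv σ) {a : Fin m} (ha : σ.dom a) :
    a < σ.env order ∧ σ.terminal a := by
  obtain ⟨c, hc⟩ := h.dom_iff
  have h1 := ((hc a).1 ha).1
  refine ⟨lt_of_le_of_lt (h.terminal_le a h1) h.iter_lt, h1⟩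

/-- The configuration `τ` is reached by one step of the search for all advice that agrees with
`f` at the positions that are read. -/
structure Advances [NeZero m] (σ τ : Conf m) (f : Fin m → Fin m) : Prop where
  same : SameInput σ τ
  inv : SearchInv τ
  weight_lt : τ.weight < σ.weight
  unread : ∀ i, τ.unread i → σ.unread i
  admissible : ∀ i, σ.unread i → ¬ τ.unread i → σ.admissible i (f i)
  eval_eq : ∀ g, (∀ i, σ.unread i → ¬ τ.unread i → g i = f i) →
    searchStep.eval (σ.withAdvice g) = τ.withAdvice g

/-- The advice is chosen with a solution `S` in mind: delete a remaining terminal if `S` contains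
one that is not deleted; otherwise activate a terminal that reaches no remaining terminal outside of
`S`. -/
theorem SearchInv.begin_step [NeZero m] {σ : Conf m} (h : SearchInv σ) (ha : σ.env active = 0)
    (hd : ∃ a, σ.dom a) : ∃ τ f, Advances σ τ f := by
  obtain ⟨hT, S, hS, hSk, hptr⟩ := h.of_inactive ha
  obtain ⟨w, hw, hmax⟩ := Set.exists_max_image {a | σ.dom a} id (Set.toFinite _) hd
  replace hw : σ.dom w := hw
  replace hmax : ∀ a, σ.dom a → a ≤ w := hmax
  have hwo := h.dom_lt hw
  have hcd : count (fun a => σ.dom a ∧ a ≠ w) + 1 = count σ.dom := count_sub_one hw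
  have hSS : count (fun a => S a ∧ ¬ σ.set del a) ≤ count S := count_mono fun a h => h.1
  -- At least one terminal remains, and deletions number at most the budget, so the account leaves
  -- the pointer strictly below `order + (k + 1) + 2 * k`, which is `limit`.
  have hptr_lt : (σ.env ptr).val + 1 < (σ.env limit).val + 1 := by
    have h1 := h.limit_eq
    have h2 := h.terminal_count
    omega
  have hpm : (σ.env ptr).val + 1 < m := by
    have h1 := h.limit_eq
    have h2 := h.size
    have h3 := h.budget_lt
    have := (σ.env limit).2
    omega
  obtain ⟨p, hp⟩ : ∃ p : Fin m, p.val = (σ.env ptr).val + 1 := ⟨⟨_, hpm⟩, rfl⟩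
  -- the choice of a terminal and of a bit
  have key : ∀ s d b : Fin m, σ.rel perm d s → b.val ≤ 1 →
      let τ := beginRest.eval (((σ.setVar pos w).setVar digit d).setVar bit b)
      (τ.env active = 0 → Hits τ.live τ.rng ∧ ∃ S : Fin m → Prop, Hits τ.live S ∧
        count S + count (τ.set del) ≤ (τ.env budget).val ∧
        (τ.env ptr).val + count τ.dom ≤
          (τ.env order).val + count τ.terminal + 2 * count (τ.set del)) →
      (τ.env active ≠ 0 → ¬ τ.rng (τ.env src) ∧ Hits τ.live τ.sinks ∧
        ∃ (S U : Fin m → Prop) (l : ℕ), Hits τ.live S ∧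
        count S + count (τ.set del) ≤ (τ.env budget).val ∧
        Valid τ.live (τ.env src) τ.sinks U ∧ (∀ a, τ.set near a → U a) ∧
        (∀ a, bd τ.live (τ.env src) U a → S a) ∧
        (∀ U, Valid τ.live (τ.env src) τ.sinks U → (∀ a, τ.set near a → U a) →
          l ≤ count (bd τ.live (τ.env src) U)) ∧
        (τ.env ptr).val + count τ.dom ≤
          (τ.env order).val + count τ.terminal + 2 * count (τ.set del) + l) →
      ∃ τ f, Advances σ τ f := by
    intro s d b hds hb τ hin hac
    obtain ⟨h1, h2, h3, h4, h5, h6⟩ := beginRest_spec (p := p) (s := s)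
      (σ := ((σ.setVar pos w).setVar digit d).setVar bit b) (by simpa using hp) h.perm_fun
      (by simpa using hds) (by simpa using h.zero_eq)
    change τ.rel perm = _ at h4
    change τ.env ptr = _ at h3
    simp at h4
    have hsame : SameInput σ τ := SameInput.trans (τ := ((σ.setVar pos w).setVar digit d).setVar bit b)
      ⟨rfl, rfl, by simp, by simp, by simp, by simp, by simp, by simp⟩ h1
    have hdom : ∀ a, τ.dom a ↔ σ.dom a ∧ a ≠ w := fun a => by
      rw [Conf.dom, h4]
      exact swapOut_dom ⟨s, hds⟩ hw a
    have hdw : d ≤ w := hmax d ⟨s, hds⟩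
    have hto := hsame.terminal
    have hun : ∀ i, σ.unread i → ¬ τ.unread i → i = w ∨ i = σ.env ptr := by
      intro i hi hni
      simp only [Conf.unread, hdom, h3, hsame.order_eq, not_or, not_and] at hi hni
      by_contra! hne
      rcases hi with hi | hi
      · exact hni.1 hi hne.1
      · refine hni.2 (Fin.le_def.2 ?_) hi.2
        have h7 := Fin.le_def.1 hi.1
        have h8 := Fin.val_ne_iff.2 hne.2
        omega
    have hwp : σ.env ptr ≠ w := by
      intro h'
      have := Fin.lt_def.1 hwo.1
      have := h.le_ptr
      rw [h'] at this
      omega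
    -- Only the values at `w` and at the pointer matter; these positions differ since `w` is below
    -- `order` and the pointer is not.
    refine ⟨τ, fun i => if i = w then d else b, hsame, ?_, ?_, ?_, ?_, ?_⟩
    · refine { hsame.ground h.toGround with
        perm_fun := ?_, perm_inj := ?_, dom_iff := ?_, le_ptr := ?_, of_inactive := hin, of_active := hac }
      · rw [h4]
        exact swapOut_fun h.perm_fun
      · rw [h4]
        exact swapOut_inj h.perm_inj
      · obtain ⟨c, hc⟩ := h.dom_iff
        refine ⟨w, fun a => ?_⟩
        rw [hdom, hto]
        constructor
        · rintro ⟨h7, h8⟩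
          exact ⟨((hc a).1 h7).1, Fin.lt_def.1 (lt_of_le_of_ne (hmax a h7) h8)⟩
        · rintro ⟨h7, h8⟩
          exact ⟨(hc a).2 ⟨h7, h8.trans ((hc w).1 hw).2⟩, fun h' => by simp [h'] at h8⟩
      · have := h.le_ptr
        rw [hsame.order_eq, h3]
        omega
    · have h7 : count τ.dom + 1 = count σ.dom := by
        rw [← hcd]
        exact congrArg (· + 1) (count_congr hdom)
      rw [Conf.weight, Conf.weight, if_pos ha, h3, hsame.limit_eq]
      split_ifs <;> omega
    · intro i hi
      simp only [Conf.unread, hdom, h3, hsame.order_eq] at hi ⊢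
      rcases hi with hi | hi
      · exact Or.inl hi.1
      · exact Or.inr ⟨(Fin.le_def.2 (by omega)).trans hi.1, hi.2⟩
    · intro i hi hni
      rcases hun i hi hni with rfl | rfl
      · rw [if_pos rfl]
        exact Or.inl ⟨hwo.1, Or.inl ⟨hwo.2, (h.dom_lt ⟨s, hds⟩).2, hdw⟩⟩
      · rw [if_neg hwp]
        exact Or.inr ⟨h.le_ptr, Or.inl ⟨Fin.lt_def.2 (by omega), hb⟩⟩
    · intro g hg
      have hgw : g w = d := by
        rw [hg w (Or.inl hw), if_pos rfl]
        rintro (h' | h')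
        · exact ((hdom w).1 h').2 rfl
        · rw [hsame.order_eq] at h'
          exact absurd hwo.1 (not_lt.2 h'.2)
      have hgp : g (σ.env ptr) = b := by
        rw [hg _ (Or.inr ⟨le_rfl, h.le_ptr⟩), if_neg hwp]
        rintro (h' | h')
        · exact absurd (h.dom_lt ((hdom _).1 h').1).1 (not_lt.2 (Fin.le_def.2 h.le_ptr))
        · rw [h3] at h'
          have := Fin.le_def.1 h'.1
          omega
      rw [eval_begin (by rw [ha, h.zero_eq]) hw hmax, hgw, hgp]
  -- the two cases
  by_cases hTS : ∃ s, σ.rng s ∧ S s ∧ ¬ σ.set del s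
  · obtain ⟨s, ⟨d, hds⟩, hSs, hsd⟩ := hTS
    obtain ⟨h1, h2, h3, h4, h5, h6⟩ := beginRest_spec (p := p) (s := s)
      (σ := ((σ.setVar pos w).setVar digit d).setVar bit (σ.env one)) (by simpa using hp) h.perm_fun
      (by simpa using hds) (by simpa using h.zero_eq)
    have hone : σ.env one ≠ 0 := fun h' => by
      have := h.one_eq
      rw [h'] at this
      simp at this
    have h7 := h6 (by simpa using hone)
    refine key s d (σ.env one) hds h.one_eq.le (fun _ => ?_) fun h' => ?_
    · have hsame : SameInput σ (((σ.setVar pos w).setVar digit d).setVar bit (σ.env one)) :=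
        ⟨rfl, rfl, by simp, by simp, by simp, by simp, by simp, by simp⟩
      replace hsame := hsame.trans h1
      generalize beginRest.eval (((σ.setVar pos w).setVar digit d).setVar bit (σ.env one)) = τ at *
      have hlive := hsame.live_erase (v := s) h7.2
      have hdel : count (τ.set del) = count (σ.set del) + 1 := by
        rw [← count_add_one hsd]
        exact count_congr h7.2
      have hdom : count τ.dom = count fun a => σ.dom a ∧ a ≠ w := count_congr fun a => by
        rw [Conf.dom, h4]
        exact swapOut_dom ⟨s, by simpa using hds⟩ hw a
      refine ⟨?_, fun a => S a ∧ a ≠ s, ?_, ?_, ?_⟩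
      · rw [hlive]
        refine (hT.erase s).mono (fun _ _ h => h) fun a b hab _ => ?_
        rw [Conf.rng, h4]
        exact (swapOut_rng h.perm_fun h.perm_inj (by simpa using hds) a).2 hab
      · rw [hlive]
        exact hS.erase s
      · have := count_sub_one hSs
        rw [hdel, hsame.budget_eq]
        omega
      · rw [h3, hdel, hdom, hsame.order_eq, hsame.terminal]
        omega
    · rw [h7.1] at h'
      exact absurd (by simpa using ha) h'
  · push Not at hTS
    have hrng : ∃ t, σ.rng t := by
      obtain ⟨b, hb⟩ := hw
      exact ⟨b, w, hb⟩
    -- Vertices that are already deleted carry no live edges and may be removed from `S`; then `S`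
    -- is disjoint from the remaining terminals.
    obtain ⟨s, U, ⟨d, hds⟩, hU, hbd⟩ := hS.restrict.exists_valid hrng
      fun a h1 h2 => h2.2 (hTS a h1 h2.1)
    obtain ⟨h1, h2, h3, h4, h5, h6⟩ := beginRest_spec (p := p) (s := s)
      (σ := ((σ.setVar pos w).setVar digit d).setVar bit 0) (by simpa using hp) h.perm_fun
      (by simpa using hds) (by simpa using h.zero_eq)
    have hone : σ.env one ≠ 0 := fun h' => by
      have := h.one_eq
      rw [h'] at this
      simp at this
    obtain ⟨h7, h8, h9⟩ := h5 (by simp)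
    refine key s d 0 hds (by simp) (fun h' => ?_) fun _ => ?_
    · rw [h8] at h'
      exact absurd (by simpa using h') hone
    · have hsame : SameInput σ (((σ.setVar pos w).setVar digit d).setVar bit 0) :=
        ⟨rfl, rfl, by simp, by simp, by simp, by simp, by simp, by simp⟩
      replace hsame := hsame.trans h1
      generalize beginRest.eval (((σ.setVar pos w).setVar digit d).setVar bit 0) = τ at *
      simp at h9 h4
      have hlive := hsame.live h9
      have hdel : τ.set del = σ.set del := by
        ext a
        rw [Conf.set, h9]
        rfl
      have hdom : count τ.dom = count fun a => σ.dom a ∧ a ≠ w := count_congr fun a => by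
        rw [Conf.dom, h4]
        exact swapOut_dom ⟨s, hds⟩ hw a
      have hrng : ∀ b, τ.rng b ↔ σ.rng b ∧ b ≠ s := fun b => by
        rw [Conf.rng, h4]
        exact swapOut_rng h.perm_fun h.perm_inj hds b
      have hsinks : τ.sinks = σ.rng := by
        ext b
        rw [Conf.sinks, hrng, h2]
        constructor
        · rintro (rfl | hb)
          · exact ⟨d, hds⟩
          · exact hb.1
        · intro hb
          by_cases hbs : b = s
          · exact Or.inl hbs
          · exact Or.inr ⟨hb, hbs⟩
      rw [hlive, hsinks, h2, h3, hdel, hdom, hsame.order_eq, hsame.terminal, hsame.budget_eq]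
      -- A fresh source starts with empty `near` and with the trivial lower bound `0`, so activation
      -- needs no credit beyond the terminal that it consumes.
      refine ⟨fun h' => ((hrng s).1 h').2 rfl, hT, _, U, 0, hS.restrict, by omega, hU,
        fun a ha => absurd ha (h7 a), hbd, fun _ _ _ => Nat.zero_le _, by omega⟩

/-! ### The step with an active source: branch or retire -/

theorem separate_frame [NeZero m] (σ : Conf m) : SameInput σ (separate.eval σ) ∧
    (separate.eval σ).env src = σ.env src ∧ (separate.eval σ).env ptr = σ.env ptr ∧
    (separate.eval σ).env active = σ.env active ∧ (separate.eval σ).rel perm = σ.rel perm ∧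
    (separate.eval σ).rel del = σ.rel del ∧ (separate.eval σ).rel near = σ.rel near := by
  have hr : ∀ r, ¬ separate.ModRel r → _ := fun r h => Cmd.eval_rel h σ
  have hv : ∀ v, ¬ separate.ModVar v → _ := fun v h => Cmd.eval_env h σ
  refine ⟨⟨?_, ?_, ?_, ?_, ?_, ?_, ?_, ?_⟩, ?_, ?_, ?_, ?_, ?_, ?_⟩
  all_goals first
    | exact hr _ (by simp [not_modRel_separate])
    | exact hv _ (by simp [not_modVar_separate])

theorem separate_withAdvice [NeZero m] (σ : Conf m) (g : Fin m → Fin m) :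
    separate.eval (σ.withAdvice g) = (separate.eval σ).withAdvice g :=
  Cmd.eval_setRel (by
    simp [separate, maxFlow, augment, levels, levelOut, levelIn, walkStep, walkEnd, walkIn,
      walkOut, Fm.isPred, Fm.bot, Fm.or, Fm.le, Cmd.Uses, Fm.Uses]) _ _

theorem eval_branch [NeZero m] {σ : Conf m} (ha : σ.env active ≠ σ.env zero)
    (hex : ∃ v, bd ((separate.eval σ).rel alive) (σ.env src) ((separate.eval σ).set far) v)
    (g : Fin m → Fin m) :
    searchStep.eval (σ.withAdvice g) =
      (branchRest.eval (((separate.eval σ).setVar vert (least fun v =>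
        bd ((separate.eval σ).rel alive) (σ.env src) ((separate.eval σ).set far) v)).setVar bit
        (g (σ.env ptr)))).withAdvice g := by
  have hsrc := (separate_frame σ).2.1
  have hptr := (separate_frame σ).2.2.1
  rw [searchStep, Cmd.eval_ite_neg (by simpa [Conf.withAdvice] using ha), Cmd.eval_seq,
    separate_withAdvice, Cmd.eval_ite_pos, branch, Cmd.eval_seq, Cmd.eval_seq]
  · have e1 : Cmd.eval (.pick vert boundary) ((separate.eval σ).withAdvice g) =
        ((separate.eval σ).setVar vert (least fun v => bd ((separate.eval σ).rel alive)
          (σ.env src) ((separate.eval σ).set far) v)).withAdvice g := by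
      rw [Cmd.eval_pick]
      simp only [Conf.withAdvice, ← Conf.setVar_setRel]
      congr 2
      ext v
      rw [sat_boundary]
      simp [hsrc]
    rw [e1]
    have e2 : ∀ ρ : Conf m, Cmd.eval (.pick bit <| .rel advice ptr bit) (ρ.withAdvice g) =
        (ρ.setVar bit (g (ρ.env ptr))).withAdvice g := fun ρ => by
      rw [Cmd.eval_pick]
      simp only [Conf.withAdvice, ← Conf.setVar_setRel]
      congr 1
      simp
    rw [e2, Conf.setVar_env, if_neg (by simp), hptr]
    exact Cmd.eval_setRel (by simp [branchRest, nextBit, Fm.isPred, Fm.or, Cmd.Uses, Fm.Uses]) _ _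
  · obtain ⟨v, hv⟩ := hex
    rw [Fm.sat_ex]
    refine ⟨v, ?_⟩
    rw [sat_boundary]
    simpa [Conf.withAdvice, hsrc] using hv

theorem eval_retire [NeZero m] {σ : Conf m} (ha : σ.env active ≠ σ.env zero)
    (hex : ∀ v, ¬ bd ((separate.eval σ).rel alive) (σ.env src) ((separate.eval σ).set far) v)
    (g : Fin m → Fin m) :
    searchStep.eval (σ.withAdvice g) =
      ((separate.eval σ).setVar active (σ.env zero)).withAdvice g := by
  have hsrc := (separate_frame σ).2.1
  have hzero := (separate_frame σ).1.zero_eq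
  rw [searchStep, Cmd.eval_ite_neg (by simpa [Conf.withAdvice] using ha), Cmd.eval_seq,
    separate_withAdvice, Cmd.eval_ite_neg, Cmd.eval_pick]
  · simp only [Conf.withAdvice, ← Conf.setVar_setRel]
    congr 1
    simp [hzero]
  · rw [Fm.sat_ex]
    rintro ⟨v, hv⟩
    rw [sat_boundary] at hv
    simp [Conf.withAdvice, hsrc] at hv
    exact hex v hv

/-- An empty separator retires the source. Otherwise the solution is pushed so that its separated
set `U'` contains `R`, and the chosen vertex `v` either lies in `U'`, where protecting it raises the
minimum by one, or lies on the boundary of `U'`, hence in the solution, and is deleted. -/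
theorem SearchInv.active_step [NeZero m] {σ : Conf m} (h : SearchInv σ) (ha : σ.env active ≠ 0) :
    ∃ τ f, Advances σ τ f := by
  obtain ⟨hsrc, hT, S, U, l, hS, hSk, hU, hnU, hbU, hl, hptr⟩ := h.of_active ha
  obtain ⟨R, hR, halive, hnR, hRv, hmin⟩ := separate_spec h.toGround hU hnU
  have ha' : σ.env active ≠ σ.env zero := by rwa [h.zero_eq]
  obtain ⟨f1, f2, f3, f4, f5, f6, f7⟩ := separate_frame σ
  have hbranch := eval_branch ha'
  have hretire := eval_retire ha'
  rw [halive, hR] at hbranch hretire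
  generalize separate.eval σ = ρ at *
  have hdel : ∀ {τ : Conf m}, τ.rel del = σ.rel del → τ.set del = σ.set del := fun h => by
    ext a
    rw [Conf.set, h]
    rfl
  have hdom : ∀ {τ : Conf m}, τ.rel perm = σ.rel perm → τ.dom = σ.dom := fun h => by
    ext a
    rw [Conf.dom, h]
    rfl
  have hrng : ∀ {τ : Conf m}, τ.rel perm = σ.rel perm → τ.rng = σ.rng := fun h => by
    ext a
    rw [Conf.rng, h]
    rfl
  by_cases hex : ∃ v, bd σ.live (σ.env src) R v
  swap
  · push Not at hex
    refine ⟨ρ.setVar active (σ.env zero), id, ?_⟩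
    have hs : SameInput σ (ρ.setVar active (σ.env zero)) := f1.trans
      ⟨rfl, rfl, by simp, by simp, by simp, by simp, by simp, by simp⟩
    have hlive := hs.live (τ := ρ.setVar active (σ.env zero)) f6
    -- The credit `l` is lost at retirement, but an empty boundary shows that it was zero.
    have hl0 : l ≤ 0 := (hl R hRv hnR).trans (count_eq_zero.2 hex).le
    have hun : (ρ.setVar active (σ.env zero)).unread = σ.unread := by
      ext i
      rw [Conf.unread, hdom (by simpa using f5), hs.order_eq, Conf.unread]
      simp [f3]
    refine ⟨hs, { hs.ground h.toGround with
      perm_fun := ?_, perm_inj := ?_, dom_iff := ?_, le_ptr := ?_, of_inactive := fun _ => ?_,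
      of_active := fun h' => absurd ?_ h' }, ?_, fun i hi => ?_, fun i hi hni => ?_, fun g _ => ?_⟩
    · simpa [f5] using h.perm_fun
    · simpa [f5] using h.perm_inj
    · rw [hdom (by simpa using f5), hs.terminal]
      exact h.dom_iff
    · rw [hs.order_eq]
      simpa [f3] using h.le_ptr
    · rw [hlive, hdom (by simpa using f5), hdel (by simpa using f6), hrng (by simpa using f5),
        hs.budget_eq, hs.order_eq, hs.terminal, Conf.setVar_env, if_neg (by simp), f3]
      refine ⟨?_, S, hS, hSk, by omega⟩
      refine (Hits.erase_source (T := σ.sinks) (Or.inl rfl) hT hRv hex).mono (fun _ _ h => h) ?_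
      rintro a b ⟨h1 | h1, h2⟩ _
      · exact absurd h1 h2
      · exact h1
    · simp [h.zero_eq]
    · rw [Conf.weight, Conf.weight, hdom (by simpa using f5), if_neg ha, if_pos (by simp [h.zero_eq]),
        hs.limit_eq, Conf.setVar_env, if_neg (by simp), f3]
      omega
    · rwa [hun] at hi
    · rw [hun] at hni
      exact absurd hi hni
    · exact hretire hex g
  -- branching
  have hv := least_spec hex
  set v := least fun v => bd σ.live (σ.env src) R v with hvdef
  replace hbranch := hbranch hex
  obtain ⟨S', U', hS', hSS, hU', hRU, hbU'⟩ := hT.push hS hU hnU hbU hRv hnR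
    fun U hU hn => (hmin U hU hn).1
  have hcR : 0 < count (bd σ.live (σ.env src) R) := count_pos.2 hex
  have hRU' : count (bd σ.live (σ.env src) R) ≤ count (bd σ.live (σ.env src) U') :=
    (hmin U' hU' fun a ha => hRU a (hnR a ha)).1
  have hUS' : count (bd σ.live (σ.env src) U') ≤ count S' := count_mono hbU'
  have hlR := hl R hRv hnR
  -- Here `l` is at most the size of the remaining solution, which is positive; so `2 * count del +
  -- l` is strictly below twice the budget.
  have hptr_lt : (σ.env ptr).val < (σ.env limit).val := by
    have h1 := h.limit_eq
    have h2 := h.terminal_count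
    omega
  have hpm : (σ.env ptr).val + 1 < m := by
    have h1 := h.limit_eq
    have h2 := h.size
    have h3 := h.budget_lt
    omega
  obtain ⟨p, hp⟩ : ∃ p : Fin m, p.val = (σ.env ptr).val + 1 := ⟨⟨_, hpm⟩, rfl⟩
  have hvdel : ¬ σ.set del v := by
    rcases hv.2 with h1 | ⟨a, -, h1⟩ <;> exact h1.2.2.2.2
  have hvT : ¬ σ.sinks v := fun h' => (hRv v h').2 hv
  have hvs : v ≠ σ.env src := fun h' => hvT (Or.inl h')
  have key : ∀ b : Fin m, b.val ≤ 1 →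
      let τ := branchRest.eval ((ρ.setVar vert v).setVar bit b)
      Hits τ.live σ.sinks → (∃ (S U : Fin m → Prop) (l : ℕ), Hits τ.live S ∧
        count S + count (τ.set del) ≤ (σ.env budget).val ∧
        Valid τ.live (σ.env src) σ.sinks U ∧ (∀ a, τ.set near a → U a) ∧
        (∀ a, bd τ.live (σ.env src) U a → S a) ∧
        (∀ U, Valid τ.live (σ.env src) σ.sinks U → (∀ a, τ.set near a → U a) →
          l ≤ count (bd τ.live (σ.env src) U)) ∧
        (σ.env ptr).val + 1 + count σ.dom ≤
          (σ.env order).val + count σ.terminal + 2 * count (τ.set del) + l) →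
      ∃ τ f, Advances σ τ f := by
    intro b hb τ hTτ hex
    obtain ⟨h1, h2, h3, h4, h5, h6⟩ := branchRest_spec (p := p)
      (σ := (ρ.setVar vert v).setVar bit b) (by simpa [f3] using hp)
      (by simpa [f1.zero_eq] using h.zero_eq)
    change τ.env src = _ at h2
    change τ.env ptr = _ at h3
    change τ.rel perm = _ at h4
    change τ.env active = _ at h5
    simp at h2 h4 h5
    rw [f2] at h2
    rw [f5] at h4
    rw [f4] at h5
    have hs : SameInput σ τ := (f1.trans (τ := ρ) (ρ := (ρ.setVar vert v).setVar bit b)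
      ⟨rfl, rfl, by simp, by simp, by simp, by simp, by simp, by simp⟩).trans h1
    have hsinks : τ.sinks = σ.sinks := by
      ext a
      rw [Conf.sinks, h2, hrng h4]
      rfl
    have hun : ∀ i, σ.unread i → ¬ τ.unread i → i = σ.env ptr := by
      intro i hi hni
      simp only [Conf.unread, hdom h4, h3, hs.order_eq, not_or, not_and] at hi hni
      by_contra hne
      rcases hi with hi | hi
      · exact hni.1 hi
      · refine hni.2 (Fin.le_def.2 ?_) hi.2
        have h7 := Fin.le_def.1 hi.1
        have h8 := Fin.val_ne_iff.2 hne
        omega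
    refine ⟨τ, fun _ => b, hs, { hs.ground h.toGround with
      perm_fun := ?_, perm_inj := ?_, dom_iff := ?_, le_ptr := ?_,
      of_inactive := fun h' => absurd (h5 ▸ h') ha, of_active := fun _ => ?_ }, ?_, fun i hi => ?_,
      fun i hi hni => ?_, fun g hg => ?_⟩
    · rw [h4]
      exact h.perm_fun
    · rw [h4]
      exact h.perm_inj
    · rw [hdom h4, hs.terminal]
      exact h.dom_iff
    · have := h.le_ptr
      rw [hs.order_eq, h3]
      omega
    · rw [h2, hsinks, hrng h4, hs.budget_eq, hs.order_eq, hs.terminal, hdom h4, h3, hp]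
      exact ⟨hsrc, hTτ, hex⟩
    · rw [Conf.weight, Conf.weight, hdom h4, h5, h3, hs.limit_eq]
      omega
    · simp only [Conf.unread, hdom h4, h3, hs.order_eq] at hi ⊢
      rcases hi with hi | hi
      · exact Or.inl hi
      · exact Or.inr ⟨(Fin.le_def.2 (by omega)).trans hi.1, hi.2⟩
    · rw [hun i hi hni]
      exact Or.inr ⟨h.le_ptr, Or.inl ⟨Fin.lt_def.2 hptr_lt, hb⟩⟩
    · have hgp : g (σ.env ptr) = b := by
        refine hg _ (Or.inr ⟨le_rfl, h.le_ptr⟩) ?_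
        rintro (h' | h')
        · rw [hdom h4] at h'
          exact absurd (h.dom_lt h').1 (not_lt.2 (Fin.le_def.2 h.le_ptr))
        · rw [h3] at h'
          have := Fin.le_def.1 h'.1
          omega
      rw [hbranch, hgp]
  by_cases hvU : U' v
  · obtain ⟨h1, h2, h3, h4, h5, h6, -⟩ := branchRest_spec (p := p)
      (σ := (ρ.setVar vert v).setVar bit 0) (by simpa [f3] using hp)
      (by simpa [f1.zero_eq] using h.zero_eq)
    obtain ⟨h7, h8⟩ := h6 (by simp)
    have hs : SameInput σ _ := (f1.trans (τ := ρ) (ρ := (ρ.setVar vert v).setVar bit 0)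
      ⟨rfl, rfl, by simp, by simp, by simp, by simp, by simp, by simp⟩).trans h1
    have k := key 0 (by simp)
    generalize branchRest.eval ((ρ.setVar vert v).setVar bit 0) = τ at *
    simp [hR, f6] at h7 h8
    have hlive := hs.live h8
    dsimp only at k
    rw [hlive, hdel h8] at k
    refine k hT ⟨S', U', count (bd σ.live (σ.env src) R) + 1, hS', by omega, hU', ?_, hbU', ?_, ?_⟩
    · intro a ha
      rcases (h7 a).1 ha with h' | rfl
      · exact hRU a h'
      · exact hvU
    · intro W hW hnW
      have hRW : ∀ a, R a → W a := fun a ha => hnW a ((h7 a).2 (Or.inl ha))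
      -- Strictness is where the farthest separator is used: a set that contains a vertex of its
      -- boundary has a larger boundary.
      exact (hmin W hW fun a ha => hRW a (hnR a ha)).2 v hv (hnW v ((h7 v).2 (Or.inr rfl)))
    · omega
  · have hone : σ.env one ≠ 0 := fun h' => by
      have := h.one_eq
      rw [h'] at this
      simp at this
    have hvS : S' v := by
      refine hbU' v ⟨hvU, ?_⟩
      rcases hv.2 with h1 | ⟨a, h0, h1⟩
      · exact Or.inl h1
      · exact Or.inr ⟨a, hRU a h0, h1⟩
    obtain ⟨h1, h2, h3, h4, h5, -, h6⟩ := branchRest_spec (p := p)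
      (σ := (ρ.setVar vert v).setVar bit (σ.env one)) (by simpa [f3] using hp)
      (by simpa [f1.zero_eq] using h.zero_eq)
    obtain ⟨h7, h8⟩ := h6 (by simpa using hone)
    have hs : SameInput σ _ := (f1.trans (τ := ρ) (ρ := (ρ.setVar vert v).setVar bit (σ.env one))
      ⟨rfl, rfl, by simp, by simp, by simp, by simp, by simp, by simp⟩).trans h1
    have k := key (σ.env one) h.one_eq.le
    generalize branchRest.eval ((ρ.setVar vert v).setVar bit (σ.env one)) = τ at *
    simp [hR, hdel f6] at h7 h8
    have hlive := hs.live_erase h8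
    have hcd : count (τ.set del) = count (σ.set del) + 1 := by
      rw [← count_add_one hvdel]
      exact count_congr h8
    have hcS := count_sub_one hvS
    dsimp only at k
    rw [hlive, hcd] at k
    refine k (hT.mono (fun _ _ h => h.1) fun _ _ h _ => h)
      -- The bound drops by one while the deletion pays two, which leaves the unit needed for the
      -- bit just read.
      ⟨fun a => S' a ∧ a ≠ v, U', count (bd σ.live (σ.env src) R) - 1, hS'.erase v, by omega,
        hU'.eraseEdge v, fun a ha => hRU a ((h7 a).1 ha), ?_, ?_, ?_⟩
    · intro a ha
      have := bd_eraseEdge ha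
      exact ⟨hbU' a this.1, this.2⟩
    · intro W hW hnW
      have := count_bd_eraseEdge hvs hvT hv.1 (fun U hU hRU => (hmin U hU fun a ha =>
        hRU a (hnR a ha)).1) hW fun a ha => hnW a ((h7 a).2 ha)
      omega
    · omega

/-- Finished configurations are fixed, so a search may be run for a uniform number of steps. -/
theorem Conf.finished.eval_eq [NeZero m] {σ : Conf m} (h0 : σ.env zero = 0) (h : σ.finished)
    (g : Fin m → Fin m) : searchStep.eval (σ.withAdvice g) = σ.withAdvice g := by
  rw [searchStep, Cmd.eval_ite_pos (by simp [Conf.withAdvice, h.1, h0]), begin, Cmd.eval_ite_neg]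
  · rfl
  · simp [Conf.withAdvice]
    intro a b hab
    exact h.2 a ⟨b, hab⟩

theorem SearchInv.exists_advice_of_finished [NeZero m] {σ : Conf m} (h : SearchInv σ)
    (hfin : σ.finished) (N : ℕ) :
    ∃ f : Fin m → Fin m, (∀ i, σ.unread i → σ.admissible i (f i)) ∧
      ∀ g, (∀ i, σ.unread i → g i = f i) →
        ∃ τ, SameInput σ τ ∧ searchStep.eval^[N] (σ.withAdvice g) = τ.withAdvice g ∧
          Hits τ.live (fun _ => False) ∧ count (τ.set del) ≤ (τ.env budget).val := by
  refine ⟨fun _ => 0, fun i hi => ?_, fun g _ => ⟨σ, .refl σ, ?_, ?_, ?_⟩⟩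
  · rcases hi with hi | hi
    · exact absurd hi (hfin.2 i)
    · exact Or.inr ⟨hi.2, Or.inr rfl⟩
  · exact Function.iterate_fixed (hfin.eval_eq h.zero_eq g) N
  -- The remaining terminals meet every cycle, and none remains; so the deleted vertices alone are a
  -- solution.
  · refine (h.of_inactive hfin.1).1.mono (fun _ _ h => h) ?_
    rintro a - ⟨b, hb⟩
    exact absurd ⟨a, hb⟩ (hfin.2 b)
  · obtain ⟨-, S, -, hS, -⟩ := h.of_inactive hfin.1
    omega

theorem SearchInv.step [NeZero m] {σ : Conf m} (h : SearchInv σ) (hfin : ¬ σ.finished) :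
    ∃ τ f, Advances σ τ f := by
  by_cases ha : σ.env active = 0
  · refine h.begin_step ha ?_
    by_contra! hd
    exact hfin ⟨ha, hd⟩
  · exact h.active_step ha

/-- The search finds a solution for some advice. -/
theorem SearchInv.exists_advice [NeZero m] {σ : Conf m} (h : SearchInv σ) {N : ℕ}
    (hN : σ.weight ≤ N) : ∃ f : Fin m → Fin m, (∀ i, σ.unread i → σ.admissible i (f i)) ∧
      ∀ g, (∀ i, σ.unread i → g i = f i) →
        ∃ τ, SameInput σ τ ∧ searchStep.eval^[N] (σ.withAdvice g) = τ.withAdvice g ∧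
          Hits τ.live (fun _ => False) ∧ count (τ.set del) ≤ (τ.env budget).val := by
  induction N generalizing σ with
  | zero =>
    by_cases hfin : σ.finished
    · exact h.exists_advice_of_finished hfin 0
    · obtain ⟨τ, f, hA⟩ := h.step hfin
      have := hA.weight_lt
      omega
  | succ N ih =>
    by_cases hfin : σ.finished
    · exact h.exists_advice_of_finished hfin _
    obtain ⟨τ, f, hA⟩ := h.step hfin
    have := hA.weight_lt
    obtain ⟨f', hf', ih⟩ := ih hA.inv (by omega)
    classical
    -- No position is read twice: what the first step consumes follows `f`, and what is still unread
    -- afterwards follows the advice for the rest.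
    refine ⟨fun i => if τ.unread i then f' i else f i, fun i hi => ?_, fun g hg => ?_⟩
    · dsimp only
      split_ifs with h'
      · have := hf' i h'
        rwa [Conf.admissible, hA.same.order_eq, hA.same.terminal, hA.same.limit_eq] at this
      · exact hA.admissible i hi h'
    · obtain ⟨ρ, h1, h2, h3, h4⟩ := ih g fun i hi => by
        exact (hg i (hA.unread i hi)).trans (if_pos hi)
      refine ⟨ρ, hA.same.trans h1, ?_, h3, h4⟩
      rw [Function.iterate_succ_apply, hA.eval_eq, h2]
      intro i hi hni
      exact (hg i hi).trans (if_neg hni)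

end DFVS

namespace DFVS
open DFVS.Var DFVS.Rel
variable {m : ℕ}

/-! ### A complete search with given advice -/

/-- Assign zero to all variables in the list. -/
def clearVars : List Var → Cmd
  | [] => .skip
  | v :: l => .seq (.pick v (.eq v zero)) (clearVars l)

/-- Assign the empty relation to all names in the list. -/
def clearRels : List Rel → Cmd
  | [] => .skip
  | r :: l => .seq (.assign r .bot) (clearRels l)

theorem eval_clearVars [NeZero m] {l : List Var} (hl : zero ∉ l) (σ : Conf m) :
    (clearVars l).eval σ = ⟨fun v => if v ∈ l then σ.env zero else σ.env v, σ.rel⟩ := by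
  induction l generalizing σ with
  | nil => simp [clearVars, Cmd.eval]
  | cons v l ih =>
    simp only [List.mem_cons, not_or] at hl
    rw [clearVars, Cmd.eval_seq, ih hl.2, Cmd.eval_pick]
    refine Conf.ext' (funext fun w => ?_) rfl
    by_cases hw : w ∈ l <;> by_cases hv : w = v <;> simp [hl.1, hw, hv]

theorem eval_clearRels [NeZero m] {l : List Rel} (σ : Conf m) :
    (clearRels l).eval σ = ⟨σ.env, fun r => if r ∈ l then fun _ _ => False else σ.rel r⟩ := by
  induction l generalizing σ with
  | nil => simp [clearRels, Cmd.eval]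
  | cons r l ih =>
    rw [clearRels, Cmd.eval_seq, ih]
    refine Conf.ext' rfl (funext fun q => ?_)
    by_cases hq : q ∈ l <;> by_cases hr : q = r <;> simp [Cmd.eval, hq, hr]

/-- The variables that are cleared before a search. -/
def workVars : List Var :=
  [x, y, z, u, pos, src, ptr, bit, digit, vert, tok, side, walking, lvl, lvl', tmp, active, .count,
    halt, found]

/-- The relations that are cleared before a search. -/
def workRels : List Rel :=
  [del, perm, .inner, alive, start, term, used, arc, first, last, lin, lout, sink, rest, near, far]

/-- Clear everything but the input of the search. -/
def resetAll : Cmd := .seq (clearVars workVars) (clearRels workRels)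

/-- The cleared configuration. -/
def Conf.reset (σ : Conf m) : Conf m :=
  ⟨fun v => if v ∈ workVars then σ.env zero else σ.env v,
    fun r => if r ∈ workRels then fun _ _ => False else σ.rel r⟩

theorem eval_resetAll [NeZero m] (σ : Conf m) : resetAll.eval σ = σ.reset := by
  rw [resetAll, Cmd.eval_seq, eval_clearVars (by simp [workVars]), eval_clearRels]
  rfl

theorem sameInput_reset (σ : Conf m) : SameInput σ σ.reset := by
  constructor <;> simp [Conf.reset, workVars, workRels]

theorem SameInput.reset_eq {σ τ : Conf m} (h : SameInput σ τ) (ha : τ.rel allowed = σ.rel allowed)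
    (hd : τ.rel advice = σ.rel advice) : τ.reset = σ.reset := by
  refine Conf.ext' (funext fun v => ?_) (funext fun r => ?_)
  · cases v <;> simp [Conf.reset, workVars, h.zero_eq, h.one_eq, h.iter_eq, h.order_eq,
      h.budget_eq, h.limit_eq]
  · cases r <;> simp [Conf.reset, workRels, ha, hd, h.sol_eq, h.edge_eq]

/-- Initialize the search. -/
def initSearch : Cmd :=
  .seq (.assign perm <| .and (.eq x y) <| .or (.rel sol x x) (.eq x iter))
    (.pick ptr (.eq ptr order))

/-- The search. -/
def trial : Cmd := .seq resetAll <| .seq initSearch <| .rep searchStep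

/-- The configuration in which the search starts. -/
def Conf.initial (σ : Conf m) : Conf m :=
  (σ.reset.setRel perm fun a b => a = b ∧ σ.terminal a).setVar ptr (σ.env order)

theorem eval_trial [NeZero m] (σ : Conf m) : trial.eval σ = searchStep.eval^[m] σ.initial := by
  rw [trial, Cmd.eval_seq, eval_resetAll, Cmd.eval_seq, Cmd.eval_rep]
  congr 1
  rw [initSearch, Cmd.eval_seq, Cmd.eval_pick]
  simp [Cmd.eval, Conf.initial, Conf.reset, workVars, workRels, Conf.terminal, Conf.set]

theorem initial_withAdvice (σ : Conf m) (f : Fin m → Fin m) :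
    (σ.withAdvice f).initial = σ.initial.withAdvice f := by
  refine Conf.ext' rfl (funext fun r => ?_)
  cases r <;> simp [Conf.initial, Conf.withAdvice, Conf.reset, workRels, Conf.terminal]

theorem sameInput_initial (σ : Conf m) : SameInput σ σ.initial :=
  (sameInput_reset σ).trans (by constructor <;> simp [Conf.initial, Conf.reset, workVars])

theorem modRel_trial {r : Rel} (h : trial.ModRel r) :
    r ≠ sol ∧ r ≠ edge ∧ r ≠ allowed ∧ r ≠ advice := by
  refine ⟨?_, ?_, ?_, ?_⟩ <;> rintro rfl <;>
  simp [trial, resetAll, clearVars, clearRels, workRels, workVars, initSearch, searchStep, begin,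
    beginRest, branch, branchRest, nextBit, separate, maxFlow, augment, levels, levelOut, levelIn,
    walkStep, walkEnd, walkIn, walkOut, Cmd.ModRel] at h

theorem modVar_trial {v : Var} (h : trial.ModVar v) :
    v ≠ zero ∧ v ≠ one ∧ v ≠ iter ∧ v ≠ order ∧ v ≠ budget ∧ v ≠ limit := by
  refine ⟨?_, ?_, ?_, ?_, ?_, ?_⟩ <;> rintro rfl <;>
  simp [trial, resetAll, clearVars, clearRels, workRels, workVars, initSearch, searchStep, begin,
    beginRest, branch, branchRest, nextBit, separate, maxFlow, augment, levels, levelOut, levelIn,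
    walkStep, walkEnd, walkIn, walkOut, Cmd.ModVar] at h

theorem sameInput_trial [NeZero m] (σ : Conf m) : SameInput σ (trial.eval σ) :=
  Cmd.sameInput σ (fun h => (modRel_trial h).1 rfl) (fun h => (modRel_trial h).2.1 rfl)
    fun _ h => modVar_trial h

/-- The edges between the first vertices. -/
def Conf.edgeLE (σ : Conf m) (a b : Fin m) : Prop :=
  σ.rel edge a b ∧ a ≤ σ.env iter ∧ b ≤ σ.env iter

/-- The search succeeds with the advice. -/
def Conf.Success [NeZero m] (σ : Conf m) (f : Fin m → Fin m) : Prop :=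
  Hits (trial.eval (σ.withAdvice f)).live (fun _ => False) ∧
    count ((trial.eval (σ.withAdvice f)).set del) ≤ (σ.env budget).val

/-- A trial begins by clearing all its work space. Hence success is a property of the task and the
advice and does not depend on what earlier trials left behind. -/
theorem SameInput.success [NeZero m] {σ τ : Conf m} (h : SameInput σ τ)
    (ha : τ.rel allowed = σ.rel allowed) {f : Fin m → Fin m} (hf : σ.Success f) : τ.Success f := by
  have : trial.eval (τ.withAdvice f) = trial.eval (σ.withAdvice f) := by
    simp only [trial, Cmd.eval_seq resetAll, eval_resetAll]
    refine congrArg _ (SameInput.reset_eq ?_ ?_ ?_)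
    · obtain ⟨h1, h2, h3, h4, h5, h6, h7, h8⟩ := h
      constructor <;> simpa [Conf.withAdvice]
    · simpa [Conf.withAdvice]
    · simp [Conf.withAdvice]
  rwa [Conf.Success, this, h.budget_eq]

/-- Completeness of the enumeration: the initial configuration satisfies `SearchInv`, with the
identity on the terminals as `perm`. Positions that are never read get the value `0`, so that the
advice is admissible everywhere. -/
theorem Ground.exists_success [NeZero m] {σ : Conf m} (h : Ground σ)
    (hT : Hits σ.edgeLE σ.terminal) (hS : ∃ S, Hits σ.edgeLE S ∧ count S ≤ (σ.env budget).val) :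
    ∃ f : Fin m → Fin m, (∀ i, σ.admissible i (f i)) ∧ σ.Success f := by
  have hs := sameInput_initial σ
  have hdel : ∀ a, ¬ σ.initial.set del a := fun a => by
    simp [Conf.set, Conf.initial, Conf.reset, workRels]
  have hlive : ∀ a b, σ.initial.live a b → σ.edgeLE a b := fun a b h => by
    rw [Conf.live, hs.edge_eq, hs.iter_eq] at h
    exact ⟨h.1, h.2.1, h.2.2.1⟩
  have hperm : σ.initial.rel perm = fun a b => a = b ∧ σ.terminal a := by
    simp [Conf.initial]
  have hdom : σ.initial.dom = σ.terminal := by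
    ext a
    simp [Conf.dom, hperm]
  have hrng : σ.initial.rng = σ.terminal := by
    ext a
    simp [Conf.rng, hperm]
  have hcd : count (σ.initial.set del) = 0 := count_eq_zero.2 hdel
  have hptr : σ.initial.env ptr = σ.env order := by simp [Conf.initial]
  have hact : σ.initial.env active = 0 := by
    simp [Conf.initial, Conf.reset, workVars, h.zero_eq]
  have hinv : SearchInv σ.initial :=
    { hs.ground h with
      perm_fun := by
        rw [hperm]
        rintro a b b' ⟨rfl, -⟩ ⟨rfl, -⟩
        rfl
      perm_inj := by
        rw [hperm]
        rintro a a' b ⟨rfl, -⟩ ⟨rfl, -⟩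
        rfl
      dom_iff := ⟨m, fun a => by rw [hdom, hs.terminal]; simp⟩
      le_ptr := by rw [hptr, hs.order_eq]
      of_inactive := fun _ => by
        rw [hdom, hrng, hcd, hptr, hs.order_eq, hs.terminal, hs.budget_eq]
        obtain ⟨S, hS, hc⟩ := hS
        exact ⟨hT.mono hlive fun _ _ h _ => h, S, hS.mono hlive fun _ _ h _ => h, by omega,
          by omega⟩
      of_active := fun h => absurd hact h }
  -- The weight is at most `2 * (k + 1) + 3 * k + 1`, which is below `8 * n` and thus below `m`, the
  -- number of repetitions in `trial`.
  obtain ⟨f, hf, hg⟩ := hinv.exists_advice (N := m) (by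
    rw [Conf.weight, if_pos hact, hdom, hptr, hs.limit_eq]
    have h1 := h.terminal_count
    have h2 := h.limit_eq
    have h3 := h.size
    have h4 := h.budget_lt
    omega)
  classical
  obtain ⟨τ, h1, h2, h3, h4⟩ := hg (fun i => if σ.initial.unread i then f i else 0)
    fun i hi => if_pos hi
  refine ⟨fun i => if σ.initial.unread i then f i else 0, fun i => ?_, ?_⟩
  · dsimp only
    split_ifs with hi
    · have := hf i hi
      rwa [Conf.admissible, hs.order_eq, hs.terminal, hs.limit_eq] at this
    · rw [Conf.unread, hdom, hptr, hs.order_eq] at hi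
      push Not at hi
      by_cases hio : i < σ.env order
      · exact Or.inl ⟨hio, Or.inr ⟨hi.1, rfl⟩⟩
      · exact Or.inr ⟨not_lt.1 hio, Or.inr rfl⟩
  · rw [Conf.Success, eval_trial, initial_withAdvice, h2]
    rw [(hs.trans h1).budget_eq] at h4
    refine ⟨?_, ?_⟩
    · convert h3 using 1
      ext a b
      simp [Conf.live, Conf.withAdvice]
    · simpa [Conf.withAdvice] using h4

end DFVS

namespace DFVS
open DFVS.Var DFVS.Rel
variable {m : ℕ}

/-! ### Checking the result of a search -/

/-- Remove the vertices without successor from `rest`. -/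
def prune : Cmd := .assign rest <| .and (.rel rest x x) (.ex y <| .and (.rel rest y y) (.rel edge x y))

/-- Compute the vertices from which a cycle of live edges can be reached. -/
def core : Cmd := .seq (.assign rest <| .and (.le x iter) (.neg (.rel del x x))) (.rep prune)

/-- Remove a vertex from `rest` and decrement the counter. -/
def discard : Cmd :=
  .ite (.and (.neg (.eq .count zero)) (.ex x <| .rel rest x x))
    (.seq (.pick vert (.rel rest vert vert)) <|
      .seq (.assign rest <| .and (.rel rest x x) (.neg (.eq x vert))) <|
      .seq (.pick tmp (.eq tmp .count)) (.pick .count (.isPred .count tmp))) .skip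

/-- Remove as many vertices from `del` as the budget allows. -/
def tally : Cmd :=
  .seq (.assign rest (.rel del x x)) <| .seq (.pick .count (.eq .count budget)) (.rep discard)

/-- Check the result of the search. -/
def verdict : Cmd :=
  .seq core <| .ite (.ex x <| .rel rest x x) (.pick bit (.eq bit zero)) <|
  .seq tally <| .ite (.ex x <| .rel rest x x) (.pick bit (.eq bit zero)) (.pick bit (.eq bit one))

/-- A set in which every vertex has a live successor survives all prunings. If there is no nonempty
one, each pruning of a nonempty `rest` removes a vertex, and there are fewer than `m` to begin with.
-/
theorem core_spec [NeZero m] {σ : Conf m} (h : (σ.env iter).val + 1 < m) :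
    (∀ a, ¬ (core.eval σ).set rest a) ↔ Hits σ.live fun _ => False := by
  set σ₁ := Cmd.eval (.assign rest <| .and (.le x iter) (.neg (.rel del x x))) σ with hσ₁
  have hrest : ∀ a, σ₁.set rest a ↔ a ≤ σ.env iter ∧ ¬ σ.set del a := fun a => by
    simp [hσ₁, Cmd.eval, Conf.set]
  have hev : core.eval σ = prune.eval^[m] σ₁ := rfl
  have hprune : ∀ τ : Conf m, ∀ a, (prune.eval τ).set rest a ↔
      τ.set rest a ∧ ∃ b, τ.set rest b ∧ τ.rel edge a b := fun τ a => by
    simp [prune, Cmd.eval, Conf.set]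
  have hedge : ∀ τ : Conf m, (prune.eval τ).rel edge = τ.rel edge := fun τ =>
    Cmd.eval_rel (by simp [prune, Cmd.ModRel]) τ
  constructor
  · intro hempty Y hY a ha
    refine hempty a ?_
    rw [hev]
    refine (iterate_induction (F := prune.eval) (a := σ₁) (I := fun _ τ => τ.rel edge = σ.rel edge ∧
      ∀ a, Y a → τ.set rest a) ⟨rfl, fun a ha => ?_⟩ (fun _ τ ⟨h1, h2⟩ => ⟨?_, fun a ha => ?_⟩)
      m).2 a ha
    · obtain ⟨-, z, -, hz⟩ := hY a ha
      exact (hrest a).2 ⟨hz.2.1, hz.2.2.2.1⟩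
    · rw [hedge, h1]
    · obtain ⟨-, z, hz, haz⟩ := hY a ha
      rw [hprune, h1]
      exact ⟨h2 a ha, z, h2 z hz, haz.1⟩
  · intro hH
    refine (iterate_reaches (F := prune.eval) (a := σ₁) (I := fun τ => τ.rel edge = σ.rel edge ∧
      ∀ a, τ.set rest a → σ₁.set rest a) (G := fun τ => ∀ a, ¬ τ.set rest a)
      (μ := fun τ => count (τ.set rest)) (fun τ ⟨h1, h2⟩ => ⟨?_, fun a ha => ?_⟩)
      (fun τ _ hG a ha => ?_) (fun τ ⟨h1, h2⟩ hG => Or.inr ?_) ⟨rfl, fun _ h => h⟩ ?_).2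
    · rw [hedge, h1]
    · exact h2 a ((hprune τ a).1 ha).1
    · exact hG a ((hprune τ a).1 ha).1
    · obtain ⟨a, ha, hn⟩ : ∃ a, τ.set rest a ∧ ∀ b, τ.set rest b → ¬ τ.rel edge a b := by
        by_contra! hcon
        refine hG fun a ha => hH (τ.set rest) (fun a ha => ⟨id, ?_⟩) a ha
        obtain ⟨b, hb, hab⟩ := hcon a ha
        have h3 := (hrest a).1 (h2 a ha)
        have h4 := (hrest b).1 (h2 b hb)
        exact ⟨b, hb, h1 ▸ hab, h3.1, h4.1, h3.2, h4.2⟩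
      have h3 := count_sub_one ha
      have h4 : count ((prune.eval τ).set rest) ≤ count fun b => τ.set rest b ∧ b ≠ a :=
        count_mono fun b hb => by
          obtain ⟨h5, c, h6, h7⟩ := (hprune τ b).1 hb
          refine ⟨h5, ?_⟩
          rintro rfl
          exact hn c h6 h7
      omega
    · refine lt_of_le_of_lt (count_mono (q := fun a => a ≤ σ.env iter) fun a ha => ((hrest a).1 ha).1) ?_
      rw [count_le_val]
      exact h

/-- Cardinalities are compared by removing one vertex per unit of the counter: the sum of `count
rest` and the spent budget is invariant until one of the two runs out. -/
theorem tally_spec [NeZero m] {σ : Conf m} (h0 : σ.env zero = 0) :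
    (∀ a, ¬ (tally.eval σ).set rest a) ↔ count (σ.set del) ≤ (σ.env budget).val := by
  set σ₁ := Cmd.eval (.pick .count (.eq .count budget)) (Cmd.eval (.assign rest (.rel del x x)) σ)
    with hσ₁
  have hrest : σ₁.set rest = σ.set del := by
    ext a
    simp [hσ₁, Cmd.eval, Conf.set]
  have hcount : σ₁.env .count = σ.env budget := by
    simp [hσ₁, Cmd.eval]
  have hzero : σ₁.env zero = 0 := by
    simp [hσ₁, Cmd.eval, h0]
  have hev : tally.eval σ = discard.eval^[m] σ₁ := rfl
  have hskip : ∀ τ : Conf m, τ.env zero = 0 → ((∀ a, ¬ τ.set rest a) ∨ τ.env .count = 0) →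
      discard.eval τ = τ := fun τ h0 h => by
    rw [discard, Cmd.eval_ite_neg]
    · rfl
    · simp [h0]
      intro hne a
      exact h.resolve_right hne a
  have hstep : ∀ τ : Conf m, τ.env zero = 0 → ¬ ((∀ a, ¬ τ.set rest a) ∨ τ.env .count = 0) →
      (discard.eval τ).env zero = 0 ∧
      ((discard.eval τ).env .count).val + 1 = (τ.env .count).val ∧
      count ((discard.eval τ).set rest) + 1 = count (τ.set rest) := fun τ h0 h => by
    push Not at h
    obtain ⟨hex, hne⟩ := h
    have hspec := least_spec hex
    rw [discard, Cmd.eval_ite_pos (by simpa [h0, hne, Conf.set] using hex), Cmd.eval_seq, Cmd.eval_pick]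
    have e : (fun a => (Fm.rel rest vert vert).Sat (τ.setVar vert a)) = τ.set rest := by
      ext a
      simp [Conf.set]
    rw [e]
    obtain ⟨e, he⟩ : ∃ e, (τ.env .count).val = e + 1 :=
      ⟨(τ.env .count).val - 1, by have := Fin.val_ne_zero_iff.2 hne; omega⟩
    refine ⟨?_, ?_, ?_⟩
    · simp [Cmd.eval, h0]
    · have : (least fun a : Fin m => a.val + 1 = (τ.env .count).val).val = e := by
        rw [least_isPred he]
      simp only [he, add_left_inj] at this
      simp [Cmd.eval, Fm.sat_isPred, he, this]
    · rw [← count_sub_one hspec]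
      congr 1
  have key := iterate_reaches (F := discard.eval) (a := σ₁) (I := fun τ => τ.env zero = 0 ∧
    (τ.env .count).val ≤ (σ.env budget).val ∧
    count (τ.set rest) + (σ.env budget).val = count (σ.set del) + (τ.env .count).val)
    (G := fun τ => (∀ a, ¬ τ.set rest a) ∨ τ.env .count = 0) (μ := fun τ => (τ.env .count).val) (N := m)
    (fun τ ⟨h1, h2, h3⟩ => by
      by_cases hG : (∀ a, ¬ τ.set rest a) ∨ τ.env .count = 0
      · rw [hskip τ h1 hG]
        exact ⟨h1, h2, h3⟩
      · obtain ⟨h4, h5, h6⟩ := hstep τ h1 hG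
        exact ⟨h4, by omega, by omega⟩)
    (fun τ ⟨h1, h2, h3⟩ hG => by rwa [hskip τ h1 hG])
    (fun τ ⟨h1, h2, h3⟩ hG => Or.inr <| by
      obtain ⟨h4, h5, h6⟩ := hstep τ h1 hG
      omega)
    ⟨hzero, by rw [hcount], by rw [hcount, hrest]⟩ (σ₁.env .count).2
  rw [hev]
  obtain ⟨⟨-, h2, h3⟩, h4⟩ := key
  generalize discard.eval^[m] σ₁ = τ at *
  rcases h4 with h4 | h4
  · have := count_eq_zero.2 h4
    exact ⟨fun _ => by omega, fun _ => h4⟩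
  · rw [← count_eq_zero]
    simp only [h4, Fin.val_zero] at h3
    omega

theorem modRel_verdict {r : Rel} (h : verdict.ModRel r) : r = rest := by
  simpa [verdict, core, tally, prune, discard, Cmd.ModRel] using h

theorem modVar_verdict {v : Var} (h : verdict.ModVar v) :
    v = bit ∨ v = tmp ∨ v = vert ∨ v = .count := by
  simp [verdict, core, tally, prune, discard, Cmd.ModVar] at h
  tauto

theorem sameInput_verdict [NeZero m] (σ : Conf m) : SameInput σ (verdict.eval σ) := by
  refine Cmd.sameInput σ (fun h => ?_) (fun h => ?_) fun v hv => ?_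
  · simpa using modRel_verdict h
  · simpa using modRel_verdict h
  · rcases modVar_verdict hv with rfl | rfl | rfl | rfl <;> simp

theorem verdict_spec [NeZero m] {σ : Conf m} (h : Ground σ) :
    (verdict.eval σ).env bit ≠ 0 ↔ Hits σ.live (fun _ => False) ∧
      count (σ.set del) ≤ (σ.env budget).val := by
  have hone : σ.env one ≠ 0 := fun h' => by
    have := h.one_eq
    rw [h'] at this
    simp at this
  have hcore := core_spec (σ := σ) (by
    have h1 := h.iter_lt
    have h2 := h.size
    omega)
  have hr : ∀ r, r ≠ rest → (core.eval σ).rel r = σ.rel r := fun r hr =>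
    Cmd.eval_rel (by simpa [core, prune, Cmd.ModRel] using hr) σ
  have hv : ∀ v, (core.eval σ).env v = σ.env v := fun v =>
    Cmd.eval_env (by simp [core, prune, Cmd.ModVar]) σ
  have hv' : ∀ τ : Conf m, ∀ v, v ≠ vert → v ≠ tmp → v ≠ .count →
      (tally.eval τ).env v = τ.env v := fun τ v h1 h2 h3 =>
    Cmd.eval_env (by simp [tally, discard, Cmd.ModVar, h1, h2, h3]) τ
  have htally := tally_spec (σ := core.eval σ) (by rw [hv, h.zero_eq])
  have hdel : (core.eval σ).set del = σ.set del := by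
    ext a
    rw [Conf.set, hr del (by simp)]
    rfl
  rw [hdel, hv] at htally
  rw [verdict, Cmd.eval_seq, ← hcore, ← htally]
  have hsat : ∀ τ : Conf m, (Fm.ex x <| .rel rest x x).Sat τ ↔ ¬ ∀ a, ¬ τ.set rest a := fun τ => by
    simp [Conf.set]
  by_cases h1 : ∀ a, ¬ (core.eval σ).set rest a
  · rw [Cmd.eval_ite_neg (by simpa [hsat] using h1), Cmd.eval_seq]
    by_cases h2 : ∀ a, ¬ (tally.eval (core.eval σ)).set rest a
    · rw [Cmd.eval_ite_neg (by simpa [hsat] using h2), Cmd.eval_pick]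
      simp [hv, hv', hone]
      exact ⟨h1, h2⟩
    · rw [Cmd.eval_ite_pos (by rw [hsat]; exact h2), Cmd.eval_pick]
      simp only [Fm.sat_eq, Conf.setVar_env, if_true, reduceCtorEq, if_false, least_eq_left]
      rw [hv' _ _ (by simp) (by simp) (by simp), hv, h.zero_eq]
      simp only [ne_eq, not_true_eq_false, false_iff]
      exact fun h' => h2 h'.2
  · rw [Cmd.eval_ite_pos (by rw [hsat]; exact h1), Cmd.eval_pick]
    simp only [Fm.sat_eq, Conf.setVar_env, if_true, reduceCtorEq, if_false, least_eq_left]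
    rw [hv, h.zero_eq]
    simp only [ne_eq, not_true_eq_false, false_iff]
    exact fun h' => h1 h'.1

end DFVS

namespace DFVS
open DFVS.Var DFVS.Rel
variable {m : ℕ}

/-! ### The lexicographic order of the advice -/

section Odometer
variable {A : Fin m → Fin m → Prop} {g : Fin m → Fin m}

theorem toLex_lt_iff {g f : Fin m → Fin m} :
    toLex g < toLex f ↔ ∃ i, (∀ j < i, g j = f j) ∧ g i < f i := Iff.rfl

open Classical in
/-- Increase the position `j` as little as possible and minimize all later positions. -/
noncomputable def increment [NeZero m] (A : Fin m → Fin m → Prop) (g : Fin m → Fin m) (j i : Fin m) :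
    Fin m :=
  if i < j then g i else if i = j then least fun a => A j a ∧ g j < a else least (A i)

theorem increment_mem [NeZero m] (hA : ∀ i, ∃ a, A i a) (hg : ∀ i, A i (g i)) {j : Fin m}
    (hj : ∃ a, A j a ∧ g j < a) (i : Fin m) : A i (increment A g j i) := by
  unfold increment
  split_ifs with h1 h2
  · exact hg i
  · subst h2
    exact (least_spec hj).1
  · exact least_spec (hA i)

theorem lt_increment [NeZero m] {j : Fin m} (hj : ∃ a, A j a ∧ g j < a) :
    toLex g < toLex (increment A g j) := by
  refine toLex_lt_iff.2 ⟨j, fun i hi => by simp [increment, hi], ?_⟩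
  simpa [increment] using (least_spec hj).2

/-- Compare `f` with `g` at their first difference `i`. Before `j`, the increment still agrees with
`g` and `f` is larger; at `j`, the increment takes the least larger value and then least values
throughout; beyond `j`, no admissible value is larger. -/
theorem increment_le [NeZero m] {j : Fin m} (hmax : ∀ i, j < i → ¬ ∃ a, A i a ∧ g i < a)
    {f : Fin m → Fin m} (hf : ∀ i, A i (f i)) (hgf : toLex g < toLex f) :
    toLex (increment A g j) ≤ toLex f := by
  obtain ⟨i, hi, hlt⟩ := toLex_lt_iff.1 hgf
  rcases lt_trichotomy i j with h | rfl | h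
  · refine le_of_lt (toLex_lt_iff.2 ⟨i, fun l hl => ?_, ?_⟩)
    · rw [increment, if_pos (hl.trans h), hi l hl]
    · rwa [increment, if_pos h]
  · refine Pi.toLex_monotone fun l => ?_
    rcases lt_trichotomy l i with hl | rfl | hl
    · rw [increment, if_pos hl, hi l hl]
    · rw [increment, if_neg (lt_irrefl _), if_pos rfl]
      exact least_le ⟨hf l, hlt⟩
    · rw [increment, if_neg hl.not_gt, if_neg hl.ne']
      exact least_le (hf l)
  · exact absurd ⟨f i, hf i, hlt⟩ (hmax i h)

theorem not_lt_of_maximal (hmax : ∀ i, ¬ ∃ a, A i a ∧ g i < a) {f : Fin m → Fin m}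
    (hf : ∀ i, A i (f i)) : ¬ toLex g < toLex f := by
  intro h
  obtain ⟨i, -, hlt⟩ := toLex_lt_iff.1 h
  exact hmax i ⟨f i, hf i, hlt⟩

/-- The number of admissible sequences that are not before `g`. -/
noncomputable def remaining (A : Fin m → Fin m → Prop) (g : Fin m → Fin m) : ℕ :=
  count fun f : Fin m → Fin m => (∀ i, A i (f i)) ∧ toLex g ≤ toLex f

theorem remaining_pos (hg : ∀ i, A i (g i)) : 0 < remaining A g :=
  count_pos.2 ⟨g, hg, le_rfl⟩

theorem remaining_lt {g' : Fin m → Fin m} (hg : ∀ i, A i (g i)) (h : toLex g < toLex g') :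
    remaining A g' < remaining A g := by
  have h1 := count_sub_one (p := fun f : Fin m → Fin m => (∀ i, A i (f i)) ∧ toLex g ≤ toLex f)
    (x := g) ⟨hg, le_rfl⟩
  have h2 : remaining A g' ≤ count fun f : Fin m → Fin m =>
      ((∀ i, A i (f i)) ∧ toLex g ≤ toLex f) ∧ f ≠ g := count_mono fun f hf => by
    refine ⟨⟨hf.1, h.le.trans hf.2⟩, ?_⟩
    rintro rfl
    exact absurd h (not_lt.2 hf.2)
  unfold remaining at *
  omega

theorem remaining_le (A : Fin m → Fin m → Prop) (g : Fin m → Fin m) :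
    remaining A g ≤ ∏ i, count (A i) := by
  classical
  refine (count_mono (q := fun f : Fin m → Fin m => ∀ i, A i (f i)) fun f hf => hf.1).trans ?_
  rw [count_eq_card]
  have : (Finset.univ.filter fun f : Fin m → Fin m => ∀ i, A i (f i)) =
      Fintype.piFinset fun i => Finset.univ.filter (A i) := by
    ext f
    simp
  rw [this, Fintype.card_piFinset]
  exact (Finset.prod_congr rfl fun i _ => (count_eq_card _).symm).le

end Odometer

/-- Induction on the maximum: it contributes the full cardinality and is invisible to the other
factors. This product is the number of ways to draw the terminals. -/
theorem prod_card_filter_le {α : Type*} [LinearOrder α] (W : Finset α) :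
    ∏ w ∈ W, (W.filter fun x => x ≤ w).card = W.card.factorial := by
  induction W using Finset.induction_on_max with
  | empty => simp
  | insert a W ha ih =>
    have hn : a ∉ W := fun h => lt_irrefl _ (ha a h)
    rw [Finset.prod_insert hn, Finset.card_insert_of_notMem hn, Nat.factorial_succ, ← ih]
    congr 1
    · rw [← Finset.card_insert_of_notMem hn, Finset.filter_true_of_mem]
      intro x hx
      rcases Finset.mem_insert.1 hx with rfl | hx
      · exact le_rfl
      · exact (ha x hx).le
    · refine Finset.prod_congr rfl fun w hw => ?_
      rw [Finset.filter_insert, if_neg (not_le.2 (ha w hw))]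

/-- The number of sequences of advice. -/
theorem Ground.prod_admissible_le [NeZero m] {σ : Conf m} (h : Ground σ) :
    ∏ i, count (σ.admissible i) ≤
      ((σ.env budget).val + 1).factorial * 2 ^ (3 * (σ.env budget).val + 1) := by
  classical
  set W := Finset.univ.filter σ.terminal with hW
  set B := Finset.univ.filter fun i => σ.env order ≤ i ∧ i < σ.env limit with hB
  have hlt : ∀ i, σ.terminal i → i < σ.env order := fun i hi =>
    lt_of_le_of_lt (h.terminal_le i hi) h.iter_lt
  -- A terminal position has one value for each terminal up to it, each of the `3 * k + 1` bit
  -- positions has at most two, and every other position only `0`.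
  have hle : ∀ i, count (σ.admissible i) ≤
      (if i ∈ W then (W.filter fun x => x ≤ i).card else 1) * (if i ∈ B then 2 else 1) := by
    intro i
    have hz : count (fun a : Fin m => a.val = 0) = 1 := by
      rw [← count_eq (0 : Fin m)]
      exact count_congr fun a => by rw [← Fin.val_eq_zero_iff]
    by_cases hio : i < σ.env order
    · have hB' : i ∉ B := by
        simp only [hB, Finset.mem_filter, not_and]
        exact fun _ h' _ => absurd hio (not_lt.2 h')
      rw [if_neg hB', mul_one]
      by_cases hT : σ.terminal i
      · have hiW : i ∈ W := by simpa [hW] using hT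
        rw [if_pos hiW, hW, Finset.filter_filter, ← count_eq_card]
        refine count_mono fun a ha => ?_
        rcases ha with ⟨-, ha | ha⟩ | ha
        · exact ha.2
        · exact absurd hT ha.1
        · exact absurd hio (not_lt.2 ha.1)
      · have hiW : i ∉ W := by simpa [hW] using hT
        rw [if_neg hiW, ← hz]
        refine count_mono fun a ha => ?_
        rcases ha with ⟨-, ha | ha⟩ | ha
        · exact absurd ha.1 hT
        · exact ha.2
        · exact absurd hio (not_lt.2 ha.1)
    · have hiW : i ∉ W := fun h' => hio (hlt i (by simpa [hW] using h'))
      rw [if_neg hiW, one_mul]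
      by_cases his : i < σ.env limit
      · have hiB : i ∈ B := by simpa [hB] using ⟨not_lt.1 hio, his⟩
        rw [if_pos hiB]
        have h1 := count_le_val (σ.env one)
        rw [h.one_eq] at h1
        refine le_trans ?_ h1.le
        refine count_mono fun a ha => ?_
        rw [Fin.le_def, h.one_eq]
        rcases ha with ha | ⟨-, ha | ha⟩
        · exact absurd ha.1 hio
        · exact ha.2
        · omega
      · have hiB : i ∉ B := by
          simp only [hB, Finset.mem_filter, not_and]
          exact fun _ _ h' => his h'
        rw [if_neg hiB, ← hz]
        refine count_mono fun a ha => ?_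
        rcases ha with ha | ⟨-, ha | ha⟩
        · exact absurd ha.1 hio
        · exact absurd ha.1 his
        · exact ha
  refine (Finset.prod_le_prod' fun i _ => hle i).trans ?_
  rw [Finset.prod_mul_distrib, Finset.prod_ite_mem, Finset.prod_ite_mem, Finset.univ_inter,
    Finset.univ_inter, prod_card_filter_le, Finset.prod_const]
  refine Nat.mul_le_mul (Nat.factorial_le ?_) (Nat.pow_le_pow_right (by norm_num) ?_)
  · rw [hW, ← count_eq_card]
    exact h.terminal_count
  · have h1 : B ⊆ Finset.Ico (σ.env order) (σ.env limit) := fun i hi => by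
      simpa [hB] using hi
    refine (Finset.card_le_card h1).trans ?_
    rw [Fin.card_Ico, h.limit_eq]
    omega

end DFVS

namespace DFVS
open DFVS.Var DFVS.Rel
variable {m : ℕ}

/-! ### The main loop -/

/-- The vertex is a terminal. -/
def terminalFm (v : Var) : Fm := .or (.rel sol v v) (.eq v iter)

/-- The value `y` is allowed at the position `x`. -/
def admissibleFm : Fm :=
  .or (.and (.lt x order) <| .or (.and (terminalFm x) (.and (terminalFm y) (.le y x)))
      (.and (.neg (terminalFm x)) (.eq y zero))) <|
    .and (.le order x) <| .or (.and (.lt x limit) (.or (.eq y zero) (.eq y one))) (.eq y zero)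

/-- `y` is the first value that is allowed at the position `x`. -/
def firstFm : Fm := .and (.rel allowed x y) (.neg (.ex z (.and (.lt z y) (.rel allowed x z))))

/-- Compute the allowed values and the first advice. -/
def prepare : Cmd := .seq (.assign allowed admissibleFm) (.assign advice firstFm)

/-- The value at the position `v` can be increased. -/
def largerFm (v : Var) : Fm :=
  .ex y <| .and (.rel allowed v y) (.ex z <| .and (.rel advice v z) (.lt z y))

/-- Stop with the given verdict. -/
def conclude (v : Var) : Cmd := .seq (.pick found (.eq found v)) (.pick halt (.eq halt one))

/-- Compute the next advice. -/
def advance : Cmd :=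
  .ite (.ex x (largerFm x))
    (.seq (.pick pos <| .and (largerFm pos) (.neg (.ex x (.and (.lt pos x) (largerFm x))))) <|
      .seq (.pick digit (.rel advice pos digit)) <|
      .seq (.pick vert (.and (.rel allowed pos vert) (.lt digit vert))) <|
      .assign advice <| .or (.and (.lt x pos) (.rel advice x y)) <|
        .or (.and (.eq x pos) (.eq y vert)) (.and (.lt pos x) firstFm))
    (conclude zero)

/-- Store the solution and proceed to the next vertex. -/
def extend : Cmd :=
  .seq (.assign sol <| .and (.rel del x x) (.le x iter)) <|
  .ite (.isPred iter order) (conclude one) <|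
  .seq (.pick tmp (.eq tmp iter)) <| .seq (.pick iter (.isPred tmp iter)) prepare

/-- The body of the main loop. -/
def body : Cmd := .seq trial <| .seq verdict <| .ite (.eq bit zero) advance extend

theorem Ground.one_ne_zero [NeZero m] {σ : Conf m} (h : Ground σ) : σ.env one ≠ 0 := fun h' => by
  have := h.one_eq
  rw [h'] at this
  simp at this

theorem Ground.sat_admissibleFm [NeZero m] {σ : Conf m} (h : Ground σ) (a b : Fin m) :
    admissibleFm.Sat ((σ.setVar x a).setVar y b) ↔ σ.admissible a b := by
  have h1 : b.val ≤ 1 ↔ b = 0 ∨ b = σ.env one := by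
    rw [Fin.ext_iff, Fin.ext_iff, h.one_eq, Fin.val_zero]
    omega
  simp [admissibleFm, terminalFm, Conf.admissible, Conf.terminal, Conf.set, h1, h.zero_eq]

theorem sat_firstFm [NeZero m] (σ : Conf m) (a b : Fin m) (hA : ∃ b, σ.rel allowed a b) :
    firstFm.Sat ((σ.setVar x a).setVar y b) ↔ least (σ.rel allowed a) = b := by
  simp only [firstFm, Fm.sat_and, Fm.sat_rel, Fm.sat_neg, Fm.sat_ex, Fm.sat_lt, Conf.setVar_env,
    Conf.setVar_rel, reduceCtorEq, if_true, if_false]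
  constructor
  · rintro ⟨h1, h2⟩
    exact least_eq h1 fun c hc h => h2 ⟨c, hc, h⟩
  · rintro rfl
    exact ⟨least_spec hA, fun ⟨c, hc, h⟩ => absurd hc (not_lt.2 (least_le h))⟩

theorem Conf.exists_admissible [NeZero m] (σ : Conf m) (i : Fin m) :
    ∃ a, σ.admissible i a := by
  by_cases hi : i < σ.env order
  · by_cases hT : σ.terminal i
    · exact ⟨i, Or.inl ⟨hi, Or.inl ⟨hT, hT, le_rfl⟩⟩⟩
    · exact ⟨0, Or.inl ⟨hi, Or.inr ⟨hT, rfl⟩⟩⟩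
  · exact ⟨0, Or.inr ⟨not_lt.1 hi, Or.inr rfl⟩⟩

theorem SameInput.admissible {σ τ : Conf m} (h : SameInput σ τ) : τ.admissible = σ.admissible := by
  ext i a
  rw [Conf.admissible, Conf.admissible, h.terminal, h.order_eq, h.limit_eq]

/-- The invariant of the main loop. -/
structure LoopInv [NeZero m] (σ : Conf m) (g : Fin m → Fin m) : Prop extends Ground σ where
  edge_lt : ∀ a b, σ.rel edge a b → a < σ.env order ∧ b < σ.env order
  sol_hits : Hits (fun a b => σ.rel edge a b ∧ a < σ.env iter ∧ b < σ.env iter) (σ.set sol)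
  allowed_eq : σ.rel allowed = σ.admissible
  advice_eq : σ.rel advice = fun i a => g i = a
  halt_eq : σ.env halt = 0
  mem : ∀ i, σ.admissible i (g i)
  minimal : ∀ f : Fin m → Fin m, (∀ i, σ.admissible i (f i)) → σ.Success f → toLex g ≤ toLex f

theorem prepare_spec [NeZero m] {σ : Conf m} (h : Ground σ)
    (he : ∀ a b, σ.rel edge a b → a < σ.env order ∧ b < σ.env order)
    (hs : Hits (fun a b => σ.rel edge a b ∧ a < σ.env iter ∧ b < σ.env iter) (σ.set sol))
    (hh : σ.env halt = 0) :
    LoopInv (prepare.eval σ) fun i => least (σ.admissible i) := by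
  have e1 : prepare.eval σ = (σ.setRel allowed σ.admissible).withAdvice
      fun i => least (σ.admissible i) := by
    have e0 : Cmd.eval (.assign allowed admissibleFm) σ = σ.setRel allowed σ.admissible := by
      rw [Cmd.eval]
      congr 1
      ext a b
      exact h.sat_admissibleFm a b
    rw [prepare, Cmd.eval_seq, e0, Cmd.eval, Conf.withAdvice]
    congr 1
    ext a b
    rw [sat_firstFm]
    · simp
    · simpa using σ.exists_admissible a
  have hsame : SameInput σ (prepare.eval σ) := by
    rw [e1]
    constructor <;> simp [Conf.withAdvice]
  have hset : (prepare.eval σ).set sol = σ.set sol := by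
    ext a
    rw [Conf.set, hsame.sol_eq]
    rfl
  refine { hsame.ground h with
    edge_lt := ?_, sol_hits := ?_, allowed_eq := ?_, advice_eq := ?_, halt_eq := ?_, mem := ?_,
    -- The first advice is least at every position, hence least lexicographically; success plays no
    -- role.
    minimal := fun f hf _ => Pi.toLex_monotone fun i => ?_ }
  · rwa [hsame.edge_eq, hsame.order_eq]
  · rwa [hsame.edge_eq, hsame.iter_eq, hset]
  · rw [hsame.admissible, e1]
    simp [Conf.withAdvice]
  · rw [e1]
    simp [Conf.withAdvice]
  · rw [e1]
    simpa [Conf.withAdvice] using hh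
  · rw [hsame.admissible]
    exact fun i => least_spec (σ.exists_admissible i)
  · rw [hsame.admissible] at hf
    exact least_le (hf i)

theorem advance_spec [NeZero m] {σ : Conf m} {A : Fin m → Fin m → Prop} {g : Fin m → Fin m}
    (hallowed : σ.rel allowed = A) (hadvice : σ.rel advice = fun i a => g i = a)
    (hA : ∀ i, ∃ a, A i a) :
    (∃ j, (∃ a, A j a ∧ g j < a) ∧ (∀ i, j < i → ¬ ∃ a, A i a ∧ g i < a) ∧
      (advance.eval σ).rel advice = (fun i a => increment A g j i = a) ∧
      (advance.eval σ).env halt = σ.env halt) ∨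
    ((∀ i, ¬ ∃ a, A i a ∧ g i < a) ∧ (advance.eval σ).env halt = σ.env one ∧
      (advance.eval σ).env found = σ.env zero) := by
  subst hallowed
  have hx : (Fm.ex x (largerFm x)).Sat σ ↔ ∃ i, ∃ a, σ.rel allowed i a ∧ g i < a := by
    simp [largerFm, hadvice]
  by_cases hex : ∃ i, ∃ a, σ.rel allowed i a ∧ g i < a
  · left
    obtain ⟨j, hj, hmax⟩ := Set.exists_max_image {i | ∃ a, σ.rel allowed i a ∧ g i < a} id
      (Set.toFinite _) hex
    replace hj : ∃ a, σ.rel allowed j a ∧ g j < a := hj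
    replace hmax : ∀ i, j < i → ¬ ∃ a, σ.rel allowed i a ∧ g i < a := fun i hi h =>
      absurd hi (not_lt.2 (hmax i h))
    have e1 : Cmd.eval (.pick pos <| .and (largerFm pos)
        (.neg (.ex x (.and (.lt pos x) (largerFm x))))) σ = σ.setVar pos j := by
      rw [Cmd.eval_pick]
      congr 1
      have e : (fun a => (Fm.and (largerFm pos) (.neg (.ex x (.and (.lt pos x) (largerFm x))))).Sat
          (σ.setVar pos a)) = fun i => (∃ a, σ.rel allowed i a ∧ g i < a) ∧
            ∀ l, i < l → ¬ ∃ a, σ.rel allowed l a ∧ g l < a := by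
        ext i
        simp [largerFm, hadvice]
      rw [e]
      exact least_eq ⟨hj, hmax⟩ fun b hb h => h.2 j hb hj
    have e2 : Cmd.eval (.pick digit (.rel advice pos digit)) (σ.setVar pos j) =
        (σ.setVar pos j).setVar digit (g j) := by
      rw [Cmd.eval_pick]
      congr 1
      simp [hadvice]
    have e3 : Cmd.eval (.pick vert (.and (.rel allowed pos vert) (.lt digit vert)))
        ((σ.setVar pos j).setVar digit (g j)) = ((σ.setVar pos j).setVar digit (g j)).setVar vert
          (least fun a => σ.rel allowed j a ∧ g j < a) := by
      rw [Cmd.eval_pick]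
      simp
    rw [advance, Cmd.eval_ite_pos (hx.2 hex), Cmd.eval_seq, e1, Cmd.eval_seq, e2, Cmd.eval_seq, e3]
    refine ⟨j, hj, hmax, ?_, by simp [Cmd.eval]⟩
    rw [Cmd.eval, Conf.setRel_rel, if_pos rfl]
    ext i a
    have hf := sat_firstFm ((((σ.setVar pos j).setVar digit (g j)).setVar vert
      (least fun a => σ.rel allowed j a ∧ g j < a))) i a (hA i)
    rw [Fm.sat_or, Fm.sat_or, Fm.sat_and (ψ := firstFm), hf]
    simp only [Fm.sat_and, Fm.sat_lt, Fm.sat_rel, Fm.sat_eq, Conf.setVar_env, Conf.setVar_rel,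
      reduceCtorEq, if_true, if_false, hadvice, increment]
    rcases lt_trichotomy i j with h | rfl | h
    · simp [h, h.ne, h.not_gt]
    · simp [eq_comm]
    · simp [h, h.ne', h.not_gt]
  · right
    rw [advance, Cmd.eval_ite_neg (mt hx.1 hex)]
    push Not at hex
    refine ⟨fun i => by simpa using hex i, ?_, ?_⟩
    · simp [conclude, Cmd.eval]
    · simp [conclude, Cmd.eval]

/-- The main loop is finished with a correct verdict. -/
structure Solved [NeZero m] (σ : Conf m) : Prop where
  halt_ne : σ.env halt ≠ 0
  of_found : σ.env found ≠ 0 → Hits (σ.rel edge) (σ.set sol) ∧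
    count (σ.set sol) ≤ (σ.env budget).val
  of_not_found : σ.env found = 0 →
    ¬ ∃ S, Hits (σ.rel edge) S ∧ count S ≤ (σ.env budget).val

/-- A bound for the number of sequences of advice. -/
def adviceBound (k : ℕ) : ℕ := (k + 1).factorial * 2 ^ (3 * k + 1)

/-- A bound for the number of remaining iterations of the main loop. -/
noncomputable def Conf.potential (σ : Conf m) (g : Fin m → Fin m) : ℕ :=
  ((σ.env order).val - 1 - (σ.env iter).val) * adviceBound (σ.env budget).val +
    remaining σ.admissible g

/-- The compression step: a closed set that avoids the vertex `iter` lives among the earlier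
vertices, where the old solution meets it. -/
theorem LoopInv.hits_terminal [NeZero m] {σ : Conf m} {g : Fin m → Fin m} (h : LoopInv σ g) :
    Hits σ.edgeLE σ.terminal := by
  refine fun Y hY => h.sol_hits Y fun a ha => ?_
  obtain ⟨h1, b, hb, hab⟩ := hY a ha
  refine ⟨fun h' => h1 (Or.inl h'), b, hb, hab.1, ?_, ?_⟩
  · exact lt_of_le_of_ne hab.2.1 fun h' => h1 (Or.inr h')
  · exact lt_of_le_of_ne hab.2.2 fun h' => (hY b hb).1 (Or.inr h')

end DFVS

/-! ### Correctness and termination of the main loop -/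

namespace DFVS
open DFVS.Var DFVS.Rel
variable {m : ℕ}

/-- The part of the configuration that the main loop does not change. -/
structure SameTask (σ τ : Conf m) : Prop where
  edge_eq : τ.rel edge = σ.rel edge
  order_eq : τ.env order = σ.env order
  budget_eq : τ.env budget = σ.env budget
  zero_eq : τ.env zero = σ.env zero

theorem sameTask_body [NeZero m] (σ : Conf m) : SameTask σ (body.eval σ) := by
  have hv : ∀ v, (body.ModVar v) → v ≠ order ∧ v ≠ budget ∧ v ≠ zero := fun v h => by
    rw [body, Cmd.ModVar, Cmd.ModVar, Cmd.ModVar] at h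
    rcases h with h | h | h | h
    · have := modVar_trial h
      tauto
    · rcases modVar_verdict h with rfl | rfl | rfl | rfl <;> simp
    · simp [advance, conclude, Cmd.ModVar] at h
      rcases h with (h | h | h) | h | h <;> simp [h]
    · simp [extend, conclude, prepare, Cmd.ModVar] at h
      rcases h with (h | h) | h | h <;> simp [h]
  have hr : ¬ body.ModRel edge := fun h => by
    rw [body, Cmd.ModRel, Cmd.ModRel, Cmd.ModRel] at h
    rcases h with h | h | h | h
    · exact (modRel_trial h).2.1 rfl
    · simpa using modRel_verdict h
    · simp [advance, conclude, Cmd.ModRel] at h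
    · simp [extend, conclude, prepare, Cmd.ModRel] at h
  exact ⟨Cmd.eval_rel hr σ, Cmd.eval_env (fun h => (hv _ h).1 rfl) σ,
    Cmd.eval_env (fun h => (hv _ h).2.1 rfl) σ, Cmd.eval_env (fun h => (hv _ h).2.2 rfl) σ⟩

theorem sameTask_iterate [NeZero m] (σ : Conf m) (j : ℕ) : SameTask σ (body.eval^[j] σ) :=
  iterate_induction (I := fun _ τ => SameTask σ τ) ⟨rfl, rfl, rfl, rfl⟩ (fun _ τ h =>
    have h' := sameTask_body τ
    ⟨h'.1.trans h.1, h'.2.trans h.2, h'.3.trans h.3, h'.4.trans h.4⟩) j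

theorem trial_halt [NeZero m] {σ : Conf m} (h : σ.env zero = 0) : (trial.eval σ).env halt = 0 := by
  rw [eval_trial, ← Cmd.eval_rep, Cmd.eval_env]
  · simp [Conf.initial, Conf.reset, workVars, h]
  · simp [searchStep, begin, beginRest, branch, branchRest, nextBit, separate, maxFlow, augment,
      levels, levelOut, levelIn, walkStep, walkEnd, walkIn, walkOut, Cmd.ModVar]

/-- As `g` failed, every successful advice comes strictly after it. So the successor of `g` inherits
minimality, and if there is no successor, no advice succeeds. -/
theorem LoopInv.advance_step [NeZero m] {σ μ : Conf m} {g : Fin m → Fin m} (h : LoopInv σ g)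
    (hs : SameInput σ μ) (ha : μ.rel allowed = σ.rel allowed) (hd : μ.rel advice = σ.rel advice)
    (hh : μ.env halt = 0) (hg : ¬ σ.Success g) :
    (∃ g', LoopInv (advance.eval μ) g' ∧ (advance.eval μ).potential g' < σ.potential g) ∨
      Solved (advance.eval μ) := by
  have hs' : SameInput σ (advance.eval μ) := hs.trans <|
    Cmd.sameInput μ (by simp [advance, conclude, Cmd.ModRel])
      (by simp [advance, conclude, Cmd.ModRel]) fun v hv => by
        simp [advance, conclude, Cmd.ModVar] at hv
        rcases hv with (hv | hv | hv) | hv | hv <;> simp [hv]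
  have ha' : (advance.eval μ).rel allowed = σ.rel allowed := by
    rw [Cmd.eval_rel (by simp [advance, conclude, Cmd.ModRel]), ha]
  have hlt : ∀ f : Fin m → Fin m, (∀ i, σ.admissible i (f i)) → σ.Success f →
      toLex g < toLex f := fun f hf hS => by
    refine lt_of_le_of_ne (h.minimal f hf hS) fun he => hg ?_
    rwa [toLex_inj.1 he]
  rcases advance_spec (ha.trans h.allowed_eq) (hd.trans h.advice_eq) σ.exists_admissible with
    ⟨j, hj, hmax, hadv, hhalt⟩ | ⟨hmax, hhalt, hfound⟩
  · left
    generalize advance.eval μ = τ at *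
    refine ⟨increment σ.admissible g j, { hs'.ground h.toGround with
      edge_lt := ?_, sol_hits := ?_, allowed_eq := ?_, advice_eq := hadv, halt_eq := hhalt.trans hh
      mem := ?_, minimal := fun f hf hS => ?_ }, ?_⟩
    · rw [hs'.edge_eq, hs'.order_eq]
      exact h.edge_lt
    · have hset : τ.set sol = σ.set sol := by
        ext a
        rw [Conf.set, hs'.sol_eq]
        rfl
      rw [hs'.edge_eq, hs'.iter_eq, hset]
      exact h.sol_hits
    · rw [ha', hs'.admissible, h.allowed_eq]
    · rw [hs'.admissible]
      exact increment_mem σ.exists_admissible h.mem hj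
    · rw [hs'.admissible] at hf
      exact increment_le hmax hf (hlt f hf (hs'.symm.success ha'.symm hS))
    · rw [Conf.potential, Conf.potential, hs'.order_eq, hs'.iter_eq, hs'.budget_eq, hs'.admissible]
      exact Nat.add_lt_add_left (remaining_lt h.mem (lt_increment hj)) _
  · right
    generalize advance.eval μ = τ at *
    refine ⟨?_, fun hf => absurd ?_ hf, fun _ => ?_⟩
    · rw [hhalt, hs.one_eq]
      exact h.one_ne_zero
    · rw [hfound, hs.zero_eq, h.zero_eq]
    · rintro ⟨S, hS, hc⟩
      rw [hs'.edge_eq] at hS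
      rw [hs'.budget_eq] at hc
      -- A solution of the whole graph also solves the subgraph on the vertices up to `iter`, so
      -- some advice would have succeeded.
      obtain ⟨f, hf, hfS⟩ := h.exists_success h.hits_terminal
        ⟨S, hS.mono (fun _ _ h => h.1) fun _ _ h _ => h, hc⟩
      exact not_lt_of_maximal hmax hf (hlt f hf hfS)

/-- The deleted vertices up to `iter` become the new `sol`, which keeps the terminals of the next
round within `k + 1`. After the last vertex they solve the whole graph. -/
theorem LoopInv.extend_step [NeZero m] {σ μ : Conf m} {g : Fin m → Fin m} (h : LoopInv σ g)
    (hs : SameInput σ μ) (hh : μ.env halt = 0) (hlive : Hits μ.live fun _ => False)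
    (hdel : count (μ.set del) ≤ (σ.env budget).val) :
    (∃ g', LoopInv (extend.eval μ) g' ∧ (extend.eval μ).potential g' < σ.potential g) ∨
      Solved (extend.eval μ) := by
  set μ₁ := Cmd.eval (.assign sol <| .and (.rel del x x) (.le x iter)) μ with hμ₁
  have hsol : ∀ a, μ₁.set sol a ↔ μ.set del a ∧ a ≤ σ.env iter := fun a => by
    simp [hμ₁, Cmd.eval, Conf.set, hs.iter_eq]
  have hedge : μ₁.rel edge = σ.rel edge := by
    simp [hμ₁, Cmd.eval, hs.edge_eq]
  have henv : μ₁.env = μ.env := rfl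
  have hcount : count (μ₁.set sol) ≤ (σ.env budget).val :=
    (count_mono fun a ha => ((hsol a).1 ha).1).trans hdel
  have hhits : Hits σ.edgeLE (μ₁.set sol) := by
    refine fun Y hY => hlive Y fun a ha => ⟨id, ?_⟩
    obtain ⟨h1, b, hb, hab⟩ := hY a ha
    refine ⟨b, hb, ?_⟩
    rw [Conf.live, hs.edge_eq, hs.iter_eq]
    exact ⟨hab.1, hab.2.1, hab.2.2, fun h' => h1 ((hsol a).2 ⟨h', hab.2.1⟩),
      fun h' => (hY b hb).1 ((hsol b).2 ⟨h', hab.2.2⟩)⟩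
  have hsat : (Fm.isPred iter order).Sat μ₁ ↔ (σ.env iter).val + 1 = (σ.env order).val := by
    rw [Fm.sat_isPred (by simp) (by simp), henv, hs.iter_eq, hs.order_eq]
  rw [extend, Cmd.eval_seq, ← hμ₁]
  by_cases hlast : (σ.env iter).val + 1 = (σ.env order).val
  · right
    rw [Cmd.eval_ite_pos (hsat.2 hlast)]
    have hle : ∀ a : Fin m, a < σ.env order → a ≤ σ.env iter := fun a ha => by
      have := Fin.lt_def.1 ha
      exact Fin.le_def.2 (by omega)
    have hone := h.one_ne_zero
    refine ⟨?_, fun _ => ⟨?_, ?_⟩, fun hf => absurd hf ?_⟩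
    · simpa [conclude, Cmd.eval, henv, hs.one_eq] using hone
    · simp only [conclude, Cmd.eval, Conf.setVar_rel, Conf.setVar_set, hedge]
      refine fun Y hY => hhits Y fun a ha => ?_
      obtain ⟨h1, b, hb, hab⟩ := hY a ha
      have h2 := h.edge_lt a b hab
      exact ⟨h1, b, hb, hab, hle a h2.1, hle b h2.2⟩
    · simpa [conclude, Cmd.eval, henv, hs.budget_eq] using hcount
    · simpa [conclude, Cmd.eval, henv, hs.one_eq] using hone
  · left
    rw [Cmd.eval_ite_neg (mt hsat.1 hlast), Cmd.eval_seq, Cmd.eval_seq]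
    have hlt := h.iter_lt
    obtain ⟨i, hi⟩ : ∃ i : Fin m, i.val = (σ.env iter).val + 1 :=
      ⟨⟨(σ.env iter).val + 1, by omega⟩, rfl⟩
    have e1 : Cmd.eval (.pick iter (.isPred tmp iter)) (Cmd.eval (.pick tmp (.eq tmp iter)) μ₁) =
        (μ₁.setVar tmp (σ.env iter)).setVar iter i := by
      rw [Cmd.eval_pick, Cmd.eval_pick]
      have : (least fun a => (Fm.eq tmp iter).Sat (μ₁.setVar tmp a)) = σ.env iter := by
        simp [henv, hs.iter_eq]
      rw [this]
      congr 1
      refine least_eq ?_ fun b hb => ?_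
      · simp [Fm.sat_isPred, hi]
      · have := Fin.lt_def.1 hb
        simp [Fm.sat_isPred]
        omega
    rw [e1]
    set ν := (μ₁.setVar tmp (σ.env iter)).setVar iter i with hν
    have hter : ∀ a, ν.terminal a → a = i ∨ μ₁.set sol a := fun a ha => by
      rcases ha with ha | ha
      · exact Or.inr ha
      · left
        simpa [hν] using ha
    have hi' : ν.env iter = i := by simp [hν]
    have h1 : ν.env order = σ.env order := by simp [hν, henv, hs.order_eq]
    have h2 : ν.env budget = σ.env budget := by simp [hν, henv, hs.budget_eq]
    have h3 : ν.env limit = σ.env limit := by simp [hν, henv, hs.limit_eq]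
    have h4 : ν.env zero = σ.env zero := by simp [hν, henv, hs.zero_eq]
    have h5 : ν.env one = σ.env one := by simp [hν, henv, hs.one_eq]
    have hground : Ground ν := by
      refine ⟨h4.trans h.zero_eq, by rw [h5]; exact h.one_eq, by rw [hi', h1]; omega,
        by rw [h1, h2]; exact h.budget_lt, by rw [h1, h2, h3]; exact h.limit_eq,
        by rw [h1]; exact h.size, fun a ha => ?_, ?_⟩
      · rw [hi']
        rcases hter a ha with rfl | ha
        · exact le_rfl
        · have := Fin.le_def.1 ((hsol a).1 ha).2
          exact Fin.le_def.2 (by omega)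
      · rw [h2]
        by_cases hii : μ₁.set sol i
        · refine (count_mono (q := μ₁.set sol) fun a ha => ?_).trans (by omega)
          rcases hter a ha with rfl | ha
          · exact hii
          · exact ha
        · refine (count_mono (q := fun a => μ₁.set sol a ∨ a = i) fun a ha =>
            (hter a ha).symm).trans ?_
          rw [count_add_one hii]
          omega
    have hinv := prepare_spec hground (by
        rw [h1]
        simpa [hν, hedge] using h.edge_lt) (by
        rw [hi']
        change Hits (fun a b => μ₁.rel edge a b ∧ a < i ∧ b < i) (μ₁.set sol)
        rw [hedge]
        refine hhits.mono (fun a b hab => ⟨hab.1, ?_, ?_⟩) fun a b h _ => h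
        · have := Fin.lt_def.1 hab.2.1
          exact Fin.le_def.2 (by omega)
        · have := Fin.lt_def.1 hab.2.2
          exact Fin.le_def.2 (by omega)) (by simpa [hν, henv] using hh)
    refine ⟨_, hinv, ?_⟩
    have hs2 : SameInput ν (prepare.eval ν) := Cmd.sameInput ν (by simp [prepare, Cmd.ModRel])
      (by simp [prepare, Cmd.ModRel]) (by simp [prepare, Cmd.ModVar])
    rw [Conf.potential, Conf.potential, hs2.order_eq, hs2.budget_eq, hs2.iter_eq, hi', h1, h2,
      hs2.admissible, hi]
    -- Moving to the next vertex gives up one full block `adviceBound`; the fresh enumeration needs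
    -- no more than that, and the old one had at least one sequence left.
    have h6 := (remaining_le ν.admissible fun i => least (ν.admissible i)).trans
      hground.prod_admissible_le
    rw [h2] at h6
    change _ ≤ adviceBound _ at h6
    have h7 := remaining_pos h.mem
    obtain ⟨e, he⟩ : ∃ e, (σ.env order).val - 1 - (σ.env iter).val = e + 1 :=
      ⟨(σ.env order).val - 1 - (σ.env iter).val - 1, by omega⟩
    have he' : (σ.env order).val - 1 - ((σ.env iter).val + 1) = e := by omega
    rw [he, he', add_mul, one_mul]
    omega

theorem LoopInv.body_step [NeZero m] {σ : Conf m} {g : Fin m → Fin m} (h : LoopInv σ g) :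
    (∃ g', LoopInv (body.eval σ) g' ∧ (body.eval σ).potential g' < σ.potential g) ∨
      Solved (body.eval σ) := by
  have hg : σ.withAdvice g = σ := by
    refine Conf.ext' rfl (funext fun r => ?_)
    by_cases hr : r = advice
    · subst hr
      simp [Conf.withAdvice, h.advice_eq]
    · simp [Conf.withAdvice, hr]
  have hS : σ.Success g ↔ Hits (trial.eval σ).live (fun _ => False) ∧
      count ((trial.eval σ).set del) ≤ (σ.env budget).val := by
    rw [Conf.Success, hg]
  have h1 := sameInput_trial σ
  have h2 := sameInput_verdict (trial.eval σ)
  have hv := verdict_spec (h1.ground h.toGround)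
  rw [h1.budget_eq, ← hS] at hv
  have hdel : (verdict.eval (trial.eval σ)).rel del = (trial.eval σ).rel del :=
    Cmd.eval_rel (fun h => by simpa using modRel_verdict h) _
  have hdel' : (verdict.eval (trial.eval σ)).set del = (trial.eval σ).set del := by
    ext a
    rw [Conf.set, hdel]
    rfl
  have hr : ∀ r, (r = allowed ∨ r = advice) →
      (verdict.eval (trial.eval σ)).rel r = σ.rel r := fun r hr => by
    rw [Cmd.eval_rel, Cmd.eval_rel]
    · intro h'
      have := modRel_trial h'
      tauto
    · intro h'
      rw [modRel_verdict h'] at hr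
      simp at hr
  have hh : (verdict.eval (trial.eval σ)).env halt = 0 := by
    rw [Cmd.eval_env (fun h => by simpa using modVar_verdict h)]
    exact trial_halt h.zero_eq
  have hs := h1.trans h2
  have hlive := h2.live hdel
  rw [body, Cmd.eval_seq, Cmd.eval_seq]
  generalize verdict.eval (trial.eval σ) = μ at *
  have hz : μ.env zero = 0 := hs.zero_eq.trans h.zero_eq
  by_cases hb : μ.env bit = 0
  · rw [Cmd.eval_ite_pos (by simp [hb, hz])]
    exact h.advance_step hs (hr _ (Or.inl rfl)) (hr _ (Or.inr rfl)) hh fun h' => hv.2 h' hb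
  · rw [Cmd.eval_ite_neg (by simp [hb, hz])]
    have h3 := hS.1 (hv.1 hb)
    exact h.extend_step hs hh (by rw [hlive]; exact h3.1) (by rw [hdel']; exact h3.2)

/-- The main loop stops with a correct verdict. -/
theorem LoopInv.solves [NeZero m] {σ : Conf m} {g : Fin m → Fin m} (h : LoopInv σ g) :
    ∃ j ≤ σ.potential g, (∀ i < j, (body.eval^[i] σ).env halt = 0) ∧
      Solved (body.eval^[j] σ) := by
  obtain ⟨N, hN⟩ : ∃ N, σ.potential g = N := ⟨_, rfl⟩
  induction N using Nat.strong_induction_on generalizing σ g with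
  | _ N ih =>
    rcases h.body_step with ⟨g', hg', hlt⟩ | hsol
    · obtain ⟨j, hj, h1, h2⟩ := ih _ (hN ▸ hlt) hg' rfl
      refine ⟨j + 1, by omega, fun i hi => ?_, ?_⟩
      · cases i with
        | zero => exact h.halt_eq
        | succ i =>
          rw [Function.iterate_succ_apply]
          exact h1 i (by omega)
      · rwa [Function.iterate_succ_apply]
    · refine ⟨1, ?_, fun i hi => ?_, hsol⟩
      · have := remaining_pos h.mem
        rw [Conf.potential]
        omega
      · obtain rfl : i = 0 := by omega
        exact h.halt_eq

theorem LoopInv.potential_le [NeZero m] {σ : Conf m} {g : Fin m → Fin m} (h : LoopInv σ g) :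
    σ.potential g ≤ (σ.env order).val * adviceBound (σ.env budget).val := by
  have h1 := (remaining_le σ.admissible g).trans h.prod_admissible_le
  change _ ≤ adviceBound _ at h1
  have h2 := h.iter_lt
  have h3 : ((σ.env order).val - 1 - (σ.env iter).val) + 1 ≤ (σ.env order).val := by omega
  have h4 := Nat.mul_le_mul_right (adviceBound (σ.env budget).val) h3
  rw [add_mul, one_mul] at h4
  rw [Conf.potential]
  omega

end DFVS

namespace DFVS
open DFVS.Var DFVS.Rel

/-! ### Directed cycles and closed sets of vertices -/

section Bridge
variable {V : Type*}

/-- Rotate the cycle so that it begins with `v`; the wrap-around of the chain covers the case of a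
loop. -/
theorem exists_mem_of_chain {r : V → V → Prop} {c : Cycle V} (hc : c.Chain r) {v : V} (hv : v ∈ c) :
    ∃ w ∈ c, r v w := by
  induction c using Quotient.inductionOn' with
  | h l =>
    change Cycle.Chain r (l : Cycle V) at hc
    change v ∈ (l : Cycle V) at hv
    change ∃ w ∈ (l : Cycle V), r v w
    obtain ⟨l₁, l₂, rfl⟩ := List.append_of_mem (Cycle.mem_coe_iff.1 hv)
    have he : ((l₁ ++ v :: l₂ : List V) : Cycle V) = ((v :: (l₂ ++ l₁) : List V) : Cycle V) :=
      Cycle.coe_eq_coe.2 List.isRotated_append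
    rw [he] at hc ⊢
    rw [Cycle.chain_coe_cons] at hc
    cases h : l₂ ++ l₁ with
    | nil =>
      rw [h] at hc
      exact ⟨v, by simp, by simpa using hc⟩
    | cons w t =>
      rw [h] at hc
      simp only [List.cons_append, List.isChain_cons_cons] at hc
      exact ⟨w, by simp, hc.1⟩

/-- Iterating a choice of successors in a finite closed set ends in a periodic orbit, which is a
directed cycle without repetitions. Conversely the vertices of a cycle form a closed set. -/
theorem isFeedbackVertexSet_iff [Finite V] (G : Digraph V) (S : Finset V) :
    IsFeedbackVertexSet G S ↔ Hits G.Adj fun v => v ∈ S := by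
  constructor
  · intro h Y hY y₀ hy₀
    choose! f hf using fun y hy => (hY y hy).2
    have hit : ∀ n, Y (f^[n] y₀) := fun n => by
      induction n with
      | zero => exact hy₀
      | succ n ih =>
        rw [Function.iterate_succ_apply']
        exact (hf _ ih).1
    obtain ⟨i, j, hij, he⟩ : ∃ i j, i < j ∧ f^[i] y₀ = f^[j] y₀ := by
      obtain ⟨i, j, hne, he⟩ := Finite.exists_ne_map_eq_of_infinite fun n : ℕ => f^[n] y₀
      rcases lt_or_gt_of_ne hne with h | h
      · exact ⟨i, j, h, he⟩
      · exact ⟨j, i, h, he.symm⟩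
    set y₁ := f^[i] y₀ with hy₁
    have hper : y₁ ∈ Function.periodicPts f := by
      refine ⟨j - i, by omega, ?_⟩
      rw [Function.IsPeriodicPt, Function.IsFixedPt, hy₁, ← Function.iterate_add_apply,
        Nat.sub_add_cancel hij.le, ← he]
    have hit' : ∀ n, Y (f^[n] y₁) := fun n => by
      rw [hy₁, ← Function.iterate_add_apply]
      exact hit _
    obtain ⟨v, hv, hvS⟩ := h (Function.periodicOrbit f y₁)
      ⟨fun h => Function.periodicOrbit_eq_nil_iff_not_periodic_pt.1 h hper,
        Function.nodup_periodicOrbit, (Function.periodicOrbit_chain _).2 fun n _ => by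
          rw [Function.iterate_succ_apply']
          exact (hf _ (hit' n)).2⟩
    obtain ⟨n, rfl⟩ := (Function.mem_periodicOrbit_iff hper).1 hv
    exact (hY _ (hit' n)).1 hvS
  · rintro h c ⟨hc, -, hch⟩
    by_contra! hcon
    have hempty := h (fun v => v ∈ c) fun v hv => ⟨hcon v hv, exists_mem_of_chain hch hv⟩
    refine hc ?_
    induction c using Quotient.inductionOn' with
    | h l =>
      refine (Cycle.coe_eq_nil _).2 (List.eq_nil_iff_forall_not_mem.2 fun v hv => hempty v ?_)
      exact Cycle.mem_coe_iff.2 hv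

variable {n m : ℕ}

/-- The edges of a graph on the first vertices of a larger universe. -/
def extendAdj (m : ℕ) (G : Digraph (Fin n)) (a b : Fin m) : Prop :=
  ∃ u v : Fin n, u.val = a.val ∧ v.val = b.val ∧ G.Adj u v

/-- The additional elements of the universe have no outgoing edges, so they belong to no closed set.
-/
theorem hits_extendAdj (hnm : n ≤ m) (G : Digraph (Fin n)) (X : Fin m → Prop) :
    Hits (extendAdj m G) X ↔ Hits G.Adj fun v => X (Fin.castLE hnm v) := by
  constructor
  · intro h Y hY c hc
    refine h (fun a => ∃ v : Fin n, v.val = a.val ∧ Y v) ?_ (Fin.castLE hnm c) ⟨c, rfl, hc⟩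
    rintro a ⟨v, hv, hYv⟩
    obtain rfl : a = Fin.castLE hnm v := Fin.ext hv.symm
    obtain ⟨h1, w, hw, hvw⟩ := hY v hYv
    exact ⟨h1, Fin.castLE hnm w, ⟨w, rfl, hw⟩, v, w, rfl, rfl, hvw⟩
  · intro h Y hY a ha
    have hempty := h (fun v => Y (Fin.castLE hnm v)) fun v hv => by
      obtain ⟨h1, b, hb, v', w, hv', hw, hvw⟩ := hY _ hv
      obtain rfl : v' = v := Fin.ext hv'
      obtain rfl : b = Fin.castLE hnm w := Fin.ext hw.symm
      exact ⟨h1, w, hb, hvw⟩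
    obtain ⟨-, b, hb, v, w, hv, hw, -⟩ := hY a ha
    obtain rfl : a = Fin.castLE hnm v := Fin.ext hv.symm
    exact hempty v ha

theorem count_castLE_le (hnm : n ≤ m) (X : Fin m → Prop) :
    count (fun v : Fin n => X (Fin.castLE hnm v)) ≤ count X := by
  classical
  rw [count_eq_card, count_eq_card, ← Finset.card_map (Fin.castLEEmb hnm)]
  refine Finset.card_le_card fun a ha => ?_
  simp only [Finset.mem_map, Finset.mem_filter, Finset.mem_univ, true_and] at ha ⊢
  obtain ⟨v, hv, rfl⟩ := ha
  exact hv

theorem count_exists_castLE_le (hnm : n ≤ m) (S : Finset (Fin n)) :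
    count (fun a : Fin m => ∃ v ∈ S, Fin.castLE hnm v = a) ≤ S.card := by
  classical
  rw [count_eq_card, ← Finset.card_map (Fin.castLEEmb hnm)]
  refine Finset.card_le_card fun a ha => ?_
  simpa using ha

end Bridge

/-! ### The initial configuration -/

section Start
variable {n m : ℕ}

/-- The values of the variables before the main loop. -/
def startValue (n k : ℕ) : Var → ℕ
  | order => n
  | budget => k
  | limit => n + 3 * k + 1
  | one => 1
  | _ => 0

/-- The configuration before the main loop. -/
def startConf (m : ℕ) [NeZero m] (n k : ℕ) (E : Fin m → Fin m → Prop) : Conf m where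
  env v := Fin.ofNat m (startValue n k v)
  rel r := if r = edge then E else fun _ _ => False

/-- The reduction modulo `m` in `Fin.ofNat` is harmless, because even `n + 3 * k + 1` is below `m`.
-/
theorem startConf_env [NeZero m] {k : ℕ} (hk : k < n) (hm : 8 * n < m) (E : Fin m → Fin m → Prop)
    (v : Var) : ((startConf m n k E).env v).val = startValue n k v := by
  refine Nat.mod_eq_of_lt ?_
  cases v <;> simp only [startValue] <;> omega

/-- The compression begins at vertex `0` with the empty solution: there are no edges among earlier
vertices, and `0` is the only terminal. -/
theorem loopInv_start [NeZero m] {k : ℕ} (hk : k < n) (hm : 8 * n < m) (G : Digraph (Fin n)) :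
    LoopInv (prepare.eval (startConf m n k (extendAdj m G)))
      fun i => least ((startConf m n k (extendAdj m G)).admissible i) := by
  have he := startConf_env hk hm (extendAdj m G)
  set σ := startConf m n k (extendAdj m G) with hσ
  have hrel : σ.rel edge = extendAdj m G := rfl
  have hiter : σ.env iter = 0 := Fin.ext (by rw [he]; rfl)
  have hsol : ∀ a, ¬ σ.set sol a := fun a => by
    simp [hσ, startConf, Conf.set]
  have hter : ∀ a, σ.terminal a → a = 0 := fun a ha => by
    rcases ha with ha | ha
    · exact absurd ha (hsol a)
    · rw [ha, hiter]
  refine prepare_spec ⟨Fin.ext (by rw [he]; rfl), he one, ?_, ?_, ?_, ?_, fun a ha => ?_, ?_⟩ ?_ ?_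
    (Fin.ext (by rw [he]; rfl))
  · rw [he, he]
    exact (Nat.zero_le k).trans_lt hk
  · rw [he, he]
    exact hk
  · rw [he, he, he]
    rfl
  · rw [he]
    exact hm
  · rw [hter a ha]
    exact Fin.zero_le _
  · refine (count_mono hter).trans ?_
    rw [count_eq]
    omega
  · rw [hrel]
    rintro a b ⟨u, v, hu, hv, -⟩
    rw [Fin.lt_def, Fin.lt_def, he, ← hu, ← hv]
    exact ⟨u.2, v.2⟩
  · rw [hiter]
    intro Y hY a ha
    obtain ⟨-, b, -, -, h, -⟩ := hY a ha
    exact absurd h (Fin.not_lt_zero a)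

end Start

end DFVS

namespace DFVS
open DFVS.Var DFVS.Rel

/-! ### The program -/

/-- Set the registers for the universe with `8 * n + 8` elements, whose matrices are stored behind
the input. -/
def setup : Program :=
  -- Register `1`, where `k` arrives, is the scratch register `0` and will hold the size of the
  -- universe; so `k` has to be moved first.
  .seq (.copy budget.reg 1) <|
  .seq (.const (scratch 1) 0) <|
  .seq (mulAddReg (scratch 1) order.reg order.reg (scratch 3) (scratch 4)) <|
  .seq (.const (scratch 0) 8) <|
  .seq (.const (scratch 2) 8) <|
  .seq (mulAddReg (scratch 0) (scratch 2) order.reg (scratch 3) (scratch 4)) <|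
  .seq (.const limit.reg 1) <|
  .seq (addReg limit.reg order.reg (scratch 3)) <|
  .seq (addReg limit.reg budget.reg (scratch 3)) <|
  .seq (addReg limit.reg budget.reg (scratch 3)) <|
  .seq (addReg limit.reg budget.reg (scratch 3)) <|
  .const one.reg 1

/-- Copy the entry `(x, y)` of the adjacency matrix. -/
def readEntry : Program :=
  .ite (.lt x.reg order.reg) (.ite (.lt y.reg order.reg)
    (.seq (.const (scratch 2) 0) <|
      .seq (mulAddReg (scratch 2) x.reg order.reg (scratch 3) (scratch 4)) <|
      .seq (addReg (scratch 2) y.reg (scratch 3)) <|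
      .seq (.load (scratch 2) (scratch 2)) <|
      .seq (cellAddr 3 edge.idx x.reg y.reg) <|
      .store (scratch 3) (scratch 2)) .skip) .skip

/-- Copy the adjacency matrix. -/
def readInput : Program :=
  .seq (forRange x.reg (forRange y.reg readEntry)) <|
  .seq (.const x.reg 0) (.const y.reg 0)

/-- Try all sequences of advice. -/
def search : Program := .loop (.eq halt.reg zero.reg) (body.compile 2)

/-- Copy the solution to the output. -/
def writeOutput : Program :=
  .seq (.const x.reg 0) <|
  .seq (.loop (.lt x.reg order.reg) <|
    .seq (cellAddr 2 sol.idx x.reg x.reg) <|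
    .seq (.load (scratch 2) (scratch 2)) <|
    .seq (.store x.reg (scratch 2)) (.succ x.reg x.reg)) <|
  .copy order.reg found.reg

/-- Answer with the set of all vertices. -/
def writeAll : Program :=
  .seq (.const 2 0) <|
  .seq (.const 4 1) <|
  .seq (.loop (.lt 2 0) (.seq (.store 2 4) (.succ 2 2))) <|
  .const 0 1

/-- The program for the directed feedback vertex set problem. -/
def solver : Program :=
  .ite (.lt 1 0)
    (.seq setup <| .seq readInput <| .seq (prepare.compile 2) <| .seq search writeOutput)
    writeAll

/-! ### The input -/

section Input
variable {n k : ℕ} (G : Digraph (Fin n))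

theorem inputState_mem_entry {m : ℕ} {a b : Fin m} (ha : a.val < n) (hb : b.val < n) :
    (inputState G k).mem (a.val * n + b.val) = ind (extendAdj m G a b) := by
  classical
  unfold inputState ind
  refine if_congr ⟨?_, ?_⟩ rfl rfl
  · rintro ⟨v, w, h, hvw⟩
    have h' : cell n 0 0 v.val w.val = cell n 0 0 a.val b.val := by simp [cell, h]
    obtain ⟨-, h1, h2⟩ := cell_inj v.2 w.2 ha hb h'
    exact ⟨v, w, h1, h2, hvw⟩
  · rintro ⟨v, w, h1, h2, hvw⟩
    exact ⟨v, w, by rw [h1, h2], hvw⟩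

/-- The memory behind the input is zero, so with base address `n * n` all matrices represent empty
relations from the outset. -/
theorem inputState_mem_of_le {i : ℕ} (hi : n * n ≤ i) : (inputState G k).mem i = 0 := by
  classical
  unfold inputState
  refine if_neg ?_
  rintro ⟨v, w, h, -⟩
  have h1 : (v.val + 1) * n ≤ n * n := Nat.mul_le_mul_right n v.2
  have h2 := w.2
  rw [add_mul, one_mul] at h1
  omega

/-- The registers during the setup. -/
structure SetupInv (f : ℕ → ℕ) (n k a b c d : ℕ) (s : State) : Prop where
  mem_eq : s.mem = f
  reg_order : s.reg 0 = n
  reg_size : s.reg 1 = a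
  reg_base : s.reg 3 = b
  reg_factor : s.reg 5 = c
  reg_budget : s.reg 10 = k
  reg_limit : s.reg 12 = d
  reg_two_mul : ∀ i, i ≠ 0 → i ≠ 5 → i ≠ 6 → s.reg (2 * i) = 0

/-- A bound for the running time of `setup`. -/
def setupCost (n : ℕ) : ℕ := n * (3 * n + 4) + 36 * n + 51

theorem runsIn_setup (hk : k < n) : RunsIn setup (inputState G k) (setupCost n) fun s =>
    s.mem = (inputState G k).mem ∧ s.reg (scratch 0) = 8 * n + 8 ∧ s.reg (scratch 1) = n * n ∧
      ∀ v : Var, s.reg v.reg = startValue n k v := by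
  set f := (inputState G k).mem with hf
  have hadd : ∀ {a b c d r q : ℕ} {s : State}, SetupInv f n k a b c d s → s.reg r = q →
      r = 0 ∨ r = 10 → RunsIn (addReg 12 r 7) s (3 * q + 2) (SetupInv f n k a b c (d + q)) := by
    rintro a b c d r q s h rfl hr
    refine RunsIn.mono (runsIn_addReg (by omega) (by omega) (by omega) s) le_rfl ?_
    rintro s' ⟨h1, h2, h3⟩
    have h4 : ∀ r, r ≠ 12 → r ≠ 7 → s'.reg r = s.reg r := h3
    refine ⟨h1.trans h.1, ?_, ?_, ?_, ?_, ?_, by rw [h2, h.7], fun i h5 h6 h7 => ?_⟩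
    · rw [h4 _ (by omega) (by omega), h.2]
    · rw [h4 _ (by omega) (by omega), h.3]
    · rw [h4 _ (by omega) (by omega), h.4]
    · rw [h4 _ (by omega) (by omega), h.5]
    · rw [h4 _ (by omega) (by omega), h.6]
    · rw [h4 _ (by omega) (by omega), h.8 i h5 h6 h7]
  refine RunsIn.mono (T := 1 + (1 + ((n * (3 * n + 4) + 2) + (1 + (1 + ((8 * (3 * n + 4) + 2) +
    (1 + ((3 * n + 2) + ((3 * k + 2) + ((3 * k + 2) + ((3 * k + 2) + 1)))))))))))
    ?_ (by unfold setupCost; omega) (fun _ h => h)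
  refine RunsIn.seq (Q := SetupInv f n k k 0 0 0) (RunsIn.copy ?_) ?_
  · refine ⟨rfl, ?_, ?_, ?_, ?_, ?_, ?_, fun i h1 h2 h3 => ?_⟩ <;>
      simp [State.setReg_reg, inputState, Var.reg, Var.idx]
    rw [if_neg (by omega), if_neg h1]
  intro s1 h1
  refine RunsIn.seq (Q := SetupInv f n k k 0 0 0) (RunsIn.const ?_) ?_
  · refine ⟨h1.1, ?_, ?_, ?_, ?_, ?_, ?_, fun i h3 h4 h5 => ?_⟩ <;>
      simp [State.setReg_reg, scratch, h1.2, h1.3, h1.5, h1.6, h1.7]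
    exact fun _ => h1.8 i h3 h4 h5
  intro s2 h2
  refine RunsIn.seq (Q := SetupInv f n k k (n * n) 0 0) (T := n * (3 * n + 4) + 2) ?_ ?_
  · have := runsIn_mulAddReg (a := 3) (b := 0) (e := 0) (c := 7) (c' := 9) (by omega) (by omega)
      (by omega) (by omega) (by omega) (by omega) (by omega) (by omega) (by omega) s2
    refine RunsIn.mono this (by rw [h2.2]) ?_
    rintro s' ⟨g1, g2, g3⟩
    refine ⟨g1.trans h2.1, ?_, ?_, by rw [g2, h2.4, h2.2, zero_add], ?_, ?_, ?_,
      fun i h5 h6 h7 => ?_⟩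
    · rw [g3 _ (by omega) (by omega) (by omega), h2.2]
    · rw [g3 _ (by omega) (by omega) (by omega), h2.3]
    · rw [g3 _ (by omega) (by omega) (by omega), h2.5]
    · rw [g3 _ (by omega) (by omega) (by omega), h2.6]
    · rw [g3 _ (by omega) (by omega) (by omega), h2.7]
    · rw [g3 _ (by omega) (by omega) (by omega), h2.8 i h5 h6 h7]
  intro s3 h3
  refine RunsIn.seq (Q := SetupInv f n k 8 (n * n) 0 0) (RunsIn.const ?_) ?_
  · refine ⟨h3.1, ?_, ?_, ?_, ?_, ?_, ?_, fun i h4 h5 h6 => ?_⟩ <;>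
      simp [State.setReg_reg, scratch, h3.2, h3.4, h3.5, h3.6, h3.7]
    exact h3.8 i h4 h5 h6
  intro s4 h4
  refine RunsIn.seq (Q := SetupInv f n k 8 (n * n) 8 0) (RunsIn.const ?_) ?_
  · refine ⟨h4.1, ?_, ?_, ?_, ?_, ?_, ?_, fun i h3 h5 h6 => ?_⟩ <;>
      simp [State.setReg_reg, scratch, h4.2, h4.3, h4.4, h4.6, h4.7]
    rw [if_neg (by omega), h4.8 i h3 h5 h6]
  intro s5 h5
  refine RunsIn.seq (Q := SetupInv f n k (8 * n + 8) (n * n) 8 0) (T := 8 * (3 * n + 4) + 2) ?_ ?_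
  · have := runsIn_mulAddReg (a := 1) (b := 5) (e := 0) (c := 7) (c' := 9) (by omega) (by omega)
      (by omega) (by omega) (by omega) (by omega) (by omega) (by omega) (by omega) s5
    refine RunsIn.mono this (by rw [h5.2, h5.5]) ?_
    rintro s' ⟨g1, g2, g3⟩
    refine ⟨g1.trans h5.1, ?_, by rw [g2, h5.3, h5.5, h5.2, add_comm], ?_, ?_, ?_, ?_,
      fun i h4 h6 h7 => ?_⟩
    · rw [g3 _ (by omega) (by omega) (by omega), h5.2]
    · rw [g3 _ (by omega) (by omega) (by omega), h5.4]
    · rw [g3 _ (by omega) (by omega) (by omega), h5.5]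
    · rw [g3 _ (by omega) (by omega) (by omega), h5.6]
    · rw [g3 _ (by omega) (by omega) (by omega), h5.7]
    · rw [g3 _ (by omega) (by omega) (by omega), h5.8 i h4 h6 h7]
  intro s6 h6
  refine RunsIn.seq (Q := SetupInv f n k (8 * n + 8) (n * n) 8 1) (RunsIn.const ?_) ?_
  · refine ⟨h6.1, ?_, ?_, ?_, ?_, ?_, ?_, fun i h3 h4 h5 => ?_⟩ <;>
      simp [State.setReg_reg, Var.reg, Var.idx, h6.2, h6.3, h6.4, h6.5, h6.6]
    rw [if_neg (by omega), h6.8 i h3 h4 h5]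
  intro s7 h7
  refine RunsIn.seq (hadd h7 h7.2 (Or.inl rfl)) fun s8 h8 => ?_
  refine RunsIn.seq (hadd h8 h8.6 (Or.inr rfl)) fun s9 h9 => ?_
  refine RunsIn.seq (hadd h9 h9.6 (Or.inr rfl)) fun s10 h10 => ?_
  refine RunsIn.seq (hadd h10 h10.6 (Or.inr rfl)) fun s11 h11 => ?_
  refine RunsIn.const ⟨h11.1, ?_, ?_, fun v => ?_⟩
  · simp [State.setReg_reg, scratch, h11.3, Var.reg, Var.idx]
  · simp [State.setReg_reg, scratch, h11.4, Var.reg, Var.idx]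
  · rw [State.setReg_reg]
    cases v
    case order => exact h11.2
    case budget => exact h11.6
    case limit => exact h11.7.trans (by simp only [startValue]; omega)
    case one => rfl
    all_goals exact h11.8 _ (by decide) (by decide) (by decide)

end Input

end DFVS

/-! ### Running times of reading, searching and writing -/

namespace DFVS
open DFVS.Var DFVS.Rel

section Run
variable {n k m : ℕ}

/-- The invariant of the program `readInput` at the entry `(j, i)`. -/
structure ReadInv (G : Digraph (Fin n)) (k m j i : ℕ) (s : State) : Prop where
  size : s.reg (scratch 0) = m
  base : s.reg (scratch 1) = n * n
  env : ∀ v : Var, v ≠ x → v ≠ y → s.reg v.reg = startValue n k v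
  input : ∀ p < n * n, s.mem p = (inputState G k).mem p
  rel : RepRel (m := m) (n * n) s fun q a b =>
    q = edge ∧ (a.val < j ∨ a.val = j ∧ b.val < i) ∧ extendAdj m G a b

theorem ReadInv.sameBelow {G : Digraph (Fin n)} {j i : ℕ} {s s' : State}
    (h : ReadInv G k m j i s) (h' : SameBelow 2 s s') : ReadInv G k m j i s' := by
  refine ⟨(h'.reg_scratch (by omega)).trans h.1, (h'.reg_scratch (by omega)).trans h.2,
    fun v hx hy => (h'.reg_var v).trans (h.3 v hx hy), fun p hp => ?_, fun q a b => ?_⟩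
  · rw [h'.1, h.4 p hp]
  · rw [h'.1, h.5 q a b]

theorem ReadInv.setReg {G : Digraph (Fin n)} {j i : ℕ} {s : State} (h : ReadInv G k m j i s)
    {v : Var} (hv : v = x ∨ v = y) (a : ℕ) : ReadInv G k m j i (s.setReg v.reg a) := by
  refine ⟨?_, ?_, fun w hx hy => ?_, h.4, h.5⟩
  · rw [State.setReg_reg, if_neg (v.reg_ne_scratch 0).symm, h.1]
  · rw [State.setReg_reg, if_neg (v.reg_ne_scratch 1).symm, h.2]
  · rw [State.setReg_reg, if_neg, h.3 w hx hy]
    rw [Var.reg_inj]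
    rintro rfl
    exact hv.elim hx hy

/-- A bound for the running time of `readEntry`. -/
def readEntryCost (n m : ℕ) : ℕ := n * (3 * n + 4) + 3 * n + cellCost 1 m + 9

/-- A bound for the running time of `readInput`. -/
def readInputCost (n m : ℕ) : ℕ := m * ((m * (readEntryCost n m + 2) + 2) + 2) + 4

/-- Outside the `n × n` block nothing is written: the target cell is already zero and `extendAdj` is
false there. The input itself stays intact because all matrices begin behind it. -/
theorem runsIn_readEntry {G : Digraph (Fin n)} {j i : ℕ} (hj : j < m) (hi : i < m) {s : State}
    (h : ReadInv G k m j i s) (ex : s.reg x.reg = j) (ey : s.reg y.reg = i) :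
    RunsIn readEntry s (readEntryCost n m) fun s' =>
      ReadInv G k m j (i + 1) s' ∧ s'.reg x.reg = j ∧ s'.reg y.reg = i := by
  have hord : s.reg order.reg = n := h.3 order (by decide) (by decide)
  have hext : ∀ {a b : Fin m}, extendAdj m G a b → a.val < n ∧ b.val < n := by
    rintro a b ⟨v, w, hv, hw, -⟩
    exact ⟨hv ▸ v.2, hw ▸ w.2⟩
  have hskip : ¬ (j < n ∧ i < n) → ReadInv G k m j (i + 1) s := fun hn => by
    refine ⟨h.1, h.2, h.3, h.4, fun q a b => (h.5 q a b).trans (ind_congr ?_)⟩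
    refine and_congr_right fun _ => and_congr_left fun hab => ?_
    have := hext hab
    omega
  have e2 : edge.idx = 1 := rfl
  refine RunsIn.mono (T := 1 + (1 + (1 + ((n * (3 * n + 4) + 2) + ((3 * n + 2) +
    (1 + (cellCost 1 m + 1))))))) ?_ (by unfold readEntryCost; omega) (fun _ h => h)
  refine RunsIn.ite (fun hb => ?_) fun hb => RunsIn.mono (RunsIn.skip ⟨hskip ?_, ex, ey⟩)
    (by omega) fun _ h => h
  swap
  · simp only [Test.Holds, ex, hord] at hb
    omega
  refine RunsIn.ite (fun hb' => ?_) fun hb' => RunsIn.mono (RunsIn.skip ⟨hskip ?_, ex, ey⟩)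
    (by omega) fun _ h => h
  swap
  · simp only [Test.Holds, ey, hord] at hb'
    omega
  simp only [Test.Holds, ex, ey, hord] at hb hb'
  refine RunsIn.seq (Q := fun s' => SameBelow 2 s s' ∧ s'.reg (scratch 2) = 0)
    (RunsIn.const ⟨(SameBelow.refl 2 s).setReg le_rfl _, by simp [State.setReg_reg]⟩) ?_
  rintro s1 ⟨h1, g1⟩
  have hx1 : s1.reg x.reg = j := (h1.reg_var x).trans ex
  have ho1 : s1.reg order.reg = n := (h1.reg_var order).trans hord
  refine RunsIn.seq (Q := fun s' => SameBelow 2 s s' ∧ s'.reg (scratch 2) = j * n) ?_ ?_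
  · refine RunsIn.mono (runsIn_mulAddReg (Var.reg_ne_scratch _ _).symm
      (Var.reg_ne_scratch _ _).symm (by simp) (by simp) (Var.reg_ne_scratch _ _)
      (Var.reg_ne_scratch _ _) (Var.reg_ne_scratch _ _) (Var.reg_ne_scratch _ _) (by simp) s1)
      ?_ ?_
    · rw [hx1, ho1]
      have := Nat.mul_le_mul_right (3 * n + 4) hb.le
      omega
    · rintro s' ⟨f1, f2, f3⟩
      refine ⟨⟨f1.trans h1.1, fun q hq => ?_⟩, by rw [f2, g1, hx1, ho1, zero_add]⟩
      rw [f3 q (hq _ (by omega)) (hq _ (by omega)) (hq _ (by omega)), h1.2 q hq]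
  rintro s2 ⟨h2, g2⟩
  have hy2 : s2.reg y.reg = i := (h2.reg_var y).trans ey
  refine RunsIn.seq (Q := fun s' => SameBelow 2 s s' ∧ s'.reg (scratch 2) = j * n + i) ?_ ?_
  · refine RunsIn.mono (runsIn_addReg (Var.reg_ne_scratch _ _).symm (by simp)
      (Var.reg_ne_scratch _ _) s2) (by rw [hy2]; omega) ?_
    rintro s' ⟨f1, f2, f3⟩
    refine ⟨⟨f1.trans h2.1, fun q hq => ?_⟩, by rw [f2, g2, hy2]⟩
    rw [f3 q (hq _ (by omega)) (hq _ (by omega)), h2.2 q hq]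
  rintro s3 ⟨h3, g3⟩
  have hlt : j * n + i < n * n := by
    have := Nat.mul_le_mul_right n (Nat.succ_le_of_lt hb)
    rw [Nat.succ_mul] at this
    omega
  refine RunsIn.seq (Q := fun s' => SameBelow 2 s s' ∧
    s'.reg (scratch 2) = ind (extendAdj m G ⟨j, hj⟩ ⟨i, hi⟩))
    (RunsIn.load ⟨h3.setReg le_rfl _, ?_⟩) ?_
  · rw [State.setReg_reg, if_pos rfl, g3, h3.1, h.4 _ hlt]
    exact inputState_mem_entry G (a := ⟨j, hj⟩) (b := ⟨i, hi⟩) hb hb'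
  rintro s4 ⟨h4, g4⟩
  have hx4 : s4.reg (2 * x.idx) = j := (h4.reg_var x).trans ex
  have hy4 : s4.reg (2 * y.idx) = i := (h4.reg_var y).trans ey
  refine RunsIn.seq (runsIn_cellAddr (m := m) (r := 1) (x := x.idx) (y := y.idx) (by omega) s4
    ((h4.reg_scratch (by omega)).trans h.1) (by rw [hx4]; exact hj) (by rw [hy4]; exact hi)) ?_
  rintro s5 ⟨h5, g5⟩
  rw [hx4, hy4, h4.reg_scratch (by omega), h.2] at g5
  have h6 := h4.trans h5 (by omega)
  have hR := h.sameBelow h6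
  have g6 : s5.reg (scratch 2) = _ := (h5.reg_scratch (by omega)).trans g4
  refine RunsIn.store ⟨⟨hR.1, hR.2, hR.3, fun p hp => ?_, fun q a b => ?_⟩,
    (h6.reg_var x).trans ex, (h6.reg_var y).trans ey⟩
  · rw [State.setMem_mem, if_neg, hR.4 p hp]
    rw [g5, cell]
    omega
  · rw [State.setMem_mem, g5, g6]
    by_cases hc : q = edge ∧ a = ⟨j, hj⟩ ∧ b = ⟨i, hi⟩
    · obtain ⟨rfl, rfl, rfl⟩ := hc
      rw [if_pos (by rw [e2])]
      exact ind_congr (by simp)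
    · rw [if_neg, hR.5 q a b]
      · refine ind_congr (and_congr_right fun hq => and_congr_left fun _ => ?_)
        refine ⟨fun h => by omega, fun h => ?_⟩
        rcases h with h | ⟨h, h'⟩
        · exact Or.inl h
        · exact Or.inr ⟨h, lt_of_le_of_ne (by omega) fun hb => hc ⟨hq, Fin.ext h, Fin.ext hb⟩⟩
      · intro hc'
        obtain ⟨f1, f2, f3⟩ := cell_inj a.2 b.2 hj hi hc'
        exact hc ⟨Rel.idx_inj.1 f1, Fin.ext f2, Fin.ext f3⟩

theorem runsIn_readInput [NeZero m] (G : Digraph (Fin n)) (hk : k < n) (hm : 8 * n < m) {s : State}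
    (hmem : s.mem = (inputState G k).mem) (h0 : s.reg (scratch 0) = m)
    (h1 : s.reg (scratch 1) = n * n) (henv : ∀ v : Var, s.reg v.reg = startValue n k v) :
    RunsIn readInput s (readInputCost n m) fun s' =>
      Rep (n * n) s' (startConf m n k (extendAdj m G)) := by
  have hxy : x.reg ≠ y.reg := by decide
  refine RunsIn.mono (T := (m * ((m * (readEntryCost n m + 2) + 2) + 2) + 2) + (1 + 1)) ?_
    (by unfold readInputCost; omega) (fun _ h => h)
  refine RunsIn.seq (runsIn_forPairs (J := ReadInv G k m) hxy
    ⟨h0, h1, fun v _ _ => henv v, fun p _ => by rw [hmem], fun q a b => ?_⟩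
    (fun j i s' a h => h.setReg (Or.inl rfl) a) (fun j i s' a h => h.setReg (Or.inr rfl) a)
    (fun j i s' h => h.1) (fun j s' h => ⟨h.1, h.2, h.3, h.4, fun q a b => ?_⟩)
    fun j hj i hi s' h => runsIn_readEntry hj hi h) ?_
  · rw [hmem, inputState_mem_of_le G (by unfold cell; omega), ind_neg]
    rintro ⟨-, h, -⟩
    omega
  · rw [h.5 q a b]
    refine ind_congr (and_congr_right fun _ => and_congr_left fun _ => ?_)
    have := b.2
    omega
  rintro s1 h2
  refine RunsIn.seq (Q := fun s' => s' = s1.setReg x.reg 0) (RunsIn.const rfl) ?_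
  rintro _ rfl
  have h3 := (h2.setReg (Or.inl rfl) 0 (v := x)).setReg (Or.inr rfl) 0 (v := y)
  refine RunsIn.const ⟨⟨h3.1, h3.2, fun v => ?_⟩, fun q a b => ?_⟩
  · rw [startConf_env hk hm]
    by_cases hx : v = x
    · subst hx; rfl
    by_cases hy : v = y
    · subst hy; rfl
    exact h3.3 v hx hy
  · rw [h3.5 q a b]
    refine ind_congr ?_
    by_cases hq : q = edge <;> simp [hq, startConf]

/-- `LoopInv.solves` provides the exact number of iterations, as `RunsIn.loop` demands; afterwards
it is estimated by the potential. -/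
theorem runsIn_search [NeZero m] {σ : Conf m} {g : Fin m → Fin m} (h : LoopInv σ g) {base : ℕ}
    {s : State} (hz : σ.env zero = 0) (hs : Rep base s σ) :
    RunsIn search s (σ.potential g * (body.cost m + 1) + 1) fun s' =>
      ∃ τ, Rep base s' τ ∧ SameTask σ τ ∧ Solved τ := by
  obtain ⟨j, hj, h1, h2⟩ := h.solves
  have hval : ∀ {i : ℕ} {s' : State}, Rep base s' (body.eval^[i] σ) →
      (Test.Holds (.eq halt.reg zero.reg) s' ↔ (body.eval^[i] σ).env halt = 0) := fun {i s'} hr => by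
    rw [Test.Holds, hr.1.2.2, hr.1.2.2, (sameTask_iterate σ i).4, hz, Fin.val_inj]
  refine RunsIn.mono (RunsIn.loop (I := fun i s' => Rep base s' (body.eval^[i] σ)) hs
    (fun i hi s' hr => ⟨(hval hr).2 (h1 i hi), ?_⟩)
    fun s' hr hh => h2.halt_ne ((hval hr).1 hh))
    (Nat.add_le_add_right (Nat.mul_le_mul_right _ hj) 1)
    fun s' hr => ⟨_, hr, sameTask_iterate σ j, h2⟩
  refine RunsIn.mono (body.runsIn_compile le_rfl hr) le_rfl fun s'' h' => ?_
  rw [Function.iterate_succ_apply']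
  exact h'.1

/-- A bound for the running time of `writeOutput`. -/
def writeOutputCost (n m : ℕ) : ℕ := n * (cellCost 2 m + 4) + 3

/-- The output overwrites cells below `n`, and `n ≤ n * n`; so the matrix of `sol`, which lies
behind the base address, can be read while the answer is written. -/
theorem runsIn_writeOutput {s : State} {σ : Conf m} (hs : Rep (n * n) s σ)
    (hn : (σ.env order).val = n) (hnm : n ≤ m) :
    RunsIn writeOutput s (writeOutputCost n m) fun s' =>
      s'.reg 0 = (σ.env found).val ∧
        ∀ v : Fin n, s'.mem v.val = ind (σ.set sol (Fin.castLE hnm v)) := by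
  refine RunsIn.mono (T := 1 + ((n * ((cellCost 2 m + (1 + (1 + 1))) + 1) + 1) + 1)) ?_
    (by unfold writeOutputCost; ring_nf; omega) (fun _ h => h)
  refine RunsIn.seq (Q := fun s' => s' = s.setReg x.reg 0) (RunsIn.const rfl) ?_
  rintro _ rfl
  refine RunsIn.seq (RunsIn.loop (N := n) (T := cellCost 2 m + (1 + (1 + 1)))
    (I := fun j s' => s'.reg x.reg = j ∧ s'.reg order.reg = n ∧
      s'.reg found.reg = (σ.env found).val ∧ s'.reg (scratch 0) = m ∧ s'.reg (scratch 1) = n * n ∧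
      (∀ p, n * n ≤ p → s'.mem p = s.mem p) ∧
      ∀ v : Fin n, v.val < j → s'.mem v.val = ind (σ.set sol (Fin.castLE hnm v))) ?_ ?_ ?_) ?_
  · refine ⟨by simp [State.setReg_reg], ?_, ?_, ?_, ?_, fun p _ => rfl, fun v hv => by omega⟩
    · rw [State.setReg_reg, if_neg (by decide), hs.1.2.2, hn]
    · rw [State.setReg_reg, if_neg (by decide), hs.1.2.2]
    · rw [State.setReg_reg, if_neg (by decide), hs.1.1]
    · rw [State.setReg_reg, if_neg (by decide), hs.1.2.1]
  · rintro j hj s1 ⟨e1, e2, e3, e4, e5, e6, e7⟩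
    refine ⟨by rw [Test.Holds, e1, e2]; exact hj, ?_⟩
    have ex : s1.reg (2 * x.idx) = j := e1
    refine RunsIn.seq (runsIn_cellAddr (m := m) (r := 2) (x := x.idx) (y := x.idx) le_rfl s1 e4
      (by omega) (by omega)) ?_
    rintro s2 ⟨h2, g2⟩
    rw [ex, e5] at g2
    refine RunsIn.seq (Q := fun s' => SameBelow 2 s1 s' ∧
      s'.reg (scratch 2) = ind (σ.set sol ⟨j, hj.trans_le hnm⟩))
      (RunsIn.load ⟨h2.setReg le_rfl _, ?_⟩) ?_
    · rw [State.setReg_reg, if_pos rfl, g2, h2.1, e6 _ (by unfold cell; omega)]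
      exact hs.2 sol ⟨j, hj.trans_le hnm⟩ ⟨j, hj.trans_le hnm⟩
    rintro s3 ⟨h3, g3⟩
    have ex3 : s3.reg x.reg = j := (h3.reg_var x).trans e1
    refine RunsIn.seq (Q := fun s' => s' = s3.setMem (s3.reg x.reg) (s3.reg (scratch 2)))
      (RunsIn.store rfl) ?_
    rintro _ rfl
    refine RunsIn.succ ⟨?_, ?_, ?_, ?_, ?_, fun p hp => ?_, fun v hv => ?_⟩
    · rw [State.setReg_reg, if_pos rfl, State.setMem_reg, ex3]
    · rw [State.setReg_reg, if_neg (by decide), State.setMem_reg, h3.reg_var, e2]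
    · rw [State.setReg_reg, if_neg (by decide), State.setMem_reg, h3.reg_var, e3]
    · rw [State.setReg_reg, if_neg (by decide), State.setMem_reg, h3.reg_scratch (by omega), e4]
    · rw [State.setReg_reg, if_neg (by decide), State.setMem_reg, h3.reg_scratch (by omega), e5]
    · rw [State.setReg_mem, State.setMem_mem, if_neg, h3.1, e6 p hp]
      have := Nat.le_mul_self n
      omega
    · rw [State.setReg_mem, State.setMem_mem, ex3, g3]
      split_ifs with hvj
      · exact ind_congr (by rw [show Fin.castLE hnm v = ⟨j, hj.trans_le hnm⟩ from Fin.ext hvj])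
      · rw [h3.1, e7 v (by omega)]
  · rintro s1 ⟨e1, e2, -⟩
    rw [Test.Holds, e1, e2]
    exact lt_irrefl n
  · rintro s1 ⟨-, -, e3, -, -, -, e7⟩
    refine RunsIn.copy ⟨?_, fun v => e7 v v.2⟩
    rw [← e3]
    rfl

theorem runsIn_writeAll {s : State} (hn : s.reg 0 = n) :
    RunsIn writeAll s (3 * n + 4) fun s' => s'.reg 0 = 1 ∧ ∀ v : Fin n, s'.mem v.val = 1 := by
  refine RunsIn.mono (T := 1 + (1 + ((n * ((1 + 1) + 1) + 1) + 1))) ?_ (by omega) (fun _ h => h)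
  refine RunsIn.seq (Q := fun s' => s' = s.setReg 2 0) (RunsIn.const rfl) ?_
  rintro _ rfl
  refine RunsIn.seq (Q := fun s' => s' = (s.setReg 2 0).setReg 4 1) (RunsIn.const rfl) ?_
  rintro _ rfl
  refine RunsIn.seq (RunsIn.loop (N := n) (T := 1 + 1) (I := fun j s' => s'.reg 0 = n ∧
    s'.reg 2 = j ∧ s'.reg 4 = 1 ∧ ∀ p < j, s'.mem p = 1) ?_ ?_ ?_) ?_
  · exact ⟨by simp [State.setReg_reg, hn], by simp [State.setReg_reg], by simp [State.setReg_reg],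
      fun p hp => by omega⟩
  · rintro j hj s1 ⟨e0, e2, e4, e5⟩
    refine ⟨by rw [Test.Holds, e0, e2]; exact hj, ?_⟩
    refine RunsIn.seq (Q := fun s' => s' = s1.setMem (s1.reg 2) (s1.reg 4)) (RunsIn.store rfl) ?_
    rintro _ rfl
    refine RunsIn.succ ⟨by simp [State.setReg_reg, e0], by simp [State.setReg_reg, e2],
      by simp [State.setReg_reg, e4], fun p hp => ?_⟩
    rw [State.setReg_mem, State.setMem_mem, e2, e4]
    split_ifs with h
    · rfl
    · exact e5 p (by omega)
  · rintro s1 ⟨e0, e2, -⟩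
    rw [Test.Holds, e0, e2]
    exact lt_irrefl n
  · rintro s1 ⟨-, -, -, e5⟩
    exact RunsIn.const ⟨by simp [State.setReg_reg], fun v => e5 v v.2⟩

end Run

end DFVS

/-! ### The total running time and the final answer -/

namespace DFVS
open DFVS.Var DFVS.Rel

section Solve
variable {n k : ℕ}

/-- A bound for the running time of the solver, except for the factor `8 ^ k * k !`. -/
def solverCost (n : ℕ) : ℕ :=
  setupCost n + readInputCost n (8 * n + 8) + prepare.cost (8 * n + 8) +
    2 * (n * n) * (body.cost (8 * n + 8) + 1) + writeOutputCost n (8 * n + 8) + 3 * n + 6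

theorem isPoly_solverCost : IsPoly solverCost := by
  have hm : IsPoly fun n => 8 * n + 8 := ((IsPoly.const 8).mul .id).add (.const 8)
  have h3 : IsPoly fun n => n * (3 * n + 4) :=
    IsPoly.id.mul (((IsPoly.const 3).mul .id).add (.const 4))
  have h1 : IsPoly setupCost := (h3.add ((IsPoly.const 36).mul .id)).add (.const 51)
  have h2 : IsPoly fun n => readEntryCost n (8 * n + 8) :=
    ((h3.add ((IsPoly.const 3).mul .id)).add ((isPoly_cellCost 1).comp hm)).add (.const 9)
  have h4 : IsPoly fun n => readInputCost n (8 * n + 8) :=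
    (hm.mul ((hm.mul (h2.add (.const 2))).add (.const 2) |>.add (.const 2))).add (.const 4)
  have h5 : IsPoly fun n => writeOutputCost n (8 * n + 8) :=
    (IsPoly.id.mul (((isPoly_cellCost 2).comp hm).add (.const 4))).add (.const 3)
  exact ((((((h1.add h4).add (prepare.isPoly_cost.comp hm)).add
    (((IsPoly.const 2).mul (IsPoly.id.mul .id)).mul ((body.isPoly_cost.comp hm).add
      (.const 1)))).add h5).add ((IsPoly.const 3).mul .id)).add (.const 6))

/-- The bound equals `2 * (k + 1) * (8 ^ k * k!)`, and `k + 1 ≤ n` turns the extra factor into a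
polynomial in `n`. -/
theorem adviceBound_le (hk : k < n) : adviceBound k ≤ 2 * n * (8 ^ k * k.factorial) := by
  have : adviceBound k = 2 * (k + 1) * (8 ^ k * k.factorial) := by
    rw [adviceBound, Nat.factorial_succ, pow_succ, pow_mul]
    ring
  rw [this]
  gcongr
  omega

theorem runsIn_solver_of_lt (hk : k < n) (G : Digraph (Fin n)) :
    RunsIn solver (inputState G k) (8 ^ k * k.factorial * solverCost n) fun s =>
      IsCorrectAnswer G k (answer n s) := by
  classical
  obtain ⟨m, hm⟩ : ∃ m, m = 8 * n + 8 := ⟨_, rfl⟩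
  have : NeZero m := ⟨by omega⟩
  have hlt : 8 * n < m := by omega
  have hnm : n ≤ m := by omega
  set σ := startConf m n k (extendAdj m G) with hσ
  have hmod : ∀ v, (prepare.eval σ).env v = σ.env v := fun v =>
    Cmd.eval_env (by simp [prepare, Cmd.ModVar]) σ
  have hedge : (prepare.eval σ).rel edge = extendAdj m G :=
    Cmd.eval_rel (by simp [prepare, Cmd.ModRel]) σ
  have henv : ∀ v, (σ.env v).val = startValue n k v := startConf_env hk hlt _
  have hinv := loopInv_start hk hlt G
  set A := 8 ^ k * k.factorial with hA
  have hA1 : 1 ≤ A := Nat.mul_pos (by positivity) k.factorial_pos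
  have hpot := hinv.potential_le
  rw [← hσ, hmod, hmod, henv, henv] at hpot
  have hN : (prepare.eval σ).potential (fun i => least (σ.admissible i)) ≤ A * (2 * (n * n)) := by
    refine hpot.trans ((Nat.mul_le_mul_left n (adviceBound_le hk)).trans (le_of_eq ?_))
    ring
  refine RunsIn.mono (T := 1 + (setupCost n + (readInputCost n m + (prepare.cost m +
    ((A * (2 * (n * n)) * (body.cost m + 1) + 1) + writeOutputCost n m))))) ?_ ?_ (fun _ h => h)
  rotate_left
  -- All costs outside the search are multiplied by `A ≥ 1`, so that the common factor can be taken
  -- out.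
  · have h1 : setupCost n + readInputCost n m + prepare.cost m + writeOutputCost n m + 2 ≤
        A * (setupCost n + readInputCost n m + prepare.cost m + writeOutputCost n m + 2) :=
      Nat.le_mul_of_pos_left _ hA1
    have h2 : A * (setupCost n + readInputCost n m + prepare.cost m + writeOutputCost n m + 2) +
        A * (2 * (n * n)) * (body.cost m + 1) ≤ A * solverCost n := by
      rw [mul_assoc A, ← mul_add, solverCost, ← hm]
      exact Nat.mul_le_mul_left A (by omega)
    omega
  refine RunsIn.ite (fun _ => ?_) (fun hb => absurd ?_ hb)
  swap
  · simpa [Test.Holds, inputState] using hk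
  refine RunsIn.seq (runsIn_setup G hk) ?_
  rintro s1 ⟨h1, h2, h3, h4⟩
  refine RunsIn.seq (runsIn_readInput (m := m) G hk hlt h1 (h2.trans hm.symm) h3 h4) fun s2 h5 => ?_
  refine RunsIn.seq (prepare.runsIn_compile le_rfl h5) ?_
  rintro s3 ⟨h6, -⟩
  refine RunsIn.seq (RunsIn.mono (runsIn_search hinv ?_ h6)
    (Nat.add_le_add_right (Nat.mul_le_mul_right _ hN) 1) fun _ h => h) ?_
  · rw [← hσ, hmod]
    exact Fin.ext (henv zero)
  rintro s4 ⟨τ, h7, h8, h9⟩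
  have e1 : τ.rel edge = extendAdj m G := h8.1.trans hedge
  have e2 : (τ.env order).val = n := by rw [h8.2, hmod, henv]; rfl
  have e3 : (τ.env budget).val = k := by rw [h8.3, hmod, henv]; rfl
  refine RunsIn.mono (runsIn_writeOutput h7 e2 hnm) le_rfl ?_
  rintro s5 ⟨h10, h11⟩
  by_cases hf : τ.env found = 0
  · have h12 := h9.of_not_found hf
    rw [answer, if_pos (by rw [h10, hf]; rfl)]
    rintro ⟨S, hS, hSk⟩
    refine h12 ⟨fun a => ∃ v ∈ S, Fin.castLE hnm v = a, ?_, ?_⟩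
    · rw [e1, hits_extendAdj hnm]
      have e : (fun v => ∃ w ∈ S, Fin.castLE hnm w = Fin.castLE hnm v) = fun v => v ∈ S := by
        ext v
        simp
      rw [e]
      exact (isFeedbackVertexSet_iff G S).1 hS
    · rw [e3]
      exact (count_exists_castLE_le hnm S).trans hSk
  · obtain ⟨h12, h13⟩ := h9.of_found hf
    rw [answer, if_neg (by rw [h10]; exact fun h => hf (Fin.ext h))]
    have e : (fun v : Fin n => v ∈ Finset.univ.filter fun v : Fin n => s5.mem v.val ≠ 0) =
        fun v => τ.set sol (Fin.castLE hnm v) := by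
      ext v
      simp [h11]
    refine ⟨(isFeedbackVertexSet_iff G _).2 ?_, ?_⟩
    · rw [e]
      rwa [e1, hits_extendAdj hnm] at h12
    · have h14 := (count_castLE_le hnm (τ.set sol)).trans (e3 ▸ h13)
      rw [← e, count_eq_card] at h14
      simpa using h14

/-- The set of all vertices is within the budget and meets every cycle, since cycles are nonempty.
-/
theorem runsIn_solver_of_le (hk : n ≤ k) (G : Digraph (Fin n)) :
    RunsIn solver (inputState G k) (8 ^ k * k.factorial * solverCost n) fun s =>
      IsCorrectAnswer G k (answer n s) := by
  have h1 : solverCost n ≤ 8 ^ k * k.factorial * solverCost n :=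
    Nat.le_mul_of_pos_left _ (Nat.mul_pos (by positivity) k.factorial_pos)
  refine RunsIn.mono (T := 1 + (3 * n + 4)) (RunsIn.ite (fun hb => absurd hb ?_) fun _ =>
    runsIn_writeAll (by simp [inputState])) (by rw [solverCost] at *; omega) ?_
  · simp [Test.Holds, inputState, hk]
  · rintro s ⟨h2, h3⟩
    have e : (Finset.univ.filter fun v : Fin n => s.mem v.val ≠ 0) = Finset.univ := by
      simp [h3]
    rw [answer, if_neg (by omega), e]
    refine ⟨fun c hc => ?_, by simpa using hk⟩
    by_contra! hcon
    refine hc.1 ?_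
    induction c using Quotient.inductionOn' with
    | h l =>
      refine (Cycle.coe_eq_nil _).2 (List.eq_nil_iff_forall_not_mem.2 fun v hv => ?_)
      exact hcon v (Cycle.mem_coe_iff.2 hv) (Finset.mem_univ v)

theorem exists_solvableInTime :
    ∃ p : Polynomial ℕ, SolvableInTime fun n k => 8 ^ k * k.factorial * p.eval n := by
  obtain ⟨p, hp⟩ := isPoly_solverCost
  refine ⟨p, solver, fun n G k => ?_⟩
  simp only [← hp]
  rcases lt_or_ge k n with hk | hk
  · exact runsIn_solver_of_lt hk G
  · exact runsIn_solver_of_le hk G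

end Solve

end DFVS

theorem mainTheorem1 :
    DFVS.FixedParameterTractable ∧
      ∃ p : Polynomial ℕ,
        DFVS.SolvableInTime fun n k => 8 ^ k * Nat.factorial k * p.eval n := by
  obtain ⟨p, hp⟩ := DFVS.exists_solvableInTime
  exact ⟨⟨fun k => 8 ^ k * k.factorial, p, hp⟩, p, hp⟩
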